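/- Let $\mathrm{GF}(q)$ be a finite field with $q\neq 2$, and let $D,N$ be integers with $N>2D\geq 6$. Let $X$ be the set of $D\times(N-D)$ matrices over $\mathrm{GF}(q)$, and let $\Gamma$ be the bilinear forms graph $H_q(D,N-D)$: it has vertex set $X$, and two vertices are adjacent if and only if their difference has rank $1$. Let $\partial$ be the path-length distance of $\Gamma$, and put $\Gamma_i(z)=\{w\in X\mid \partial(z,w)=i\}$ and $\Gamma(z)=\Gamma_1(z)$. Let $V=\mathbb R^X$ with the bilinear form $\langle u,v\rangle=u^tv$. For $z\in X$ let $\hat z\in V$ be the vector with $z$-coordinate $1$ and all other coordinates $0$, and for $\Omega\subseteq X$ put $\widehat\Omega=\sum_{z\in\Omega}\hat z$. Let $A$ be the adjacency matrix of $\Gamma$, let $\theta_1$ be its second largest eigenvalue, and let $E$ be the primitive idempotent of $A$ for $\theta_1$, that is, the matrix that acts as the identity on the $\theta_1$-eigenspace of $A$ and as $0$ on every other eigenspace of $A$. The Norton product on $EV$ is $u\star v=E(u\circ v)$, where $\circ$ is the entrywise product. Fix $x,y\in X$ such that $k=\partial(x,y)$ satisfies $2\leq k\leq D-1$. Define $O_1=\Gamma(x)\cap\Gamma_{k-1}(y)$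 and $O_6=\Gamma(x)\cap\Gamma_{k+1}(y)$. For $z\in\Gamma(x)\cap\Gamma_k(y)$ put $m_\pm(z)=|\Gamma(x)\cap\Gamma(z)\cap\Gamma_{k\pm1}(y)|$, and let $O_2,O_3,O_4,O_5$ be the sets of those $z\in\Gamma(x)\cap\Gamma_k(y)$ for which $(m_-(z),m_+(z))$ equals, respectively, $$(2q^{k-1},\,0),\qquad (2q^{k-1}-1,\,0),\qquad (q^{k-1},\,q^D-q^k),\qquad (q^{k-1},\,q^{N-D}-q^k).$$ Let $S=\mathrm{Span}\{E\widehat O_i\mid 1\leq i\leq 6\}$ and $\omega=\sum_{i=1}^6\omega_iE\widehat O_i$, where $$\omega_1=\omega_3=\frac{(q^D-q^k)(q^{N-D}-q^k)(q^{k-1}-1)}{q^k(q-1)},\qquad \omega_2=\frac{(q^D-q^k)(q^{N-D}-q^k)}{q(q-1)},$$ $$\omega_4=-\frac{(q^D-q^k)(q^{k-1}-1)}{q-1},\qquad \omega_5=-\frac{(q^{N-D}-q^k)(q^{k-1}-1)}{q-1},\qquad \omega_6=\frac{(q^k-1)(q^{k-1}-1)}{q-1}.$$ Let $\omega^\perp=\{v\in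 S\mid\langle\omega,v\rangle=0\}$. Then the subspace $\omega^\perp$ has a basis $$E\hat y,\quad E\hat x\star E\hat y,\quad E\hat x\star(E\hat x\star E\hat y),\quad E\hat x\star(E\hat x\star(E\hat x\star E\hat y)),\quad E\hat x\star(E\hat x\star(E\hat x\star(E\hat x\star E\hat y)))$$ and another basis $$E\hat x,\quad E\hat y\star E\hat x,\quad E\hat y\star(E\hat y\star E\hat x),\quad E\hat y\star(E\hat y\star(E\hat y\star E\hat x)),\quad E\hat y\star(E\hat y\star(E\hat y\star(E\hat y\star E\hat x))).$$ -/

import Mathlib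

open scoped Matrix

noncomputable section

/-! ### Graph-theoretic notions for a finite graph -/

section Graph

variable {X : Type*} [Fintype X]

open Classical in
/-- The real adjacency matrix of a graph: the `(x, y)`-entry is `1` if `x, y` are adjacent, and
`0` otherwise. -/
def adjacencyMatrix (Γ : SimpleGraph X) : Matrix X X ℝ := Γ.adjMatrix ℝ

open Classical in
/-- The set of eigenvalues of a square real matrix. -/
def matrixEigenvalues (A : Matrix X X ℝ) : Set ℝ :=
  {θ | Module.End.HasEigenvalue (Matrix.toLin' A) θ}

/-- The second largest element `θ₁` of the set `θ₀ > θ₁ > ⋯` of eigenvalues of the adjacency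
matrix of `Γ` (a finite set). -/
def secondEigenvalue (Γ : SimpleGraph X) : ℝ :=
  sSup {θ | θ ∈ matrixEigenvalues (adjacencyMatrix Γ) ∧
    θ < sSup (matrixEigenvalues (adjacencyMatrix Γ))}

open Classical in
/-- The matrix that represents the orthogonal projection of `ℝ^X` onto the `θ`-eigenspace of `A`.
For symmetric `A` this is the matrix that acts as the identity on the `θ`-eigenspace of `A`, and
as `0` on every other eigenspace of `A`; see `primitiveIdempotent_mulVec_self` and
`primitiveIdempotent_mulVec_of_ne`. -/
def primitiveIdempotent (A : Matrix X X ℝ) (θ : ℝ) : Matrix X X ℝ :=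
  Matrix.toEuclideanLin.symm
    ((Module.End.eigenspace (Matrix.toEuclideanLin A) θ).starProjection :
      EuclideanSpace ℝ X →ₗ[ℝ] EuclideanSpace ℝ X)

open Classical in
theorem primitiveIdempotent_mulVec (A : Matrix X X ℝ) (θ : ℝ) (v : X → ℝ) :
    primitiveIdempotent A θ *ᵥ v = WithLp.ofLp
      ((Module.End.eigenspace (Matrix.toEuclideanLin A) θ).starProjection (WithLp.toLp 2 v)) := by
  have h : Matrix.toEuclideanLin (primitiveIdempotent A θ) =
      ((Module.End.eigenspace (Matrix.toEuclideanLin A) θ).starProjection :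
        EuclideanSpace ℝ X →ₗ[ℝ] EuclideanSpace ℝ X) :=
    LinearEquiv.apply_symm_apply _ _
  have h2 := congrArg (fun f => WithLp.ofLp (f (WithLp.toLp 2 v))) h
  simpa using h2

theorem primitiveIdempotent_mulVec_self (A : Matrix X X ℝ) (θ : ℝ) (v : X → ℝ)
    (hv : A *ᵥ v = θ • v) : primitiveIdempotent A θ *ᵥ v = v := by
  classical
  rw [primitiveIdempotent_mulVec, Submodule.starProjection_eq_self_iff.mpr]
  rw [Module.End.mem_eigenspace_iff, Matrix.toLpLin_apply]
  simp [hv]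

theorem primitiveIdempotent_mulVec_of_ne (A : Matrix X X ℝ) (hA : A.IsSymm) (θ μ : ℝ)
    (hμ : μ ≠ θ) (v : X → ℝ) (hv : A *ᵥ v = μ • v) : primitiveIdempotent A θ *ᵥ v = 0 := by
  classical
  rw [primitiveIdempotent_mulVec, (Submodule.starProjection_apply_eq_zero_iff _).mpr]
  · rfl
  · have hS : (Matrix.toEuclideanLin A).IsSymmetric :=
      Matrix.isSymmetric_toEuclideanLin_iff.mpr (by
        rw [Matrix.IsHermitian, Matrix.conjTranspose_eq_transpose_of_trivial]; exact hA)
    have hm : WithLp.toLp 2 v ∈ Module.End.eigenspace (Matrix.toEuclideanLin A) μ := by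
      rw [Module.End.mem_eigenspace_iff, Matrix.toLpLin_apply]
      simp [hv]
    rw [Submodule.mem_orthogonal]
    intro u hu
    have := hS.orthogonalFamily_eigenspaces.pairwise hμ.symm
    exact this.inner_eq hu hm

/-- The vector `Ω̂ = ∑_{z ∈ Ω} ẑ` in `ℝ^X`, the characteristic vector of `Ω ⊆ X`. -/
def setVec (Ω : Set X) : X → ℝ := Ω.indicator 1

/-- The vector `x̂` in `ℝ^X`, with `x`-coordinate `1` and all other coordinates `0`. -/
def hatVec (x : X) : X → ℝ := setVec {x}

/-- The matrix `E` of `Γ`: the primitive idempotent of the adjacency matrix for its second largest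
eigenvalue `θ₁`. -/
def matE (Γ : SimpleGraph X) : Matrix X X ℝ :=
  primitiveIdempotent (adjacencyMatrix Γ) (secondEigenvalue Γ)

/-- The Norton product `u ⋆ v = E (u ∘ v)`, where `∘` is the entrywise product. It is used only
for `u, v` in the Norton algebra `EV`. -/
def nortonMul (Γ : SimpleGraph X) (u v : X → ℝ) : X → ℝ := matE Γ *ᵥ (u * v)

/-- `nortonIter Γ x y l` is `E x̂ ⋆ (E x̂ ⋆ ⋯ ⋆ (E x̂ ⋆ E ŷ))`, with `l` factors `E x̂`. -/
def nortonIter (Γ : SimpleGraph X) (x y : X) : ℕ → X → ℝ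
  | 0 => matE Γ *ᵥ hatVec y
  | l + 1 => nortonMul Γ (matE Γ *ᵥ hatVec x) (nortonIter Γ x y l)

/-- The set `Γᵢ(x)` of vertices at path-length distance `i` from `x`. -/
def distSet (Γ : SimpleGraph X) (i : ℕ) (x : X) : Set X := {y | Γ.dist x y = i}

end Graph

/-! ### The bilinear forms graph -/

section BilinearForms

/-- The bilinear forms graph `H_q(D, N - D)`: the vertices are the `D × (N - D)` matrices over `F`,
and two vertices are adjacent whenever their difference has rank one. -/
def bilinearFormsGraph (F : Type*) [Field F] (D N : ℕ) :
    SimpleGraph (Matrix (Fin D) (Fin (N - D)) F) where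
  Adj x y := (x - y).rank = 1
  symm := ⟨fun x y h => by
    have h2 : y - x = (-1 : F) • (x - y) := by simp
    rw [h2, Matrix.rank_smul_of_mem_nonZeroDivisors _ (by simp)]
    exact h⟩
  loopless := ⟨fun x h => by simp at h⟩

variable {F : Type*} [Field F] [Fintype F] {D N : ℕ}

/-- The `y`-partition `O₁, …, O₆` of the local graph `Γ(x)` (indexed by `0, …, 5`), where
`q = |F|` and `k = ∂(x, y)`. -/
def yPart (x y : Matrix (Fin D) (Fin (N - D)) F) : Fin 6 → Set (Matrix (Fin D) (Fin (N - D)) F) :=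
  let Γ := bilinearFormsGraph F D N
  let q := Fintype.card F
  let k := Γ.dist x y
  -- the numbers of common neighbours of `x` and `z` in `Γ_{k-1}(y)` and in `Γ_{k+1}(y)`
  let lower := fun z => (distSet Γ 1 x ∩ distSet Γ 1 z ∩ distSet Γ (k - 1) y).ncard
  let upper := fun z => (distSet Γ 1 x ∩ distSet Γ 1 z ∩ distSet Γ (k + 1) y).ncard
  ![distSet Γ 1 x ∩ distSet Γ (k - 1) y,
    {z ∈ distSet Γ 1 x ∩ distSet Γ k y | lower z = 2 * q ^ (k - 1) ∧ upper z = 0},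
    {z ∈ distSet Γ 1 x ∩ distSet Γ k y | lower z = 2 * q ^ (k - 1) - 1 ∧ upper z = 0},
    {z ∈ distSet Γ 1 x ∩ distSet Γ k y | lower z = q ^ (k - 1) ∧ upper z = q ^ D - q ^ k},
    {z ∈ distSet Γ 1 x ∩ distSet Γ k y | lower z = q ^ (k - 1) ∧ upper z = q ^ (N - D) - q ^ k},
    distSet Γ 1 x ∩ distSet Γ (k + 1) y]

/-- The subspace `S = S(x, y)` spanned by the vectors `E Ôᵢ`. -/
def subspaceS (x y : Matrix (Fin D) (Fin (N - D)) F) :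
    Submodule ℝ (Matrix (Fin D) (Fin (N - D)) F → ℝ) :=
  Submodule.span ℝ (Set.range fun i : Fin 6 =>
    matE (bilinearFormsGraph F D N) *ᵥ setVec (yPart x y i))

/-- The coefficients `ω₁, …, ω₆` (indexed by `0, …, 5`), in terms of the real numbers
`q`, `a = q ^ D`, `b = q ^ (N - D)` and the natural number `k`. -/
def omegaCoeff (q a b : ℝ) (k : ℕ) : Fin 6 → ℝ :=
  ![(a - q ^ k) * (b - q ^ k) * (q ^ (k - 1) - 1) / (q ^ k * (q - 1)),
    (a - q ^ k) * (b - q ^ k) / (q * (q - 1)),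
    (a - q ^ k) * (b - q ^ k) * (q ^ (k - 1) - 1) / (q ^ k * (q - 1)),
    -((a - q ^ k) * (q ^ (k - 1) - 1) / (q - 1)),
    -((b - q ^ k) * (q ^ (k - 1) - 1) / (q - 1)),
    (q ^ k - 1) * (q ^ (k - 1) - 1) / (q - 1)]

/-- The vector `ω = ω(x, y) = ∑ᵢ ωᵢ E Ôᵢ`. -/
def omegaVec (x y : Matrix (Fin D) (Fin (N - D)) F) : Matrix (Fin D) (Fin (N - D)) F → ℝ :=
  ∑ i : Fin 6,
    omegaCoeff (Fintype.card F) ((Fintype.card F : ℝ) ^ D) ((Fintype.card F : ℝ) ^ (N - D))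
      ((bilinearFormsGraph F D N).dist x y) i •
    (matE (bilinearFormsGraph F D N) *ᵥ setVec (yPart x y i))

/-- The orthogonal complement `ω^⊥ = {v ∈ S | ⟨ω, v⟩ = 0}` of `ω` in `S`, with respect to the
standard bilinear form `⟨u, v⟩ = uᵗ v`. -/
def omegaPerp (x y : Matrix (Fin D) (Fin (N - D)) F) :
    Submodule ℝ (Matrix (Fin D) (Fin (N - D)) F → ℝ) where
  carrier := {v | v ∈ subspaceS x y ∧ omegaVec x y ⬝ᵥ v = 0}
  add_mem' := fun ha hb => ⟨add_mem ha.1 hb.1, by rw [dotProduct_add, ha.2, hb.2, add_zero]⟩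
  zero_mem' := ⟨zero_mem _, dotProduct_zero _⟩
  smul_mem' := fun c _ h => ⟨Submodule.smul_mem _ c h.1, by rw [dotProduct_smul, h.2, smul_zero]⟩

end BilinearForms

end

/-! The proof is Fourier analysis on the additive group X of matrices. The graph is a Cayley graph,
so each character `matChar a` is an eigenvector, with an eigenvalue that depends only on the rank of
a and strictly decreases with it. Hence EV corresponds to the characters with a of rank one, and a
vector of EV is `charTransform x g` for a function g on the rank-one matrices. In this picture E x̂
has constant coefficients, E ŷ has coefficients f(a) = `matChar a (y - x)`, and Norton
multiplication by E x̂ is, up to a factor 1/|X|, the operator `localSum`: adjacency restricted to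
the rank-one matrices (`ofReal_nortonMul`).

Put d = y - x. The operator `localSum` preserves the span of five functions of a: f, the indicators
of tr(aᵀd) = 0, of aᵀd = 0 and of adᵀ = 0, and the constant 1 (`localSum_basicComb`). There it is
triangular with the distinct eigenvalues -1, -q, q^(N-D) - q - 1, q^D - q - 1, q^D + q^(N-D) - q -
2, and f has a nonzero component for each of them (`localStep_iterate`). A Vandermonde argument then
makes the five iterates independent, provided that the five functions are independent. This is where
q ≠ 2 enters: for q = 2 the function f is twice the first indicator minus 1.

It remains to place the iterates in ω^⊥. With a full-rank factorization d = PQ, a neighbour x + prᵀ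
of x belongs to O_i according to the position of p relative to the column space of P, and of r
relative to the row space of Q (`mem_yPart_iff`). This makes the character sums over O_i computable,
and the five functions turn out to be combinations of them, so the iterates lie in S
(`basicComb_mem_span`). Any w in EV with coefficients in the five-function span is constant on each
O_i, and ⟨EÔ_i, w⟩ is the sum of w over O_i; the weights ω_i make the total vanish
(`sum_omegaCoeff_mul_partSum`). Since ω is a nonzero element of S and dim S ≤ 6, dim ω^⊥ ≤ 5, so
five independent vectors form a basis.

For the second basis, moving the base point from y to x multiplies coefficients by f. This exchanges
the roles of the character and of the constant and fixes the three indicators, so the iterates taken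
from y lie in the same space (`matChar_mul_basicComb_neg`). -/

set_option linter.unusedSectionVars false

/-! ### Rank factorizations and rank-one perturbations. -/

section LinearAlgebra

open Matrix

variable {F : Type*} [Field F] {ι κ σ : Type*} [Fintype ι] [Fintype κ] [Fintype σ]

theorem Matrix.rank_eq_card_of_mulVec_injective (A : Matrix ι σ F)
    (hA : ∀ p, A *ᵥ p = 0 → p = 0) : A.rank = Fintype.card σ := by
  have h := LinearMap.finrank_range_add_finrank_ker A.mulVecLin
  have hk : LinearMap.ker A.mulVecLin = ⊥ := by
    rw [LinearMap.ker_eq_bot']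
    intro p hp
    exact hA p (by simpa using hp)
  rw [hk, finrank_bot, Module.finrank_fintype_fun_eq_card] at h
  simpa [Matrix.rank] using h

theorem Matrix.mulVec_eq_zero_of_rank_eq_card (A : Matrix ι σ F) (hA : A.rank = Fintype.card σ)
    (p : σ → F) (hp : A *ᵥ p = 0) : p = 0 := by
  have h := LinearMap.finrank_range_add_finrank_ker A.mulVecLin
  rw [Module.finrank_fintype_fun_eq_card] at h
  have h0 : Module.finrank F (LinearMap.ker A.mulVecLin) = 0 := by
    have : Module.finrank F (LinearMap.range A.mulVecLin) = Fintype.card σ := hA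
    omega
  have hb := Submodule.finrank_eq_zero.mp h0
  have : p ∈ LinearMap.ker A.mulVecLin := by simpa using hp
  rw [hb] at this
  simpa using this

theorem Matrix.rank_mul_eq_card (A : Matrix ι σ F) (B : Matrix σ κ F)
    (hA : ∀ p, A *ᵥ p = 0 → p = 0) (hB : ∀ h, h ᵥ* B = 0 → h = 0) :
    (A * B).rank = Fintype.card σ := by
  have hBr : B.rank = Fintype.card σ := by
    rw [← Matrix.rank_transpose]
    exact Matrix.rank_eq_card_of_mulVec_injective _ fun p hp => hB p (by
      rwa [Matrix.mulVec_transpose] at hp)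
  have hBs : LinearMap.range B.mulVecLin = ⊤ := by
    apply Submodule.eq_top_of_finrank_eq
    rw [Module.finrank_fintype_fun_eq_card]
    exact hBr
  rw [← Matrix.rank_eq_card_of_mulVec_injective A hA, Matrix.rank, Matrix.mulVecLin_mul,
    LinearMap.range_comp, hBs, Submodule.map_top, Matrix.rank]

/-- The columns of `P` are a basis of the column space, and `Q` holds the coordinates of the columns
of `y`. Both have full rank because their product already has rank `y.rank`. -/
theorem Matrix.exists_rank_factorization (y : Matrix ι κ F) :
    ∃ (P : Matrix ι (Fin y.rank) F) (Q : Matrix (Fin y.rank) κ F), y = P * Q ∧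
      (∀ p, P *ᵥ p = 0 → p = 0) ∧ (∀ h, h ᵥ* Q = 0 → h = 0) := by
  classical
  let b := Module.finBasis F (LinearMap.range y.mulVecLin)
  let P : Matrix ι (Fin y.rank) F := Matrix.of fun i j => (b j : ι → F) i
  let Q : Matrix (Fin y.rank) κ F :=
    Matrix.of fun j c => b.repr ⟨y.col c, ⟨Pi.single c 1, by simp⟩⟩ j
  have hy : y = P * Q := by
    ext i c
    have h := congrArg (fun v : LinearMap.range y.mulVecLin => (v : ι → F) i)
      (b.sum_repr ⟨y.col c, ⟨Pi.single c 1, by simp⟩⟩)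
    simp only [Submodule.coe_sum, Submodule.coe_smul, Finset.sum_apply, Pi.smul_apply,
      smul_eq_mul, Matrix.col_apply] at h
    rw [← h, Matrix.mul_apply]
    exact Finset.sum_congr rfl fun j _ => mul_comm _ _
  have hr : (P * Q).rank = y.rank := by rw [← hy]
  refine ⟨P, Q, hy, ?_, ?_⟩
  · apply Matrix.mulVec_eq_zero_of_rank_eq_card
    refine le_antisymm (Matrix.rank_le_card_width P) ?_
    rw [Fintype.card_fin]
    exact hr.symm.le.trans (Matrix.rank_mul_le_left P Q)
  · intro h hh
    refine Matrix.mulVec_eq_zero_of_rank_eq_card Qᵀ ?_ h (by rwa [Matrix.mulVec_transpose])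
    rw [Matrix.rank_transpose]
    refine le_antisymm (Matrix.rank_le_card_height Q) ?_
    rw [Fintype.card_fin]
    exact hr.symm.le.trans (Matrix.rank_mul_le_right P Q)

theorem Matrix.rank_vecMulVec_eq_one (u : ι → F) (v : κ → F) (hu : u ≠ 0) (hv : v ≠ 0) :
    (vecMulVec u v).rank = 1 := by
  refine le_antisymm (Matrix.rank_vecMulVec_le u v) ?_
  rw [Nat.one_le_iff_ne_zero]
  intro h
  rw [Matrix.rank, Submodule.finrank_eq_zero, LinearMap.range_eq_bot] at h
  obtain ⟨i, hi⟩ := Function.ne_iff.mp hu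
  obtain ⟨j, hj⟩ := Function.ne_iff.mp hv
  classical
  have := congrFun (LinearMap.congr_fun h (Pi.single j 1)) i
  simp [vecMulVec_apply] at this
  tauto

theorem Matrix.rank_pos_of_ne_zero {w : Matrix ι κ F} (hw : w ≠ 0) : w.rank ≠ 0 := by
  intro h
  rw [Matrix.rank, Submodule.finrank_eq_zero, LinearMap.range_eq_bot] at h
  apply hw
  classical
  ext i j
  simpa using congrFun (LinearMap.congr_fun h (Pi.single j 1)) i

theorem Matrix.exists_eq_vecMulVec_of_rank_eq_one (w : Matrix ι κ F) (hw : w.rank = 1) :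
    ∃ (u : ι → F) (v : κ → F), u ≠ 0 ∧ v ≠ 0 ∧ w = vecMulVec u v := by
  obtain ⟨P, Q, h, -, -⟩ := w.exists_rank_factorization
  have e : w = vecMulVec (fun i => P i ⟨0, by omega⟩) (fun j => Q ⟨0, by omega⟩ j) := by
    ext i j
    conv_lhs => rw [h]
    rw [Matrix.mul_apply, vecMulVec_apply]
    have : Subsingleton (Fin w.rank) := by rw [hw]; infer_instance
    rw [Fintype.sum_subsingleton _ (⟨0, by omega⟩ : Fin w.rank)]
  refine ⟨_, _, ?_, ?_, e⟩
  · intro h0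
    rw [h0, zero_vecMulVec] at e
    simp [e] at hw
  · intro h0
    have e0 : w = 0 := by
      rw [e]
      ext i j
      have := congrFun h0 j
      simp only [Pi.zero_apply] at this
      simp [vecMulVec_apply, this]
    simp [e0] at hw

theorem Matrix.rank_add_le_add (w z : Matrix ι κ F) : (w + z).rank ≤ w.rank + z.rank := by
  rw [Matrix.rank, Matrix.rank, Matrix.rank, Matrix.mulVecLin_add]
  exact (Submodule.finrank_mono (LinearMap.range_add_le _ _)).trans
    (Submodule.finrank_add_le_finrank_add_finrank _ _)

theorem Matrix.rank_neg' (w : Matrix ι κ F) : (-w).rank = w.rank := by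
  rw [← neg_one_smul F w, Matrix.rank_smul_of_mem_nonZeroDivisors _ (by simp)]

theorem Matrix.rank_sub_rev (w z : Matrix ι κ F) : (w - z).rank = (z - w).rank := by
  rw [← Matrix.rank_neg', neg_sub]

theorem Matrix.rank_smul_of_ne_zero {s : F} (hs : s ≠ 0) (w : Matrix ι κ F) :
    (s • w).rank = w.rank :=
  Matrix.rank_smul_of_mem_nonZeroDivisors _ (mem_nonZeroDivisors_of_ne_zero hs)

theorem Matrix.card_ker_mul [Fintype F] [DecidableEq F] [DecidableEq κ] (w : Matrix ι κ F) :
    (Finset.univ.filter fun v : κ → F => w *ᵥ v = 0).card * Fintype.card F ^ w.rank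
      = Fintype.card F ^ Fintype.card κ := by
  classical
  have h := LinearMap.finrank_range_add_finrank_ker w.mulVecLin
  rw [Module.finrank_fintype_fun_eq_card] at h
  have h1 : (Finset.univ.filter fun v : κ → F => w *ᵥ v = 0).card
      = Fintype.card F ^ Module.finrank F (LinearMap.ker w.mulVecLin) := by
    rw [← Module.card_eq_pow_finrank (K := F), Fintype.card_subtype]
    congr 1
    ext v
    simp
  rw [h1, ← pow_add, ← h, add_comm]
  rfl

/-! Ranks of rank-one perturbations of `P * Q`. -/

variable {P : Matrix ι σ F} {Q : Matrix σ κ F}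

theorem sub_mul_vecMulVec (p : σ → F) (r : κ → F) :
    P * Q - vecMulVec (P *ᵥ p) r = P * (Q - vecMulVec p r) := by
  rw [Matrix.mul_sub, Matrix.mul_vecMulVec]

/-- The perturbed matrix is P(1 - prᵀ)Q, and 1 - prᵀ is invertible exactly when p ⬝ᵥ r ≠ 1. -/
theorem rank_sub_col_row_of_ne (hP : ∀ p, P *ᵥ p = 0 → p = 0) (hQ : ∀ h, h ᵥ* Q = 0 → h = 0)
    (p r : σ → F) (h : p ⬝ᵥ r ≠ 1) :
    (P * Q - vecMulVec (P *ᵥ p) (r ᵥ* Q)).rank = Fintype.card σ := by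
  rw [sub_mul_vecMulVec]
  refine Matrix.rank_mul_eq_card _ _ hP fun g hg => ?_
  rw [Matrix.vecMul_sub, vecMul_vecMulVec, ← Matrix.smul_vecMul, ← Matrix.sub_vecMul] at hg
  have h1 := hQ _ hg
  have h2 : (1 - p ⬝ᵥ r) * (g ⬝ᵥ p) = 0 := by
    have := congrArg (· ⬝ᵥ p) h1
    simp only [sub_dotProduct, smul_dotProduct, zero_dotProduct, smul_eq_mul] at this
    rw [dotProduct_comm p r]
    linear_combination this
  have h3 : g ⬝ᵥ p = 0 := by
    rcases mul_eq_zero.mp h2 with h2 | h2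
    · exact absurd (sub_eq_zero.mp h2).symm h
    · exact h2
  simpa [h3] using h1

theorem rank_sub_col_row_of_eq (hP : ∀ p, P *ᵥ p = 0 → p = 0) (hQ : ∀ h, h ᵥ* Q = 0 → h = 0)
    (p r : σ → F) (h : p ⬝ᵥ r = 1) :
    (P * Q - vecMulVec (P *ᵥ p) (r ᵥ* Q)).rank + 1 = Fintype.card σ := by
  classical
  have hle : Fintype.card σ ≤ (P * Q - vecMulVec (P *ᵥ p) (r ᵥ* Q)).rank + 1 := by
    rw [← Matrix.rank_mul_eq_card P Q hP hQ]
    calc (P * Q).rank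
        = ((P * Q - vecMulVec (P *ᵥ p) (r ᵥ* Q)) + vecMulVec (P *ᵥ p) (r ᵥ* Q)).rank := by
          rw [sub_add_cancel]
      _ ≤ _ := Matrix.rank_add_le_add _ _
      _ ≤ _ := Nat.add_le_add_left (Matrix.rank_vecMulVec_le _ _) _
  refine le_antisymm ?_ hle
  have e : P * Q - vecMulVec (P *ᵥ p) (r ᵥ* Q) = P * ((1 - vecMulVec p r) * Q) := by
    rw [sub_mul_vecMulVec, Matrix.sub_mul, Matrix.one_mul, Matrix.vecMulVec_mul]
  have hs : (P * Q - vecMulVec (P *ᵥ p) (r ᵥ* Q)).rank ≤ (1 - vecMulVec p r).rank := by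
    rw [e]
    exact (Matrix.rank_mul_le_right _ _).trans (Matrix.rank_mul_le_left _ _)
  -- The vector p itself spans the kernel of 1 - prᵀ.
  have hlt : (1 - vecMulVec p r).rank ≠ Fintype.card σ := by
    intro hc
    have := Matrix.mulVec_eq_zero_of_rank_eq_card _ hc p (by
      rw [Matrix.sub_mulVec, Matrix.one_mulVec, vecMulVec_mulVec, dotProduct_comm, h]
      simp)
    simp [this] at h
  have := Matrix.rank_le_card_width (1 - vecMulVec p r)
  omega

/-- After factoring out P, a relation among the rows of Q - prᵀ would put r in the row space of Q.
-/
theorem rank_sub_col_not_row (hP : ∀ p, P *ᵥ p = 0 → p = 0) (hQ : ∀ h, h ᵥ* Q = 0 → h = 0)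
    (p : σ → F) (r : κ → F) (h : ∀ s, r ≠ s ᵥ* Q) :
    (P * Q - vecMulVec (P *ᵥ p) r).rank = Fintype.card σ := by
  rw [sub_mul_vecMulVec]
  refine Matrix.rank_mul_eq_card _ _ hP fun g hg => ?_
  rw [Matrix.vecMul_sub, vecMul_vecMulVec, sub_eq_zero] at hg
  by_cases h0 : g ⬝ᵥ p = 0
  · rw [h0, zero_smul] at hg
    exact hQ _ hg
  · exact absurd (by rw [Matrix.smul_vecMul, hg, smul_smul, inv_mul_cancel₀ h0, one_smul])
      (h ((g ⬝ᵥ p)⁻¹ • g))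

theorem rank_sub_not_col_row (hP : ∀ p, P *ᵥ p = 0 → p = 0) (hQ : ∀ h, h ᵥ* Q = 0 → h = 0)
    (p : ι → F) (r : σ → F) (h : ∀ s, p ≠ P *ᵥ s) :
    (P * Q - vecMulVec p (r ᵥ* Q)).rank = Fintype.card σ := by
  rw [← Matrix.rank_transpose, Matrix.transpose_sub, Matrix.transpose_mul, transpose_vecMulVec,
    ← Matrix.mulVec_transpose]
  refine rank_sub_col_not_row (fun g hg => hQ g ?_) (fun g hg => hP g ?_) r p fun s => ?_
  · rwa [Matrix.mulVec_transpose] at hg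
  · rwa [Matrix.vecMul_transpose] at hg
  · rw [Matrix.vecMul_transpose]
    exact h s

theorem mulVec_fromCols_eq_zero (hP : ∀ p, P *ᵥ p = 0 → p = 0) {p : ι → F}
    (hp : ∀ s, p ≠ P *ᵥ s) (g : σ ⊕ Unit → F)
    (hg : Matrix.fromCols P (replicateCol Unit p) *ᵥ g = 0) : g = 0 := by
  have h1 : P *ᵥ (g ∘ Sum.inl) + g (Sum.inr ()) • p = 0 := by
    rw [← hg, Matrix.fromCols_mulVec]
    congr 1
    ext i
    simp [Matrix.mulVec, dotProduct, mul_comm]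
  by_cases h0 : g (Sum.inr ()) = 0
  · rw [h0, zero_smul, add_zero] at h1
    have := hP _ h1
    ext (i | i)
    · exact congrFun this i
    · exact h0
  · refine absurd ?_ (hp (-(g (Sum.inr ()))⁻¹ • (g ∘ Sum.inl)))
    rw [Matrix.mulVec_smul, eq_neg_of_add_eq_zero_left h1, smul_neg, neg_smul, neg_neg, smul_smul,
      inv_mul_cancel₀ h0, one_smul]

/-- Adjoin p to P as a column and -r to Q as a row: the two enlarged factors still have full rank,
and their product is the perturbed matrix. -/
theorem rank_sub_not_col_not_row (hP : ∀ p, P *ᵥ p = 0 → p = 0)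
    (hQ : ∀ h, h ᵥ* Q = 0 → h = 0) (p : ι → F) (r : κ → F) (hp : ∀ s, p ≠ P *ᵥ s)
    (hr : ∀ s, r ≠ s ᵥ* Q) :
    (P * Q - vecMulVec p r).rank = Fintype.card σ + 1 := by
  classical
  have e : P * Q - vecMulVec p r
      = Matrix.fromCols P (replicateCol Unit p) * Matrix.fromRows Q (replicateRow Unit (-r)) := by
    rw [Matrix.fromCols_mul_fromRows, ← vecMulVec_eq, vecMulVec_neg, sub_eq_add_neg]
  rw [e, Matrix.rank_mul_eq_card]
  · simp
  · exact mulVec_fromCols_eq_zero hP hp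
  · intro g hg
    have h1 : (g ∘ Sum.inl) ᵥ* Q - g (Sum.inr ()) • r = 0 := by
      rw [← hg, Matrix.vecMul_fromRows, sub_eq_add_neg]
      congr 1
      ext i
      simp [Matrix.vecMul, dotProduct]
    by_cases h0 : g (Sum.inr ()) = 0
    · rw [h0, zero_smul, sub_zero] at h1
      have := hQ _ h1
      ext (i | i)
      · exact congrFun this i
      · exact h0
    · refine absurd ?_ (hr ((g (Sum.inr ()))⁻¹ • (g ∘ Sum.inl)))
      rw [Matrix.smul_vecMul, sub_eq_zero.mp h1, smul_smul, inv_mul_cancel₀ h0, one_smul]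

/-- Removing one term of a rank factorization is the case p = r = e_i of `rank_sub_col_row_of_eq`.
-/
theorem Matrix.exists_rank_one_sub (w : Matrix ι κ F) (n : ℕ) (hw : w.rank = n + 1) :
    ∃ z : Matrix ι κ F, z.rank = 1 ∧ (w - z).rank = n := by
  obtain ⟨P, Q, h, hP, hQ⟩ := w.exists_rank_factorization
  let i : Fin w.rank := ⟨0, by omega⟩
  have h1 : (Pi.single i 1 : Fin w.rank → F) ⬝ᵥ Pi.single i 1 = 1 := by simp
  have hne : (Pi.single i 1 : Fin w.rank → F) ≠ 0 := by simp
  refine ⟨vecMulVec (P *ᵥ Pi.single i 1) (Pi.single i 1 ᵥ* Q),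
    Matrix.rank_vecMulVec_eq_one _ _ (fun h => hne (hP _ h)) (fun h => hne (hQ _ h)), ?_⟩
  have := rank_sub_col_row_of_eq hP hQ _ _ h1
  rw [← h, Fintype.card_fin] at this
  omega

end LinearAlgebra

/-! ### Path-length distance equals rank of the difference. -/

section Distance

variable {F : Type*} [Field F] {D N : ℕ}

theorem bilinearFormsGraph_exists_walk (n : ℕ) (x y : Matrix (Fin D) (Fin (N - D)) F)
    (h : (x - y).rank = n) : ∃ p : (bilinearFormsGraph F D N).Walk x y, p.length = n := by
  induction n generalizing x with
  | zero =>
    have : x = y := by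
      by_contra hxy
      exact Matrix.rank_pos_of_ne_zero (sub_ne_zero.mpr hxy) h
    subst this
    exact ⟨.nil, rfl⟩
  | succ n ih =>
    obtain ⟨z, hz, hz'⟩ := Matrix.exists_rank_one_sub _ _ h
    obtain ⟨p, hp⟩ := ih (x - z) (by rwa [sub_right_comm])
    have ha : (bilinearFormsGraph F D N).Adj x (x - z) := by
      change (x - (x - z)).rank = 1
      rwa [sub_sub_cancel]
    exact ⟨.cons ha p, by simp [hp]⟩

theorem bilinearFormsGraph_rank_le_length {x y : Matrix (Fin D) (Fin (N - D)) F}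
    (p : (bilinearFormsGraph F D N).Walk x y) : (x - y).rank ≤ p.length := by
  induction p with
  | nil => simp
  | @cons u v w h p ih =>
    have h1 : (u - v).rank = 1 := h
    have := Matrix.rank_add_le_add (u - v) (v - w)
    rw [sub_add_sub_cancel] at this
    rw [SimpleGraph.Walk.length_cons]
    omega

theorem bilinearFormsGraph_dist (x y : Matrix (Fin D) (Fin (N - D)) F) :
    (bilinearFormsGraph F D N).dist x y = (x - y).rank := by
  obtain ⟨p, hp⟩ := bilinearFormsGraph_exists_walk _ x y rfl
  refine le_antisymm (hp ▸ SimpleGraph.dist_le p) ?_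
  obtain ⟨p', hp'⟩ := (SimpleGraph.Walk.reachable p).exists_walk_length_eq_dist
  exact hp' ▸ bilinearFormsGraph_rank_le_length p'

end Distance

/-! ### Additive characters of matrices and sums over rank-one matrices. -/

section Characters

open scoped Classical
open Matrix

variable {F : Type*} [Field F] [Fintype F] {ι κ : Type*} [Fintype ι] [Fintype κ]

/-- A fixed primitive additive character of `F`. -/
noncomputable def stdChar (F : Type*) [Field F] [Fintype F] : AddChar F ℂ :=
  AddChar.FiniteField.primitiveChar_to_Complex F

theorem sum_stdChar_linear {V : Type*} [AddCommGroup V] [Module F V] [Fintype V]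
    (l : V →ₗ[F] F) : ∑ v, stdChar F (l v) = if l = 0 then (Fintype.card V : ℂ) else 0 := by
  have h := AddChar.sum_eq_ite ((stdChar F).compAddMonoidHom l.toAddMonoidHom)
  simp only [AddChar.compAddMonoidHom_apply] at h
  refine h.trans ?_
  congr 1
  rw [eq_iff_iff]
  constructor
  · intro h0
    by_contra hl
    obtain ⟨v, hv⟩ : ∃ v, l v ≠ 0 := by
      by_contra hc
      push Not at hc
      exact hl (LinearMap.ext hc)
    apply AddChar.FiniteField.primitiveChar_to_Complex_isPrimitive F (one_ne_zero)
    ext s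
    rw [AddChar.mulShift_apply, one_mul]
    -- The linear form takes the value s at this multiple of v, so the character would be trivial at
    -- every s.
    have := DFunLike.congr_fun h0 ((s * (l v)⁻¹) • v)
    simpa [mul_assoc, hv, stdChar] using this
  · rintro rfl
    ext
    simp

theorem sum_stdChar_dotProduct [DecidableEq ι] (ξ : ι → F) :
    ∑ r : ι → F, stdChar F (r ⬝ᵥ ξ) =
      if ξ = 0 then (Fintype.card F : ℂ) ^ Fintype.card ι else 0 := by
  have h := sum_stdChar_linear (F := F) (V := ι → F)
    ((dotProductBilin F F).flip ξ)
  simp only [LinearMap.flip_apply, dotProductBilin_apply_apply] at h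
  rw [h]
  have : (dotProductBilin F F).flip ξ = 0 ↔ ξ = 0 := by
    constructor
    · intro h0
      ext i
      simpa using LinearMap.congr_fun h0 (Pi.single i 1)
    · rintro rfl
      simp
  simp [this]

theorem sum_stdChar_mul (t : F) :
    ∑ s : F, stdChar F (s * t) = if t = 0 then (Fintype.card F : ℂ) else 0 := by
  have h := sum_stdChar_linear (F := F) ((LinearMap.mul F F).flip t)
  simp only [LinearMap.flip_apply, LinearMap.mul_apply'] at h
  rw [h]
  have : (LinearMap.mul F F).flip t = 0 ↔ t = 0 := by
    constructor
    · intro h0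
      simpa using LinearMap.congr_fun h0 1
    · rintro rfl
      simp
  simp only [this]

/-- The character of the additive group of matrices attached to the matrix `a`. -/
noncomputable def matChar (a w : Matrix ι κ F) : ℂ := stdChar F (trace (aᵀ * w))

theorem matChar_add_right (a w z : Matrix ι κ F) :
    matChar a (w + z) = matChar a w * matChar a z := by
  simp [matChar, Matrix.mul_add, AddChar.map_add_eq_mul]

theorem matChar_comm (a w : Matrix ι κ F) : matChar a w = matChar w a := by
  rw [matChar, matChar, ← Matrix.trace_transpose, Matrix.transpose_mul, Matrix.transpose_transpose]

theorem matChar_add_left (a b w : Matrix ι κ F) :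
    matChar (a + b) w = matChar a w * matChar b w := by
  rw [matChar_comm, matChar_add_right, matChar_comm w, matChar_comm w]

theorem matChar_neg_right (a w : Matrix ι κ F) :
    matChar a (-w) = (starRingEnd ℂ) (matChar a w) := by
  simp [matChar, AddChar.map_neg_eq_conj]

theorem matChar_neg_left (a w : Matrix ι κ F) :
    matChar (-a) w = (starRingEnd ℂ) (matChar a w) := by
  rw [matChar_comm, matChar_neg_right, matChar_comm]

@[simp] theorem matChar_zero_right (a : Matrix ι κ F) : matChar a 0 = 1 := by simp [matChar]

@[simp] theorem matChar_zero_left (a : Matrix ι κ F) : matChar 0 a = 1 := by simp [matChar]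

theorem trace_transpose_vecMulVec_mul (u : ι → F) (v : κ → F) (w : Matrix ι κ F) :
    trace ((vecMulVec u v)ᵀ * w) = u ⬝ᵥ (w *ᵥ v) := by
  rw [transpose_vecMulVec, Matrix.vecMulVec_mul, Matrix.trace_vecMulVec, dotProduct_comm,
    Matrix.dotProduct_mulVec]

theorem matChar_vecMulVec_left (u : ι → F) (v : κ → F) (w : Matrix ι κ F) :
    matChar (vecMulVec u v) w = stdChar F (u ⬝ᵥ (w *ᵥ v)) := by
  rw [matChar, trace_transpose_vecMulVec_mul]

theorem matChar_vecMulVec_vecMulVec (u p : ι → F) (v r : κ → F) :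
    matChar (vecMulVec u v) (vecMulVec p r) = stdChar F ((u ⬝ᵥ p) * (r ⬝ᵥ v)) := by
  rw [matChar_vecMulVec_left, vecMulVec_mulVec]
  simp [dotProduct_smul, mul_comm]

variable [DecidableEq ι] [DecidableEq κ]

theorem sum_matChar (a : Matrix ι κ F) :
    ∑ w, matChar a w = if a = 0 then (Fintype.card (Matrix ι κ F) : ℂ) else 0 := by
  let l : Matrix ι κ F →ₗ[F] F :=
    { toFun := fun w => trace (aᵀ * w)
      map_add' := fun w z => by simp [Matrix.mul_add]
      map_smul' := fun c w => by simp }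
  have h := sum_stdChar_linear l
  have h0 : l = 0 ↔ a = 0 := by
    constructor
    · intro h
      ext i j
      have := LinearMap.congr_fun h (vecMulVec (Pi.single i 1) (Pi.single j 1))
      simp only [LinearMap.zero_apply] at this
      change trace (aᵀ * vecMulVec (Pi.single i 1) (Pi.single j 1)) = 0 at this
      rw [← Matrix.trace_transpose, Matrix.transpose_mul, Matrix.transpose_transpose,
        trace_transpose_vecMulVec_mul] at this
      simpa using this
    · rintro rfl
      ext w
      simp [l]
  simp only [h0] at h
  exact h

/-- The finite set of matrices of rank one. -/
noncomputable def rankOne (F ι κ : Type*) [Field F] [Fintype F] [Fintype ι] [Fintype κ]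
    [DecidableEq ι] [DecidableEq κ] : Finset (Matrix ι κ F) :=
  Finset.univ.filter fun a => a.rank = 1

@[simp] theorem mem_rankOne {a : Matrix ι κ F} : a ∈ rankOne F ι κ ↔ a.rank = 1 := by
  simp [rankOne]

theorem vecMulVec_eq_vecMulVec_iff {u u' : ι → F} {v v' : κ → F} (hu : u ≠ 0) (hv : v ≠ 0) :
    vecMulVec u' v' = vecMulVec u v ↔ ∃ s : F, s ≠ 0 ∧ u' = s • u ∧ v' = s⁻¹ • v := by
  constructor
  · intro h
    obtain ⟨j, hj⟩ := Function.ne_iff.mp hv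
    obtain ⟨i, hi⟩ := Function.ne_iff.mp hu
    simp only [Pi.zero_apply] at hi hj
    have e : ∀ i j, u' i * v' j = u i * v j := fun i j => by
      simpa [vecMulVec_apply] using congrFun (congrFun h i) j
    have h1 : v' j ≠ 0 := fun h0 => by
      have := e i j
      simp [h0, hi, hj] at this
    refine ⟨v j / v' j, div_ne_zero hj h1, ?_, ?_⟩
    · ext i'
      simp only [Pi.smul_apply, smul_eq_mul]
      rw [div_mul_eq_mul_div, eq_div_iff h1, e, mul_comm]
    · ext j'
      simp only [Pi.smul_apply, smul_eq_mul, inv_div]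
      have h3 : u i * (v j * v' j' - v' j * v j') = 0 := by
        linear_combination v' j * e i j' - v' j' * e i j
      rcases mul_eq_zero.mp h3 with h3 | h3
      · exact absurd h3 hi
      · field_simp
        linear_combination h3
  · rintro ⟨s, hs, rfl, rfl⟩
    rw [smul_vecMulVec, vecMulVec_smul, smul_smul, mul_inv_cancel₀ hs, one_smul]

/-- Each rank-one matrix is uvᵀ for exactly |F| - 1 pairs, namely (su, s⁻¹v) with s ≠ 0. The factor
on the left avoids a division. -/
theorem sum_rankOne_mul_pred (G : Matrix ι κ F → ℂ) :
    ((Fintype.card F : ℂ) - 1) * ∑ a ∈ rankOne F ι κ, G a =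
      ∑ u ∈ Finset.univ.erase (0 : ι → F), ∑ v ∈ Finset.univ.erase (0 : κ → F),
        G (vecMulVec u v) := by
  rw [← Finset.sum_product', ← Finset.sum_fiberwise_of_maps_to (t := rankOne F ι κ)
    (g := fun p : (ι → F) × (κ → F) => vecMulVec p.1 p.2), Finset.mul_sum]
  · refine Finset.sum_congr rfl fun a ha => ?_
    obtain ⟨u, v, hu, hv, rfl⟩ := Matrix.exists_eq_vecMulVec_of_rank_eq_one a (mem_rankOne.mp ha)
    rw [Finset.sum_congr rfl (g := fun _ => G (vecMulVec u v))
      fun p hp => by rw [(Finset.mem_filter.mp hp).2], Finset.sum_const, nsmul_eq_mul]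
    congr 1
    have hc : ((Finset.univ.erase (0 : ι → F) ×ˢ Finset.univ.erase (0 : κ → F)).filter
        fun p => vecMulVec p.1 p.2 = vecMulVec u v) =
        (Finset.univ.erase (0 : F)).image fun s => (s • u, s⁻¹ • v) := by
      ext ⟨u', v'⟩
      simp only [Finset.mem_filter, Finset.mem_product, Finset.mem_erase, Finset.mem_univ,
        and_true, Finset.mem_image, Prod.mk.injEq, vecMulVec_eq_vecMulVec_iff hu hv]
      constructor
      · rintro ⟨-, s, hs, rfl, rfl⟩
        exact ⟨s, hs, rfl, rfl⟩
      · rintro ⟨s, hs, rfl, rfl⟩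
        exact ⟨⟨smul_ne_zero hs hu, smul_ne_zero (inv_ne_zero hs) hv⟩, s, hs, rfl, rfl⟩
    rw [hc, Finset.card_image_of_injective, Finset.card_erase_of_mem (Finset.mem_univ _),
      Finset.card_univ, Nat.cast_sub Fintype.card_pos, Nat.cast_one]
    intro s s' h
    exact smul_left_injective F hu (Prod.ext_iff.mp h).1
  · rintro ⟨u, v⟩ h
    simp only [Finset.mem_product, Finset.mem_erase, Finset.mem_univ, and_true] at h
    exact mem_rankOne.mpr (Matrix.rank_vecMulVec_eq_one u v h.1 h.2)

theorem sum_erase_zero {V : Type*} [Fintype V] [DecidableEq V] [Zero V] (G : V → ℂ) :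
    ∑ u ∈ Finset.univ.erase (0 : V), G u = ∑ u, G u - G 0 := by
  rw [← Finset.add_sum_erase _ G (Finset.mem_univ (0 : V))]
  ring

/-- The correction term counts the pairs with u = 0 or v = 0. -/
theorem sum_rankOne_eq (G : Matrix ι κ F → ℂ) :
    ((Fintype.card F : ℂ) - 1) * ∑ a ∈ rankOne F ι κ, G a =
      ∑ u : ι → F, ∑ v : κ → F, G (vecMulVec u v)
        - ((Fintype.card F : ℂ) ^ Fintype.card ι + (Fintype.card F : ℂ) ^ Fintype.card κ - 1)
          * G 0 := by
  rw [sum_rankOne_mul_pred, sum_erase_zero]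
  simp_rw [sum_erase_zero]
  have hz : ∀ u : ι → F, vecMulVec u (0 : κ → F) = 0 := fun u => by
    ext
    simp [vecMulVec_apply]
  simp only [zero_vecMulVec, hz, Finset.sum_const, Finset.sum_sub_distrib,
    Finset.card_univ, nsmul_eq_mul, Fintype.card_fun, Nat.cast_pow]
  ring

/-- The `r`-th eigenvalue of the bilinear forms graph. -/
noncomputable def bilinEigenvalue (q a b : ℝ) (r : ℕ) : ℝ := (a * b / q ^ r - a - b + 1) / (q - 1)

theorem one_lt_card_real (F : Type*) [Field F] [Fintype F] : (1 : ℝ) < Fintype.card F := by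
  exact_mod_cast Fintype.one_lt_card

theorem one_lt_card_ne (F : Type*) [Field F] [Fintype F] : (Fintype.card F : ℂ) - 1 ≠ 0 := by
  have := one_lt_card_real F
  have h : ((Fintype.card F : ℝ) - 1 : ℝ) ≠ 0 := by linarith
  exact_mod_cast h

theorem card_ne_zero_complex (F : Type*) [Field F] [Fintype F] : (Fintype.card F : ℂ) ≠ 0 := by
  exact_mod_cast Fintype.card_ne_zero

theorem card_ker_complex (w : Matrix ι κ F) :
    ((Finset.univ.filter fun v : κ → F => w *ᵥ v = 0).card : ℂ)
      = (Fintype.card F : ℂ) ^ Fintype.card κ / (Fintype.card F : ℂ) ^ w.rank := by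
  rw [eq_div_iff (pow_ne_zero _ (card_ne_zero_complex F))]
  exact_mod_cast w.card_ker_mul

/-- The character sum over all matrices of rank one. -/
noncomputable def rankOneSum (F ι κ : Type*) [Field F] [Fintype F] [Fintype ι] [Fintype κ]
    (r : ℕ) : ℝ :=
  bilinEigenvalue (Fintype.card F) ((Fintype.card F : ℝ) ^ Fintype.card ι)
    ((Fintype.card F : ℝ) ^ Fintype.card κ) r

theorem rankOneSum_mul (r : ℕ) : ((Fintype.card F : ℂ) - 1) * (rankOneSum F ι κ r : ℂ) =
    (Fintype.card F : ℂ) ^ Fintype.card ι * (Fintype.card F : ℂ) ^ Fintype.card κ /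
      (Fintype.card F : ℂ) ^ r - (Fintype.card F : ℂ) ^ Fintype.card ι
      - (Fintype.card F : ℂ) ^ Fintype.card κ + 1 := by
  simp only [rankOneSum, bilinEigenvalue]
  push_cast
  rw [mul_div_cancel₀ _ (one_lt_card_ne F)]

/-- Summing over u first leaves only those v with wv = 0, so the sum is determined by the size of
the kernel of w. -/
theorem sum_rankOne_matChar (w : Matrix ι κ F) :
    ∑ a ∈ rankOne F ι κ, matChar a w = rankOneSum F ι κ w.rank := by
  apply mul_left_cancel₀ (one_lt_card_ne F)
  rw [sum_rankOne_eq, rankOneSum_mul, Finset.sum_comm]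
  simp only [matChar_vecMulVec_left, sum_stdChar_dotProduct, matChar_zero_left]
  rw [← Finset.sum_filter, Finset.sum_const, nsmul_eq_mul, card_ker_complex]
  ring

end Characters

/-! ### Eigenvalues of the graph and the matrix E. -/

section Spectrum

open scoped Classical
open Matrix

variable {F : Type*} [Field F] [Fintype F] {D N : ℕ}

theorem adjacencyMatrix_bilinearFormsGraph_mulVec (v : Matrix (Fin D) (Fin (N - D)) F → ℝ)
    (z : Matrix (Fin D) (Fin (N - D)) F) :
    (adjacencyMatrix (bilinearFormsGraph F D N) *ᵥ v) z =
      ∑ d ∈ rankOne F (Fin D) (Fin (N - D)), v (z - d) := by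
  rw [adjacencyMatrix, SimpleGraph.adjMatrix_mulVec_apply]
  refine Finset.sum_nbij' (fun w => z - w) (fun d => z - d) ?_ ?_ ?_ ?_ ?_
  · intro w hw
    rw [SimpleGraph.mem_neighborFinset] at hw
    exact mem_rankOne.mpr hw
  · intro d hd
    rw [SimpleGraph.mem_neighborFinset]
    change (z - (z - d)).rank = 1
    rw [sub_sub_cancel]
    exact mem_rankOne.mp hd
  all_goals simp

theorem adjacencyMatrix_isSymm {X : Type*} [Fintype X] (Γ : SimpleGraph X) :
    (adjacencyMatrix Γ).IsSymm := SimpleGraph.isSymm_adjMatrix Γ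

theorem sum_rankOne_matChar_neg {ι κ : Type*} [Fintype ι] [Fintype κ] [DecidableEq ι]
    [DecidableEq κ] (a : Matrix ι κ F) :
    ∑ d ∈ rankOne F ι κ, matChar a (-d) = rankOneSum F ι κ a.rank := by
  simp_rw [matChar_comm a, matChar_neg_left, ← map_sum, sum_rankOne_matChar, Complex.conj_ofReal]

/-- Real parts are taken because the adjacency matrix and E are real; the arbitrary factor c lets
these functions carry the Fourier expansion of any real vector. -/
theorem adjacencyMatrix_mulVec_matChar (c : ℂ) (a : Matrix (Fin D) (Fin (N - D)) F) :
    adjacencyMatrix (bilinearFormsGraph F D N) *ᵥ (fun z => (c * matChar a z).re) =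
      rankOneSum F (Fin D) (Fin (N - D)) a.rank • fun z => (c * matChar a z).re := by
  ext z
  rw [adjacencyMatrix_bilinearFormsGraph_mulVec, ← Complex.re_sum, ← Finset.mul_sum]
  simp_rw [sub_eq_add_neg, matChar_add_right]
  rw [← Finset.mul_sum, sum_rankOne_matChar_neg, Pi.smul_apply, smul_eq_mul, ← mul_assoc,
    mul_comm _ (rankOneSum F (Fin D) (Fin (N - D)) a.rank : ℂ), Complex.re_ofReal_mul]

theorem sum_sum_matChar {ι κ : Type*} [Fintype ι] [Fintype κ] [DecidableEq ι] [DecidableEq κ]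
    (v : Matrix ι κ F → ℝ) (z : Matrix ι κ F) :
    ∑ a, (∑ w, (v w : ℂ) * matChar a (-w)) * matChar a z =
      (Fintype.card (Matrix ι κ F) : ℂ) * v z := by
  simp_rw [Finset.sum_mul]
  rw [Finset.sum_comm]
  simp_rw [mul_assoc, ← Finset.mul_sum, ← matChar_add_right]
  have : ∀ w, ∑ a, matChar a (-w + z) =
      if w = z then (Fintype.card (Matrix ι κ F) : ℂ) else 0 := fun w => by
    simp_rw [fun a => matChar_comm a (-w + z)]
    rw [sum_matChar]
    congr 1
    rw [neg_add_eq_zero]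
  simp [this, mul_comm]

/-- A nonzero vector has a nonzero Fourier coefficient, and the adjacency matrix multiplies the
coefficient at a by the eigenvalue of `matChar a`. -/
theorem eigenvalue_adjacencyMatrix (μ : ℝ)
    (v : Matrix (Fin D) (Fin (N - D)) F → ℝ) (hv : v ≠ 0)
    (h : adjacencyMatrix (bilinearFormsGraph F D N) *ᵥ v = μ • v) :
    ∃ a : Matrix (Fin D) (Fin (N - D)) F,
      μ = rankOneSum F (Fin D) (Fin (N - D)) a.rank := by
  obtain ⟨a, ha⟩ : ∃ a : Matrix (Fin D) (Fin (N - D)) F,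
      ∑ w, (v w : ℂ) * matChar a (-w) ≠ 0 := by
    by_contra hc
    push Not at hc
    apply hv
    ext z
    have := sum_sum_matChar v z
    simp only [hc, zero_mul, Finset.sum_const_zero] at this
    have h0 := (mul_eq_zero.mp this.symm).resolve_left (by exact_mod_cast Fintype.card_ne_zero)
    exact_mod_cast h0
  refine ⟨a, ?_⟩
  have h1 : ∑ w, ((adjacencyMatrix (bilinearFormsGraph F D N) *ᵥ v) w : ℂ) * matChar a (-w) =
      rankOneSum F (Fin D) (Fin (N - D)) a.rank * ∑ w, (v w : ℂ) * matChar a (-w) := by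
    simp_rw [adjacencyMatrix_bilinearFormsGraph_mulVec]
    push_cast
    simp_rw [Finset.sum_mul]
    rw [Finset.sum_comm, ← sum_rankOne_matChar_neg a, Finset.sum_mul]
    refine Finset.sum_congr rfl fun d _ => ?_
    rw [Finset.mul_sum, ← (Equiv.subRight d).sum_comp fun w => matChar a (-d) *
      ((v w : ℂ) * matChar a (-w))]
    refine Finset.sum_congr rfl fun w _ => ?_
    rw [Equiv.subRight_apply, mul_left_comm, ← matChar_add_right]
    congr 2
    abel
  rw [h] at h1
  simp only [Pi.smul_apply, smul_eq_mul, Complex.ofReal_mul, mul_assoc] at h1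
  rw [← Finset.mul_sum] at h1
  exact_mod_cast mul_right_cancel₀ ha h1

theorem rankOneSum_strictAnti {ι κ : Type*} [Fintype ι] [Fintype κ] :
    StrictAnti (rankOneSum F ι κ) := by
  have hq := one_lt_card_real F
  intro r s hrs
  have h0 : (0 : ℝ) < Fintype.card F := by linarith
  simp only [rankOneSum, bilinEigenvalue]
  refine div_lt_div_of_pos_right ?_ (by linarith)
  have : (Fintype.card F : ℝ) ^ Fintype.card ι * (Fintype.card F : ℝ) ^ Fintype.card κ /
      (Fintype.card F : ℝ) ^ s < (Fintype.card F : ℝ) ^ Fintype.card ι *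
      (Fintype.card F : ℝ) ^ Fintype.card κ / (Fintype.card F : ℝ) ^ r :=
    div_lt_div_of_pos_left (by positivity) (by positivity) (pow_lt_pow_right₀ hq hrs)
  linarith

theorem mem_matrixEigenvalues_iff {X : Type*} [Fintype X] (A : Matrix X X ℝ) (μ : ℝ) :
    μ ∈ matrixEigenvalues A ↔ ∃ v : X → ℝ, v ≠ 0 ∧ A *ᵥ v = μ • v := by
  rw [matrixEigenvalues, Set.mem_ofPred_eq]
  constructor
  · intro h
    obtain ⟨v, hv⟩ := h.exists_hasEigenvector
    refine ⟨v, hv.2, ?_⟩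
    simpa using hv.apply_eq_smul
  · rintro ⟨v, hv, h⟩
    exact Module.End.hasEigenvalue_of_hasEigenvector (x := v)
      ⟨Module.End.mem_eigenspace_iff.mpr (by simpa using h), hv⟩

theorem rankOneSum_mem_matrixEigenvalues (a : Matrix (Fin D) (Fin (N - D)) F) :
    rankOneSum F (Fin D) (Fin (N - D)) a.rank ∈
      matrixEigenvalues (adjacencyMatrix (bilinearFormsGraph F D N)) := by
  rw [mem_matrixEigenvalues_iff]
  refine ⟨fun z => (1 * matChar a z).re, ?_, adjacencyMatrix_mulVec_matChar 1 a⟩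
  intro h
  have := congrFun h 0
  simp at this

/-- The matrix `b` only witnesses that rank one occurs, so that the value for rank one is attained
as an eigenvalue. -/
theorem secondEigenvalue_bilinearFormsGraph (b : Matrix (Fin D) (Fin (N - D)) F)
    (hb : b.rank = 1) :
    secondEigenvalue (bilinearFormsGraph F D N) = rankOneSum F (Fin D) (Fin (N - D)) 1 := by
  have h0 : sSup (matrixEigenvalues (adjacencyMatrix (bilinearFormsGraph F D N))) =
      rankOneSum F (Fin D) (Fin (N - D)) 0 := by
    refine IsGreatest.csSup_eq ⟨?_, ?_⟩
    · have := rankOneSum_mem_matrixEigenvalues (0 : Matrix (Fin D) (Fin (N - D)) F)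
      rwa [Matrix.rank_zero] at this
    · intro μ hμ
      obtain ⟨v, hv, h⟩ := (mem_matrixEigenvalues_iff _ _).mp hμ
      obtain ⟨a, rfl⟩ := eigenvalue_adjacencyMatrix μ v hv h
      exact rankOneSum_strictAnti.antitone (Nat.zero_le _)
  rw [secondEigenvalue, h0]
  refine IsGreatest.csSup_eq ⟨⟨?_, rankOneSum_strictAnti zero_lt_one⟩, ?_⟩
  · have := rankOneSum_mem_matrixEigenvalues b
    rwa [hb] at this
  · rintro μ ⟨hμ, hlt⟩
    obtain ⟨v, hv, h⟩ := (mem_matrixEigenvalues_iff _ _).mp hμ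
    obtain ⟨a, rfl⟩ := eigenvalue_adjacencyMatrix μ v hv h
    exact rankOneSum_strictAnti.antitone (rankOneSum_strictAnti.lt_iff_gt.mp hlt)

/-- E keeps the rank-one terms of the Fourier expansion, so its entries are character sums over the
rank-one matrices. These are again eigenvalues of the graph, now indexed by the rank of w - z. -/
theorem matE_mulVec_apply (b : Matrix (Fin D) (Fin (N - D)) F) (hb : b.rank = 1)
    (v : Matrix (Fin D) (Fin (N - D)) F → ℝ) (z : Matrix (Fin D) (Fin (N - D)) F) :
    (matE (bilinearFormsGraph F D N) *ᵥ v) z =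
      (Fintype.card (Matrix (Fin D) (Fin (N - D)) F) : ℝ)⁻¹ *
        ∑ w, v w * rankOneSum F (Fin D) (Fin (N - D)) (w - z).rank := by
  have hX : (Fintype.card (Matrix (Fin D) (Fin (N - D)) F) : ℝ) ≠ 0 := by
    exact_mod_cast Fintype.card_ne_zero
  have hv : v = (Fintype.card (Matrix (Fin D) (Fin (N - D)) F) : ℝ)⁻¹ •
      ∑ a, fun z => ((∑ w, (v w : ℂ) * matChar a (-w)) * matChar a z).re := by
    ext z
    rw [Pi.smul_apply, Finset.sum_apply, ← Complex.re_sum, sum_sum_matChar, smul_eq_mul]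
    norm_cast
    rw [inv_mul_cancel_left₀ hX]
  have hE : ∀ a : Matrix (Fin D) (Fin (N - D)) F, ∀ c : ℂ,
      matE (bilinearFormsGraph F D N) *ᵥ (fun z => (c * matChar a z).re) =
        if a.rank = 1 then fun z => (c * matChar a z).re else 0 := by
    intro a c
    rw [matE, secondEigenvalue_bilinearFormsGraph b hb]
    have h := adjacencyMatrix_mulVec_matChar c a
    split_ifs with ha
    · exact primitiveIdempotent_mulVec_self _ _ _ (ha ▸ h)
    · exact primitiveIdempotent_mulVec_of_ne _ (adjacencyMatrix_isSymm _) _ _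
        (rankOneSum_strictAnti.injective.ne ha) _ h
  conv_lhs => rw [hv]
  rw [Matrix.mulVec_smul, Matrix.mulVec_sum, Pi.smul_apply, Finset.sum_apply, smul_eq_mul]
  congr 1
  simp_rw [hE, ite_apply, Pi.zero_apply]
  rw [← Finset.sum_filter, ← Complex.re_sum]
  simp_rw [Finset.sum_mul]
  rw [Finset.sum_comm, Complex.re_sum]
  refine Finset.sum_congr rfl fun w _ => ?_
  simp_rw [mul_assoc, ← matChar_add_right]
  rw [← Finset.mul_sum, Complex.re_ofReal_mul]
  congr 1
  have := sum_rankOne_matChar (-w + z)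
  rw [rankOne] at this
  rw [this, Complex.ofReal_re, ← Matrix.rank_neg']
  congr 2
  abel

end Spectrum

/-! ### Fourier coefficients on rank-one matrices and the local adjacency operator. -/

section NortonProduct

open scoped Classical
open Matrix

variable {F : Type*} [Field F] [Fintype F]

section General

variable {ι κ : Type*} [Fintype ι] [Fintype κ] [DecidableEq ι] [DecidableEq κ]

/-- The function on matrices with Fourier coefficients `g a` at the characters of matrices `a` of
rank one, based at `x`. -/
noncomputable def charTransform (x : Matrix ι κ F) (g : Matrix ι κ F → ℂ) (z : Matrix ι κ F) : ℂ :=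
  ∑ a ∈ rankOne F ι κ, g a * matChar a (x - z)

theorem charTransform_congr {x : Matrix ι κ F} {g h : Matrix ι κ F → ℂ}
    (H : ∀ a, a.rank = 1 → g a = h a) : charTransform x g = charTransform x h := by
  ext z
  exact Finset.sum_congr rfl fun a ha => by rw [H a (mem_rankOne.mp ha)]

/-- This change of base point is what allows the iterates taken from y to be compared with those
taken from x. -/
theorem charTransform_base (x y : Matrix ι κ F) (g : Matrix ι κ F → ℂ) :
    charTransform y g = charTransform x fun a => matChar a (y - x) * g a := by
  ext z
  refine Finset.sum_congr rfl fun a _ => ?_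
  rw [← sub_add_sub_cancel y x z, matChar_add_right]
  ring

theorem sum_charTransform_mul_matChar (x : Matrix ι κ F) (g : Matrix ι κ F → ℂ)
    (a : Matrix ι κ F) (ha : a.rank = 1) :
    ∑ z, charTransform x g z * matChar a (z - x) = (Fintype.card (Matrix ι κ F) : ℂ) * g a := by
  simp only [charTransform, Finset.sum_mul]
  rw [Finset.sum_comm]
  have h2 : ∀ c : Matrix ι κ F, ∑ z, g c * matChar c (x - z) * matChar a (z - x) =
      if a = c then (Fintype.card (Matrix ι κ F) : ℂ) * g c else 0 := by
    intro c
    have : ∀ z, g c * matChar c (x - z) * matChar a (z - x) = g c * matChar (a - c) (z - x) := by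
      intro z
      rw [mul_assoc, sub_eq_add_neg a c, matChar_add_left, matChar_neg_left, ← matChar_neg_right,
        neg_sub, mul_comm (matChar a _)]
    simp_rw [this]
    have hs := (Equiv.subRight x).sum_comp fun z => matChar (a - c) z
    simp only [Equiv.subRight_apply] at hs
    rw [← Finset.mul_sum, hs, sum_matChar]
    simp [sub_eq_zero, mul_comm]
  simp_rw [h2]
  rw [Finset.sum_ite_eq, if_pos (mem_rankOne.mpr ha)]

theorem eq_zero_of_charTransform_eq_zero {x : Matrix ι κ F} {g : Matrix ι κ F → ℂ}
    (h : charTransform x g = 0) (a : Matrix ι κ F) (ha : a.rank = 1) : g a = 0 := by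
  have h1 := sum_charTransform_mul_matChar x g a ha
  simp only [h, Pi.zero_apply, zero_mul, Finset.sum_const_zero] at h1
  exact (mul_eq_zero.mp h1.symm).resolve_left (by exact_mod_cast Fintype.card_ne_zero)

/-- The sum of `g` over the matrices of rank one that are at distance one from `c`. -/
noncomputable def localSum (g : Matrix ι κ F → ℂ) (c : Matrix ι κ F) : ℂ :=
  ∑ b ∈ (rankOne F ι κ).filter fun b => (c - b).rank = 1, g b

theorem exists_smul_of_rank_sub_vecMulVec {u p : ι → F} {v r : κ → F} (hu : u ≠ 0) (hv : v ≠ 0)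
    (h : (vecMulVec u v - vecMulVec p r).rank = 1) :
    (∃ s : F, p = s • u) ∨ ∃ s : F, r = s • v := by
  by_contra hc
  push Not at hc
  have e : vecMulVec u v = replicateCol Unit u * replicateRow Unit v := vecMulVec_eq Unit u v
  rw [e, rank_sub_not_col_not_row] at h
  · simp at h
  · intro g hg
    obtain ⟨i, hi⟩ := Function.ne_iff.mp hu
    ext ⟨⟩
    have := congrFun hg i
    simp only [Matrix.mulVec, dotProduct, Finset.univ_unique, Finset.sum_singleton,
      replicateCol_apply, Pi.zero_apply] at this hi
    simpa [hi] using this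
  · intro g hg
    obtain ⟨i, hi⟩ := Function.ne_iff.mp hv
    ext ⟨⟩
    have := congrFun hg i
    simp only [Matrix.vecMul, dotProduct, Finset.univ_unique, Finset.sum_singleton,
      replicateRow_apply, Pi.zero_apply] at this hi
    simpa [hi] using this
  · intro s hs
    refine hc.1 (s ()) ?_
    rw [hs]
    ext i
    simp [Matrix.mulVec, dotProduct, mul_comm]
  · intro s hs
    refine hc.2 (s ()) ?_
    rw [hs]
    ext i
    simp [Matrix.vecMul, dotProduct]

/-- The rank-one neighbours of uvᵀ are the other nonzero matrices uwᵀ and wvᵀ. These two families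
meet in the nonzero multiples of uvᵀ, and inclusion-exclusion gives the formula; g 0 compensates for
letting w and s be 0. -/
theorem localSum_vecMulVec (g : Matrix ι κ F → ℂ) {u : ι → F} {v : κ → F} (hu : u ≠ 0)
    (hv : v ≠ 0) :
    localSum g (vecMulVec u v) = ∑ w : κ → F, g (vecMulVec u w) + ∑ w : ι → F, g (vecMulVec w v)
      - ∑ s : F, g (s • vecMulVec u v) - g (vecMulVec u v) - g 0 := by
  have hi1 : Function.Injective fun w : κ → F => vecMulVec u w := by
    intro w w' h
    obtain ⟨i, hi⟩ := Function.ne_iff.mp hu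
    ext j
    exact mul_left_cancel₀ hi (congrFun (congrFun h i) j)
  have hi2 : Function.Injective fun w : ι → F => vecMulVec w v := by
    intro w w' h
    obtain ⟨j, hj⟩ := Function.ne_iff.mp hv
    ext i
    exact mul_right_cancel₀ hj (congrFun (congrFun h i) j)
  have hne : vecMulVec u v ≠ 0 := by
    intro h
    have := Matrix.rank_vecMulVec_eq_one u v hu hv
    simp [h] at this
  have hi3 : Function.Injective fun s : F => s • vecMulVec u v := smul_left_injective F hne
  have hz : vecMulVec u (0 : κ → F) = 0 := by ext; simp [vecMulVec_apply]
  set A := (Finset.univ.erase (0 : κ → F)).image fun w => vecMulVec u w with hA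
  set B := (Finset.univ.erase (0 : ι → F)).image fun w => vecMulVec w v with hB
  have hAB : A ∩ B = (Finset.univ.erase (0 : F)).image fun s => s • vecMulVec u v := by
    ext c
    simp only [hA, hB, Finset.mem_inter, Finset.mem_image, Finset.mem_erase, Finset.mem_univ,
      and_true]
    constructor
    · rintro ⟨⟨w, hw, rfl⟩, w', hw', h⟩
      obtain ⟨s, hs, rfl, rfl⟩ := (vecMulVec_eq_vecMulVec_iff hu hw).mp h
      refine ⟨s, hs, ?_⟩
      rw [vecMulVec_smul, smul_smul, mul_inv_cancel₀ hs, one_smul]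
    · rintro ⟨s, hs, rfl⟩
      exact ⟨⟨s • v, smul_ne_zero hs hv, vecMulVec_smul _ _ _⟩,
        s • u, smul_ne_zero hs hu, smul_vecMulVec _ _ _⟩
  have hS : ((rankOne F ι κ).filter fun b => (vecMulVec u v - b).rank = 1) =
      (A ∪ B).erase (vecMulVec u v) := by
    ext c
    simp only [hA, hB, Finset.mem_filter, mem_rankOne, Finset.mem_erase, Finset.mem_union,
      Finset.mem_image, Finset.mem_univ, and_true]
    constructor
    · rintro ⟨hc, h⟩
      obtain ⟨p, r, hp, hr, rfl⟩ := Matrix.exists_eq_vecMulVec_of_rank_eq_one c hc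
      refine ⟨fun h0 => ?_, ?_⟩
      · simp [h0] at h
      · rcases exists_smul_of_rank_sub_vecMulVec hu hv h with ⟨s, rfl⟩ | ⟨s, rfl⟩
        · refine .inl ⟨s • r, smul_ne_zero (left_ne_zero_of_smul hp) hr, ?_⟩
          rw [smul_vecMulVec, vecMulVec_smul]
        · refine .inr ⟨s • p, smul_ne_zero (left_ne_zero_of_smul hr) hp, ?_⟩
          rw [smul_vecMulVec, vecMulVec_smul]
    · rintro ⟨h0, ⟨w, hw, rfl⟩ | ⟨w, hw, rfl⟩⟩
      · refine ⟨Matrix.rank_vecMulVec_eq_one _ _ hu hw, ?_⟩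
        rw [← vecMulVec_sub]
        refine Matrix.rank_vecMulVec_eq_one _ _ hu fun h => h0 ?_
        rw [sub_eq_zero.mp h]
      · refine ⟨Matrix.rank_vecMulVec_eq_one _ _ hw hv, ?_⟩
        rw [← sub_vecMulVec]
        refine Matrix.rank_vecMulVec_eq_one _ _ (fun h => h0 ?_) hv
        rw [sub_eq_zero.mp h]
  have hmem : vecMulVec u v ∈ A ∪ B := Finset.mem_union_left _ (by
    rw [hA]
    exact Finset.mem_image_of_mem _ (Finset.mem_erase.mpr ⟨hv, Finset.mem_univ _⟩))
  have h1 := Finset.add_sum_erase _ g hmem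
  have h2 := Finset.sum_union_inter (s₁ := A) (s₂ := B) (f := g)
  rw [hAB, hA, hB, Finset.sum_image hi1.injOn, Finset.sum_image hi2.injOn,
    Finset.sum_image hi3.injOn, sum_erase_zero, sum_erase_zero, sum_erase_zero,
    zero_smul, zero_vecMulVec, hz] at h2
  rw [localSum, hS]
  rw [hA, hB] at h1 ⊢
  linear_combination h1 + h2

theorem sum_ite_dotProduct_eq_zero (ξ : ι → F) :
    ∑ w : ι → F, (if w ⬝ᵥ ξ = 0 then (1 : ℂ) else 0) =
      (Fintype.card F : ℂ) ^ Fintype.card ι / Fintype.card F *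
        (1 + ((Fintype.card F : ℂ) - 1) * if ξ = 0 then 1 else 0) := by
  have hq := card_ne_zero_complex F
  have h : ∀ w : ι → F, (if w ⬝ᵥ ξ = 0 then (1 : ℂ) else 0) =
      (Fintype.card F : ℂ)⁻¹ * ∑ s : F, stdChar F (s * (w ⬝ᵥ ξ)) := by
    intro w
    rw [sum_stdChar_mul]
    split_ifs <;> simp [hq]
  simp_rw [h]
  rw [← Finset.mul_sum, Finset.sum_comm]
  have h' : ∀ s : F, ∑ w : ι → F, stdChar F (s * (w ⬝ᵥ ξ)) =
      if s • ξ = 0 then (Fintype.card F : ℂ) ^ Fintype.card ι else 0 := by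
    intro s
    rw [← sum_stdChar_dotProduct]
    simp
  simp_rw [h']
  by_cases hξ : ξ = 0
  · simp [hξ]
  · simp [hξ]
    field_simp

/-- The combination `c₀ f + c₁ τ + c₂ α + c₃ β + c₄` of the character value `f` of `y` and the
indicators of `tr(aᵀ y) = 0`, of `aᵀ y = 0`, of `a yᵀ = 0`, and of everything. -/
noncomputable def basicComb (y : Matrix ι κ F) (c : Fin 5 → ℝ) (a : Matrix ι κ F) : ℂ :=
  c 0 * matChar a y + c 1 * (if trace (aᵀ * y) = 0 then 1 else 0) +
    c 2 * (if aᵀ * y = 0 then 1 else 0) + c 3 * (if a * yᵀ = 0 then 1 else 0) + c 4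

theorem transpose_vecMulVec_mul_eq_zero {u : ι → F} {v : κ → F} {y : Matrix ι κ F} :
    (vecMulVec u v)ᵀ * y = 0 ↔ v = 0 ∨ u ᵥ* y = 0 := by
  rw [transpose_vecMulVec, Matrix.vecMulVec_mul, vecMulVec_eq_zero]

theorem vecMulVec_mul_transpose_eq_zero {u : ι → F} {v : κ → F} {y : Matrix ι κ F} :
    vecMulVec u v * yᵀ = 0 ↔ u = 0 ∨ y *ᵥ v = 0 := by
  rw [Matrix.vecMulVec_mul, vecMulVec_eq_zero, Matrix.vecMul_transpose]

/-- The matrix of `localSum` on the span of the functions in `basicComb`, where `q = |F|`,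
`a = |F|^|ι|`, `b = |F|^|κ|`, and `m = |F|^(rank y)`. -/
noncomputable def localStep (q a b m : ℝ) (c : Fin 5 → ℝ) : Fin 5 → ℝ :=
  ![-c 0, -q * c 0 - q * c 1, b * c 0 + (b - b / q) * c 1 + (b - q - 1) * c 2,
    a * c 0 + (a - a / q) * c 1 + (a - q - 1) * c 3,
    -c 0 + (b / q + a / q - 2) * c 1 + (a / m - 1) * c 2 + (b / m - 1) * c 3
      + (a + b - q - 2) * c 4]

/-- In `localSum_vecMulVec` each of the three sums sends the five functions back into their span.
For instance, the sum of f(uwᵀ) over w is |F|^|κ| when uᵀy = 0 and vanishes otherwise. -/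
theorem localSum_basicComb (y : Matrix ι κ F) (c : Fin 5 → ℝ) (a : Matrix ι κ F)
    (ha : a.rank = 1) :
    localSum (basicComb y c) a = basicComb y (localStep (Fintype.card F)
      ((Fintype.card F : ℝ) ^ Fintype.card ι) ((Fintype.card F : ℝ) ^ Fintype.card κ)
      ((Fintype.card F : ℝ) ^ y.rank) c) a := by
  obtain ⟨u, v, hu, hv, rfl⟩ := Matrix.exists_eq_vecMulVec_of_rank_eq_one a ha
  have hq := card_ne_zero_complex F
  have h1 : ∑ w : κ → F, stdChar F (u ⬝ᵥ (y *ᵥ w)) =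
      if u ᵥ* y = 0 then (Fintype.card F : ℂ) ^ Fintype.card κ else 0 := by
    rw [← sum_stdChar_dotProduct]
    simp_rw [Matrix.dotProduct_mulVec, dotProduct_comm]
  have h2 : ∑ w : ι → F, stdChar F (w ⬝ᵥ (y *ᵥ v)) =
      if y *ᵥ v = 0 then (Fintype.card F : ℂ) ^ Fintype.card ι else 0 :=
    sum_stdChar_dotProduct _
  have h3 : ∑ s : F, stdChar F (s * (u ⬝ᵥ (y *ᵥ v))) =
      if u ⬝ᵥ (y *ᵥ v) = 0 then (Fintype.card F : ℂ) else 0 := sum_stdChar_mul _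
  have h4 := sum_ite_dotProduct_eq_zero (F := F) (u ᵥ* y)
  have h5 := sum_ite_dotProduct_eq_zero (F := F) (y *ᵥ v)
  have h4' : ∑ w : κ → F, (if u ⬝ᵥ (y *ᵥ w) = 0 then (1 : ℂ) else 0) =
      ∑ w : κ → F, (if w ⬝ᵥ (u ᵥ* y) = 0 then (1 : ℂ) else 0) := by
    simp_rw [Matrix.dotProduct_mulVec, dotProduct_comm]
  have h6 := card_ker_complex y
  have h7 := card_ker_complex yᵀ
  rw [Matrix.rank_transpose] at h7
  simp_rw [Matrix.mulVec_transpose] at h7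
  have h8 : ∑ w : κ → F, (if w = 0 ∨ u ᵥ* y = 0 then (1 : ℂ) else 0) =
      1 + ((Fintype.card F : ℂ) ^ Fintype.card κ - 1) * if u ᵥ* y = 0 then 1 else 0 := by
    by_cases h : u ᵥ* y = 0 <;> simp [h]
  have h9 : ∑ w : ι → F, (if w = 0 ∨ y *ᵥ v = 0 then (1 : ℂ) else 0) =
      1 + ((Fintype.card F : ℂ) ^ Fintype.card ι - 1) * if y *ᵥ v = 0 then 1 else 0 := by
    by_cases h : y *ᵥ v = 0 <;> simp [h]
  have h10 : ∑ s : F, (if s = 0 ∨ u ⬝ᵥ (y *ᵥ v) = 0 then (1 : ℂ) else 0) =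
      1 + ((Fintype.card F : ℂ) - 1) * if u ⬝ᵥ (y *ᵥ v) = 0 then 1 else 0 := by
    by_cases h : u ⬝ᵥ (y *ᵥ v) = 0 <;> simp [h]
  have h11 : ∑ s : F, (if s = 0 ∨ u ᵥ* y = 0 then (1 : ℂ) else 0) =
      1 + ((Fintype.card F : ℂ) - 1) * if u ᵥ* y = 0 then 1 else 0 := by
    by_cases h : u ᵥ* y = 0 <;> simp [h]
  have h12 : ∑ s : F, (if s = 0 ∨ y *ᵥ v = 0 then (1 : ℂ) else 0) =
      1 + ((Fintype.card F : ℂ) - 1) * if y *ᵥ v = 0 then 1 else 0 := by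
    by_cases h : y *ᵥ v = 0 <;> simp [h]
  have h13 : ∑ w : ι → F, (if w ᵥ* y = 0 then (1 : ℂ) else 0) =
      (Fintype.card F : ℂ) ^ Fintype.card ι / (Fintype.card F : ℂ) ^ y.rank := by
    rw [← h7]; simp
  have h14 : ∑ w : κ → F, (if y *ᵥ w = 0 then (1 : ℂ) else 0) =
      (Fintype.card F : ℂ) ^ Fintype.card κ / (Fintype.card F : ℂ) ^ y.rank := by
    rw [← h6]; simp
  rw [localSum_vecMulVec _ hu hv]
  simp only [basicComb, ← smul_vecMulVec, matChar_vecMulVec_left, trace_transpose_vecMulVec_mul,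
    transpose_vecMulVec_mul_eq_zero, vecMulVec_mul_transpose_eq_zero, hu, hv, false_or,
    smul_dotProduct, smul_eq_mul, mul_eq_zero, Matrix.smul_vecMul, smul_eq_zero, or_false]
  simp only [Finset.sum_add_distrib, ← Finset.mul_sum, h1, h2, h3, h4', h4, h5, h8, h9, h10, h11,
    h12, h13, h14, Finset.sum_const, Finset.card_univ, nsmul_eq_mul, Fintype.card_fun,
    matChar_zero_left, Matrix.transpose_zero, Matrix.zero_mul, Matrix.trace_zero, if_true,
    localStep, Matrix.cons_val]
  push_cast
  have i1 : (if u ᵥ* y = 0 then (Fintype.card F : ℂ) ^ Fintype.card κ else 0) =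
    (Fintype.card F : ℂ) ^ Fintype.card κ * if u ᵥ* y = 0 then 1 else 0 := by simp
  have i2 : (if y *ᵥ v = 0 then (Fintype.card F : ℂ) ^ Fintype.card ι else 0) =
    (Fintype.card F : ℂ) ^ Fintype.card ι * if y *ᵥ v = 0 then 1 else 0 := by simp
  have i3 : (if u ⬝ᵥ (y *ᵥ v) = 0 then (Fintype.card F : ℂ) else 0) =
    (Fintype.card F : ℂ) * if u ⬝ᵥ (y *ᵥ v) = 0 then 1 else 0 := by simp
  rw [i1, i2, i3]
  -- The identity is linear in the three indicators, so no relation between them is needed.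
  generalize (if u ᵥ* y = 0 then (1 : ℂ) else 0) = α
  generalize (if y *ᵥ v = 0 then (1 : ℂ) else 0) = β
  generalize (if u ⬝ᵥ (y *ᵥ v) = 0 then (1 : ℂ) else 0) = τ
  field_simp
  ring

end General

end NortonProduct

/-! ### Norton iterates and their linear independence. -/

section NortonIterates

open scoped Classical
open Matrix

variable {F : Type*} [Field F] [Fintype F]

section General

variable {ι κ : Type*} [Fintype ι] [Fintype κ] [DecidableEq ι] [DecidableEq κ]

/-- If the character were constant on nonzero elements, then splitting s = (s - 1) + 1 for some s
other than 0 and 1 would force the constant to be 1, making the character trivial. -/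
theorem exists_stdChar_ne (hF : Fintype.card F ≠ 2) :
    ∃ s : F, s ≠ 0 ∧ stdChar F s ≠ stdChar F 1 := by
  have h2 : 2 < Fintype.card F := lt_of_le_of_ne Fintype.one_lt_card hF.symm
  obtain ⟨s, hs⟩ : ∃ s : F, s ∉ ({0, 1} : Finset F) := by
    by_contra hc
    push Not at hc
    have := Finset.card_le_card (fun s _ => hc s : (Finset.univ : Finset F) ⊆ {0, 1})
    rw [Finset.card_univ] at this
    have := Finset.card_le_two (a := (0 : F)) (b := 1)
    omega
  simp only [Finset.mem_insert, Finset.mem_singleton, not_or] at hs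
  by_contra hc
  push Not at hc
  have h1 := hc s hs.1
  rw [← sub_add_cancel s 1, AddChar.map_add_eq_mul, hc _ (sub_ne_zero.mpr hs.2)] at h1
  have h3 : stdChar F (1 : F) ≠ 0 := fun h0 => by
    have := AddChar.map_add_eq_mul (stdChar F) 1 (-1)
    simp [h0] at this
  have h4 : stdChar F (1 : F) = 1 := mul_right_cancel₀ h3 (by rw [h1, one_mul])
  have h5 := sum_stdChar_mul (1 : F)
  rw [if_neg one_ne_zero] at h5
  have h6 : ∀ t : F, stdChar F (t * 1) = 1 := fun t => by
    by_cases ht : t = 0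
    · simp [ht]
    · rw [mul_one, hc t ht, h4]
  rw [Finset.sum_congr rfl fun t _ => h6 t] at h5
  simp at h5

theorem exists_vecMul_eq_zero (y : Matrix ι κ F) (h : y.rank < Fintype.card ι) :
    ∃ u : ι → F, u ≠ 0 ∧ u ᵥ* y = 0 := by
  by_contra hc
  push Not at hc
  have := Matrix.rank_eq_card_of_mulVec_injective yᵀ fun p hp => by
    by_contra h0
    exact hc p h0 (by rwa [Matrix.mulVec_transpose] at hp)
  rw [Matrix.rank_transpose] at this
  omega

theorem exists_mulVec_eq_zero_of_rank_lt (y : Matrix ι κ F) (h : y.rank < Fintype.card κ) :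
    ∃ v : κ → F, v ≠ 0 ∧ y *ᵥ v = 0 := by
  by_contra hc
  push Not at hc
  have := Matrix.rank_eq_card_of_mulVec_injective y fun p hp => by
    by_contra h0
    exact hc p h0 hp
  omega

/-- Five test matrices suffice: u₀ and v₀ annihilate y from the left and the right, and u₁ᵀyv₁ = 1.
The products of u₀, u₁ with v₀, v₁ separate all but f and the constant; these are separated by
rescaling u₁ to change the character value. -/
theorem eq_zero_of_basicComb_eq_zero (hF : Fintype.card F ≠ 2) {y : Matrix ι κ F} (hy : y ≠ 0)
    (h1 : y.rank < Fintype.card ι) (h2 : y.rank < Fintype.card κ) {c : Fin 5 → ℝ}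
    (hc : ∀ a : Matrix ι κ F, a.rank = 1 → basicComb y c a = 0) : c = 0 := by
  obtain ⟨u₀, hu₀, hu₀'⟩ := exists_vecMul_eq_zero y h1
  obtain ⟨v₀, hv₀, hv₀'⟩ := exists_mulVec_eq_zero_of_rank_lt y h2
  obtain ⟨s, hs, hs'⟩ := exists_stdChar_ne hF
  obtain ⟨u₁, v₁, ht⟩ : ∃ (u₁ : ι → F) (v₁ : κ → F), u₁ ⬝ᵥ (y *ᵥ v₁) = 1 := by
    obtain ⟨i, j, hij⟩ : ∃ i j, y i j ≠ 0 := by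
      by_contra h
      push Not at h
      exact hy (by ext i j; exact h i j)
    exact ⟨Pi.single i (y i j)⁻¹, Pi.single j 1, by simp [hij]⟩
  have hu₁ : u₁ ≠ 0 := by rintro rfl; simp at ht
  have hv₁ : v₁ ≠ 0 := by rintro rfl; simp at ht
  have hu₁' : u₁ ᵥ* y ≠ 0 := fun h => by
    rw [Matrix.dotProduct_mulVec, h] at ht; simp at ht
  have hv₁' : y *ᵥ v₁ ≠ 0 := fun h => by rw [h] at ht; simp at ht
  have e : ∀ (u : ι → F) (v : κ → F), u ≠ 0 → v ≠ 0 →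
      c 0 * stdChar F (u ⬝ᵥ (y *ᵥ v)) + c 1 * (if u ⬝ᵥ (y *ᵥ v) = 0 then (1 : ℂ) else 0) +
      c 2 * (if u ᵥ* y = 0 then 1 else 0) + c 3 * (if y *ᵥ v = 0 then 1 else 0) + c 4 = 0 := by
    intro u v hu hv
    have := hc (vecMulVec u v) (Matrix.rank_vecMulVec_eq_one u v hu hv)
    simpa only [basicComb, matChar_vecMulVec_left, trace_transpose_vecMulVec_mul,
      transpose_vecMulVec_mul_eq_zero, vecMulVec_mul_transpose_eq_zero, hu, hv, false_or] using this
  have t0 : ∀ v, u₀ ⬝ᵥ (y *ᵥ v) = 0 := fun v => by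
    rw [Matrix.dotProduct_mulVec, hu₀', zero_dotProduct]
  have e00 := e u₀ v₀ hu₀ hv₀
  have e01 := e u₀ v₁ hu₀ hv₁
  have e10 := e u₁ v₀ hu₁ hv₀
  have e11 := e u₁ v₁ hu₁ hv₁
  have es := e (s • u₁) v₁ (smul_ne_zero hs hu₁) hv₁
  simp only [smul_dotProduct, ht, smul_eq_mul, mul_one, hs, Matrix.smul_vecMul, smul_eq_zero,
    hu₁', hv₁', or_self, if_false, mul_zero, add_zero, one_ne_zero, hu₀', hv₀', dotProduct_zero,
    t0, if_true, AddChar.map_zero_eq_one] at e00 e01 e10 e11 es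
  have h0 : (c 0 : ℂ) = 0 := by
    have : (c 0 : ℂ) * (stdChar F s - stdChar F 1) = 0 := by linear_combination es - e11
    exact (mul_eq_zero.mp this).resolve_right (sub_ne_zero.mpr hs')
  have h4 : (c 4 : ℂ) = 0 := by linear_combination e11 - stdChar F 1 * h0
  have h3 : (c 3 : ℂ) = 0 := by linear_combination e00 - e01
  have h2 : (c 2 : ℂ) = 0 := by linear_combination e00 - e10
  have h1 : (c 1 : ℂ) = 0 := by linear_combination e00 - h0 - h4 - h3 - h2
  ext i
  fin_cases i
  · exact_mod_cast h0
  · exact_mod_cast h1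
  · exact_mod_cast h2
  · exact_mod_cast h3
  · exact_mod_cast h4

end General

/-- The five constant vectors are eigenvectors of the triangular map `localStep` whose sum is the
starting vector. The scalar in the last one is the mean of f over the rank-one matrices. -/
theorem localStep_iterate (q a b m : ℝ) (hq : 1 < q) (ha : 1 < a) (hb : 1 < b) (hm : m ≠ 0)
    (l : ℕ) :
    (localStep q a b m)^[l] ![1, 0, 0, 0, 0] =
      (-1 : ℝ) ^ l • ![1, -(q / (q - 1)), 0, 0, 1 / (q - 1)] +
      (-q) ^ l • ![0, q / (q - 1), -(b / (b - 1)), -(a / (a - 1)),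
        -(1 / (q - 1)) + 1 / (b - 1) + 1 / (a - 1) +
          (a * b / m - a - b + 1) / ((a - 1) * (b - 1))] +
      (b - q - 1) ^ l • ![0, 0, b / (b - 1), 0,
        -(1 / (b - 1)) - (a * b / m - a - b + 1) / ((a - 1) * (b - 1))] +
      (a - q - 1) ^ l • ![0, 0, 0, a / (a - 1),
        -(1 / (a - 1)) - (a * b / m - a - b + 1) / ((a - 1) * (b - 1))] +
      (a + b - q - 2) ^ l • ![0, 0, 0, 0, (a * b / m - a - b + 1) / ((a - 1) * (b - 1))] := by
  have hq1 : q - 1 ≠ 0 := by linarith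
  have ha1 : a - 1 ≠ 0 := by linarith
  have hb1 : b - 1 ≠ 0 := by linarith
  have hq0 : q ≠ 0 := by linarith
  induction l with
  | zero =>
    ext i
    fin_cases i <;> simp <;> field_simp <;> ring
  | succ l ih =>
    rw [Function.iterate_succ_apply', ih]
    simp only [pow_succ]
    generalize (-1 : ℝ) ^ l = p₁
    generalize (-q) ^ l = p₂
    generalize (b - q - 1) ^ l = p₃
    generalize (a - q - 1) ^ l = p₄
    generalize (a + b - q - 2) ^ l = p₅
    ext i
    fin_cases i <;> simp [localStep] <;> field_simp <;> ring

theorem eq_zero_of_sum_localStep_iterate {q a b m : ℝ} (hq : 1 < q) (ha : q < a) (hab : a < b)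
    (hm : 0 < m) (hma : m ≤ a / 2) (d : Fin 5 → ℝ)
    (h : ∑ l, d l • (localStep q a b m)^[(l : ℕ)] ![1, 0, 0, 0, 0] = 0) : d = 0 := by
  have hc : (a * b / m - a - b + 1) / ((a - 1) * (b - 1)) ≠ 0 := by
    -- The mean of f must not vanish; m ≤ a/2 makes a * b / m at least 2b, which exceeds a + b - 1.
    have h1 : 2 * b ≤ a * b / m := by
      rw [le_div_iff₀ hm]
      nlinarith
    apply div_ne_zero
    · linarith
    · exact mul_ne_zero (by linarith) (by linarith)
  have hq1 : q / (q - 1) ≠ 0 := div_ne_zero (by linarith) (by linarith)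
  have ha1 : a / (a - 1) ≠ 0 := div_ne_zero (by linarith) (by linarith)
  have hb1 : b / (b - 1) ≠ 0 := div_ne_zero (by linarith) (by linarith)
  let ev : Fin 5 → ℝ := ![-1, -q, b - q - 1, a - q - 1, a + b - q - 2]
  have hinj : Function.Injective ev := by
    intro i j hij
    fin_cases i <;> fin_cases j <;> simp [ev] at hij ⊢ <;> linarith
  simp_rw [localStep_iterate q a b m hq (by linarith) (by linarith) hm.ne', smul_add,
    Finset.sum_add_distrib, smul_smul, ← Finset.sum_smul] at h
  -- Each coordinate, read in order, isolates the value of the polynomial with coefficients d at one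
  -- more eigenvalue.
  have e0 := congrFun h 0
  have e1 := congrFun h 1
  have e2 := congrFun h 2
  have e3 := congrFun h 3
  have e4 := congrFun h 4
  simp only [Pi.add_apply, Pi.smul_apply, smul_eq_mul, Matrix.cons_val, mul_zero, add_zero,
    zero_add, mul_one, Pi.zero_apply] at e0 e1 e2 e3 e4
  simp only [e0, zero_mul, zero_add] at e1 e2 e3 e4
  have f1 := (mul_eq_zero.mp e1).resolve_right hq1
  simp only [f1, zero_mul, zero_add] at e2 e3 e4
  have f2 := (mul_eq_zero.mp e2).resolve_right hb1
  have f3 := (mul_eq_zero.mp e3).resolve_right ha1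
  simp only [f2, f3, zero_mul, zero_add] at e4
  have f4 := (mul_eq_zero.mp e4).resolve_right hc
  -- A polynomial of degree at most 4 with five distinct roots is zero.
  refine Matrix.eq_zero_of_forall_index_sum_mul_pow_eq_zero hinj fun j => ?_
  fin_cases j
  · exact e0
  · exact f1
  · exact f2
  · exact f3
  · exact f4

variable {D N : ℕ}

theorem ofReal_matE_mulVec (b : Matrix (Fin D) (Fin (N - D)) F) (hb : b.rank = 1)
    (x : Matrix (Fin D) (Fin (N - D)) F)
    (v : Matrix (Fin D) (Fin (N - D)) F → ℝ) (z : Matrix (Fin D) (Fin (N - D)) F) :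
    ((matE (bilinearFormsGraph F D N) *ᵥ v) z : ℂ) =
      (Fintype.card (Matrix (Fin D) (Fin (N - D)) F) : ℂ)⁻¹ *
        charTransform x (fun a => ∑ w, v w * matChar a (w - x)) z := by
  rw [matE_mulVec_apply b hb, charTransform]
  push_cast
  congr 1
  simp_rw [← sum_rankOne_matChar, Finset.sum_mul, Finset.mul_sum]
  rw [Finset.sum_comm]
  refine Finset.sum_congr rfl fun a _ => Finset.sum_congr rfl fun w _ => ?_
  rw [mul_assoc, ← matChar_add_right, sub_add_sub_cancel]

theorem ofReal_matE_mulVec_setVec (b : Matrix (Fin D) (Fin (N - D)) F) (hb : b.rank = 1)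
    (x : Matrix (Fin D) (Fin (N - D)) F)
    (S : Set (Matrix (Fin D) (Fin (N - D)) F)) (z : Matrix (Fin D) (Fin (N - D)) F) :
    ((matE (bilinearFormsGraph F D N) *ᵥ setVec S) z : ℂ) =
      (Fintype.card (Matrix (Fin D) (Fin (N - D)) F) : ℂ)⁻¹ *
        charTransform x (fun a => ∑ w, if w ∈ S then matChar a (w - x) else 0) z := by
  rw [ofReal_matE_mulVec b hb x]
  congr 2
  ext a
  refine Finset.sum_congr rfl fun w _ => ?_
  by_cases hw : w ∈ S <;> simp [setVec, hw]

theorem ofReal_matE_mulVec_hatVec (b : Matrix (Fin D) (Fin (N - D)) F) (hb : b.rank = 1)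
    (x y z : Matrix (Fin D) (Fin (N - D)) F) :
    ((matE (bilinearFormsGraph F D N) *ᵥ hatVec y) z : ℂ) =
      (Fintype.card (Matrix (Fin D) (Fin (N - D)) F) : ℂ)⁻¹ *
        charTransform x (fun a => matChar a (y - x)) z := by
  rw [hatVec, ofReal_matE_mulVec_setVec b hb x]
  simp

/-- A product of characters adds their indices, so the coefficient at c collects the pairs (c - b,
b) with both entries of rank one. This is exactly `localSum`. -/
theorem sum_charTransform_mul_charTransform {ι κ : Type*} [Fintype ι] [Fintype κ]
    [DecidableEq ι] [DecidableEq κ] (x : Matrix ι κ F) (g : Matrix ι κ F → ℂ)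
    (c : Matrix ι κ F) :
    ∑ w, charTransform x (fun _ => 1) w * charTransform x g w * matChar c (w - x) =
      (Fintype.card (Matrix ι κ F) : ℂ) * localSum g c := by
  simp only [charTransform, one_mul, Finset.sum_mul_sum]
  simp_rw [Finset.sum_mul]
  rw [Finset.sum_comm]
  simp_rw [Finset.sum_comm (s := Finset.univ)]
  have h : ∀ a b : Matrix ι κ F,
      ∑ w, matChar a (x - w) * (g b * matChar b (x - w)) * matChar c (w - x) =
        if a = c - b then (Fintype.card (Matrix ι κ F) : ℂ) * g b else 0 := by
    intro a b
    have e : ∀ w, matChar a (x - w) * (g b * matChar b (x - w)) * matChar c (w - x) =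
        g b * matChar (a - (c - b)) (x - w) := by
      intro w
      rw [← neg_sub x w, matChar_neg_right, ← matChar_neg_left, sub_sub_eq_add_sub,
        sub_eq_add_neg (a + b), matChar_add_left, matChar_add_left]
      ring
    simp_rw [e]
    have hs := (Equiv.subLeft x).sum_comp fun z => matChar (a - (c - b)) z
    simp only [Equiv.subLeft_apply] at hs
    rw [← Finset.mul_sum, hs, sum_matChar]
    by_cases h : a = c - b <;> simp [h, sub_eq_zero, mul_comm]
  simp_rw [h]
  rw [Finset.sum_comm]
  simp_rw [Finset.sum_ite_eq', mem_rankOne]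
  rw [localSum, Finset.sum_filter, Finset.mul_sum]
  simp

/-- The translation of the Norton product into Fourier coefficients: E x̂ has constant coefficients,
multiplication becomes convolution, and E discards the coefficients outside rank one. -/
theorem ofReal_nortonMul (b : Matrix (Fin D) (Fin (N - D)) F) (hb : b.rank = 1)
    (x : Matrix (Fin D) (Fin (N - D)) F) (v : Matrix (Fin D) (Fin (N - D)) F → ℝ)
    (C : ℂ) (g : Matrix (Fin D) (Fin (N - D)) F → ℂ)
    (hv : ∀ z, (v z : ℂ) = C * charTransform x g z) (z : Matrix (Fin D) (Fin (N - D)) F) :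
    (nortonMul (bilinearFormsGraph F D N) (matE (bilinearFormsGraph F D N) *ᵥ hatVec x) v z : ℂ) =
      (Fintype.card (Matrix (Fin D) (Fin (N - D)) F) : ℂ)⁻¹ * C *
        charTransform x (localSum g) z := by
  have hX : (Fintype.card (Matrix (Fin D) (Fin (N - D)) F) : ℂ) ≠ 0 := by
    exact_mod_cast Fintype.card_ne_zero
  rw [nortonMul, ofReal_matE_mulVec b hb x, mul_assoc]
  congr 1
  rw [charTransform, charTransform, Finset.mul_sum]
  refine Finset.sum_congr rfl fun a _ => ?_
  rw [← mul_assoc]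
  congr 1
  have h := sum_charTransform_mul_charTransform x g a
  simp only [Pi.mul_apply, Complex.ofReal_mul, hv, ofReal_matE_mulVec_hatVec b hb x x, sub_self,
    matChar_zero_right]
  rw [← mul_right_inj' hX, mul_left_comm, ← h, Finset.mul_sum, Finset.mul_sum]
  refine Finset.sum_congr rfl fun w _ => ?_
  field_simp

theorem ofReal_nortonIter (b : Matrix (Fin D) (Fin (N - D)) F) (hb : b.rank = 1)
    (x y : Matrix (Fin D) (Fin (N - D)) F) (l : ℕ) (z : Matrix (Fin D) (Fin (N - D)) F) :
    (nortonIter (bilinearFormsGraph F D N) x y l z : ℂ) =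
      ((Fintype.card (Matrix (Fin D) (Fin (N - D)) F) : ℂ)⁻¹) ^ (l + 1) *
        charTransform x (basicComb (y - x) ((localStep (Fintype.card F)
          ((Fintype.card F : ℝ) ^ Fintype.card (Fin D))
          ((Fintype.card F : ℝ) ^ Fintype.card (Fin (N - D)))
          ((Fintype.card F : ℝ) ^ (y - x).rank))^[l] ![1, 0, 0, 0, 0])) z := by
  induction l generalizing z with
  | zero =>
    rw [nortonIter, ofReal_matE_mulVec_hatVec b hb x, zero_add, pow_one]
    congr 2
    ext a
    simp [basicComb]
  | succ l ih =>
    rw [nortonIter, ofReal_nortonMul b hb x _ _ _ ih, ← pow_succ', Function.iterate_succ_apply',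
      charTransform_congr fun a ha => localSum_basicComb (y - x) _ a ha]

theorem basicComb_linear {ι κ : Type*} [Fintype ι] [Fintype κ] {σ : Type*} (s : Finset σ)
    (y : Matrix ι κ F) (d : σ → ℝ) (c : σ → Fin 5 → ℝ) (a : Matrix ι κ F) :
    basicComb y (∑ i ∈ s, d i • c i) a = ∑ i ∈ s, (d i : ℂ) * basicComb y (c i) a := by
  simp only [basicComb, Finset.sum_apply, Pi.smul_apply, smul_eq_mul, Complex.ofReal_sum,
    Complex.ofReal_mul, Finset.sum_mul, mul_add, Finset.sum_add_distrib, mul_assoc]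

theorem linearIndependent_nortonIter (hF : Fintype.card F ≠ 2)
    (x y : Matrix (Fin D) (Fin (N - D)) F) (hN : 2 * D < N) (hk : 1 ≤ (y - x).rank)
    (hkD : (y - x).rank < D) :
    LinearIndependent ℝ fun l : Fin 5 => nortonIter (bilinearFormsGraph F D N) x y l := by
  have hq := one_lt_card_real F
  have hq0 : (0 : ℝ) < Fintype.card F := by linarith
  have hX : (Fintype.card (Matrix (Fin D) (Fin (N - D)) F) : ℝ) ≠ 0 := by
    exact_mod_cast Fintype.card_ne_zero
  obtain ⟨b, hb, -⟩ := Matrix.exists_rank_one_sub (y - x) ((y - x).rank - 1) (by omega)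
  rw [Fintype.linearIndependent_iff]
  intro d hd
  have h1 : charTransform x (basicComb (y - x) (∑ l : Fin 5,
      (d l * ((Fintype.card (Matrix (Fin D) (Fin (N - D)) F) : ℝ)⁻¹) ^ ((l : ℕ) + 1)) •
      (localStep (Fintype.card F) ((Fintype.card F : ℝ) ^ Fintype.card (Fin D))
          ((Fintype.card F : ℝ) ^ Fintype.card (Fin (N - D)))
          ((Fintype.card F : ℝ) ^ (y - x).rank))^[(l : ℕ)] ![1, 0, 0, 0, 0])) = 0 := by
    ext z
    have := congrArg (fun r : ℝ => (r : ℂ)) (congrFun hd z)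
    simp only [Finset.sum_apply, Pi.smul_apply, smul_eq_mul, Complex.ofReal_sum,
      Complex.ofReal_mul, ofReal_nortonIter b hb, Pi.zero_apply, Complex.ofReal_zero] at this
    rw [Pi.zero_apply, ← this]
    simp only [charTransform, basicComb_linear, Finset.sum_mul, Finset.mul_sum]
    rw [Finset.sum_comm]
    refine Finset.sum_congr rfl fun l _ => Finset.sum_congr rfl fun a _ => ?_
    push_cast
    ring
  have h2 := eq_zero_of_basicComb_eq_zero hF
    (fun h => by simp [h] at hk) (by simpa using hkD) (by simpa using (by omega))
    (eq_zero_of_charTransform_eq_zero h1)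
  have h3 := eq_zero_of_sum_localStep_iterate hq
    (by simpa using pow_lt_pow_right₀ hq (show 1 < D by omega))
    (by simpa using pow_lt_pow_right₀ hq (show D < N - D by omega)) (by positivity) (by
      -- Since the rank k of y - x is less than D and |F| ≥ 2, one has 2|F|^k ≤ |F|^(k+1) ≤ |F|^D.
      rw [le_div_iff₀ two_pos, Fintype.card_fin]
      calc (Fintype.card F : ℝ) ^ (y - x).rank * 2
          ≤ (Fintype.card F : ℝ) ^ (y - x).rank * Fintype.card F := by
            gcongr
            exact_mod_cast Fintype.one_lt_card
        _ = (Fintype.card F : ℝ) ^ ((y - x).rank + 1) := (pow_succ _ _).symm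
        _ ≤ _ := pow_le_pow_right₀ hq.le hkD) _ h2
  intro l
  have := congrFun h3 l
  simp only [Pi.zero_apply] at this
  exact (mul_eq_zero.mp this).resolve_right (pow_ne_zero _ (inv_ne_zero hX))

end NortonIterates

/-! ### Positions of p and r, and common-neighbour counts. -/

section LocalPartition

open scoped Classical
open Matrix

variable {F : Type*} [Field F] [Fintype F]

section General

variable {ι κ σ : Type*} [Fintype ι] [Fintype κ] [Fintype σ] [DecidableEq ι] [DecidableEq κ]
  [DecidableEq σ]

theorem sum_ite_dotProduct_eq {ξ : ι → F} (hξ : ξ ≠ 0) (e : F) :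
    ∑ w : ι → F, (if w ⬝ᵥ ξ = e then (1 : ℂ) else 0) =
      (Fintype.card F : ℂ) ^ Fintype.card ι / Fintype.card F := by
  have hq := card_ne_zero_complex F
  have h : ∀ w : ι → F, (if w ⬝ᵥ ξ = e then (1 : ℂ) else 0) =
      (Fintype.card F : ℂ)⁻¹ * ∑ s : F, stdChar F (s * (w ⬝ᵥ ξ - e)) := by
    intro w
    rw [sum_stdChar_mul]
    by_cases h : w ⬝ᵥ ξ = e <;> simp [hq, h, sub_eq_zero]
  simp_rw [h]
  rw [← Finset.mul_sum, Finset.sum_comm]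
  have h' : ∀ s : F, ∑ w : ι → F, stdChar F (s * (w ⬝ᵥ ξ - e)) =
      if s = 0 then (Fintype.card F : ℂ) ^ Fintype.card ι else 0 := by
    intro s
    have h1 : ∀ w : ι → F, stdChar F (s * (w ⬝ᵥ ξ - e)) =
        stdChar F (-(s * e)) * stdChar F (w ⬝ᵥ (s • ξ)) := by
      intro w
      rw [← AddChar.map_add_eq_mul, dotProduct_smul, smul_eq_mul]
      congr 1
      ring
    simp_rw [h1]
    rw [← Finset.mul_sum, sum_stdChar_dotProduct]
    by_cases hs : s = 0 <;> simp [hs, hξ]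
  simp_rw [h']
  simp
  field_simp

/-- The vector `p` lies in the column space of `P`. -/
def InColSpace (P : Matrix ι σ F) (p : ι → F) : Prop := ∃ s, p = P *ᵥ s

/-- The vector `r` lies in the row space of `Q`. -/
def InRowSpace (Q : Matrix σ κ F) (r : κ → F) : Prop := ∃ t, r = t ᵥ* Q

/-- The vectors `p` and `r` have coordinates in the column space of `P` and in the row space of `Q`
whose product is `e`. -/
def HasPairing (P : Matrix ι σ F) (Q : Matrix σ κ F) (e : F) (p : ι → F) (r : κ → F) : Prop :=
  ∃ s t, p = P *ᵥ s ∧ r = t ᵥ* Q ∧ s ⬝ᵥ t = e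

variable {P : Matrix ι σ F} {Q : Matrix σ κ F}

theorem inColSpace_mulVec (s : σ → F) : InColSpace P (P *ᵥ s) := ⟨s, rfl⟩

theorem inRowSpace_vecMul (t : σ → F) : InRowSpace Q (t ᵥ* Q) := ⟨t, rfl⟩

theorem inColSpace_zero : InColSpace P 0 := ⟨0, by simp⟩

theorem inRowSpace_zero : InRowSpace Q 0 := ⟨0, by simp⟩

theorem HasPairing.inColSpace {e : F} {p : ι → F} {r : κ → F} (h : HasPairing P Q e p r) :
    InColSpace P p := by
  obtain ⟨s, t, h, -, -⟩ := h
  exact ⟨s, h⟩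

theorem HasPairing.inRowSpace {e : F} {p : ι → F} {r : κ → F} (h : HasPairing P Q e p r) :
    InRowSpace Q r := by
  obtain ⟨s, t, -, h, -⟩ := h
  exact ⟨t, h⟩

theorem mulVec_injective_of_ker (hP : ∀ p, P *ᵥ p = 0 → p = 0) :
    Function.Injective fun s => P *ᵥ s := fun s s' h =>
  sub_eq_zero.mp (hP _ (by rw [Matrix.mulVec_sub, sub_eq_zero]; exact h))

theorem vecMul_injective_of_ker (hQ : ∀ h, h ᵥ* Q = 0 → h = 0) :
    Function.Injective fun t => t ᵥ* Q := fun s s' h =>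
  sub_eq_zero.mp (hQ _ (by rw [Matrix.sub_vecMul, sub_eq_zero]; exact h))

theorem hasPairing_mulVec_vecMul (hP : ∀ p, P *ᵥ p = 0 → p = 0) (hQ : ∀ h, h ᵥ* Q = 0 → h = 0)
    {e : F} {s t : σ → F} : HasPairing P Q e (P *ᵥ s) (t ᵥ* Q) ↔ s ⬝ᵥ t = e := by
  constructor
  · rintro ⟨s', t', h1, h2, h3⟩
    rwa [mulVec_injective_of_ker hP h1, vecMul_injective_of_ker hQ h2]
  · intro h
    exact ⟨s, t, rfl, rfl, h⟩

theorem sum_inColSpace (hP : ∀ p, P *ᵥ p = 0 → p = 0) (G : (ι → F) → ℂ) :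
    ∑ p, (if InColSpace P p then G p else 0) = ∑ s : σ → F, G (P *ᵥ s) := by
  symm
  apply Fintype.sum_of_injective _ (mulVec_injective_of_ker hP)
  · intro p hp
    rw [if_neg]
    rintro ⟨s, rfl⟩
    exact hp ⟨s, rfl⟩
  · intro s
    rw [if_pos (inColSpace_mulVec s)]

theorem sum_inRowSpace (hQ : ∀ h, h ᵥ* Q = 0 → h = 0) (G : (κ → F) → ℂ) :
    ∑ r, (if InRowSpace Q r then G r else 0) = ∑ t : σ → F, G (t ᵥ* Q) := by
  symm
  apply Fintype.sum_of_injective _ (vecMul_injective_of_ker hQ)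
  · intro p hp
    rw [if_neg]
    rintro ⟨s, rfl⟩
    exact hp ⟨s, rfl⟩
  · intro s
    rw [if_pos (inRowSpace_vecMul s)]

theorem rank_sub_vecMulVec_add_one_iff (hP : ∀ p, P *ᵥ p = 0 → p = 0)
    (hQ : ∀ h, h ᵥ* Q = 0 → h = 0) (p : ι → F) (r : κ → F) :
    (P * Q - vecMulVec p r).rank + 1 = Fintype.card σ ↔ HasPairing P Q 1 p r := by
  by_cases hp : InColSpace P p
  · by_cases hr : InRowSpace Q r
    · obtain ⟨s, rfl⟩ := hp
      obtain ⟨t, rfl⟩ := hr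
      rw [hasPairing_mulVec_vecMul hP hQ]
      by_cases h : s ⬝ᵥ t = 1
      · simp [h, rank_sub_col_row_of_eq hP hQ s t h]
      · simp [h, rank_sub_col_row_of_ne hP hQ s t h]
    · obtain ⟨s, rfl⟩ := hp
      rw [rank_sub_col_not_row hP hQ s r fun t h => hr ⟨t, h⟩]
      simp only [Nat.add_eq_left, one_ne_zero, false_iff]
      exact fun h => hr h.inRowSpace
  · have h1 : ¬ HasPairing P Q 1 p r := fun h => hp h.inColSpace
    simp only [h1, iff_false]
    by_cases hr : InRowSpace Q r
    · obtain ⟨t, rfl⟩ := hr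
      rw [rank_sub_not_col_row hP hQ p t fun s h => hp ⟨s, h⟩]
      omega
    · rw [rank_sub_not_col_not_row hP hQ p r (fun s h => hp ⟨s, h⟩) fun t h => hr ⟨t, h⟩]
      omega

theorem rank_sub_vecMulVec_eq_add_one_iff (hP : ∀ p, P *ᵥ p = 0 → p = 0)
    (hQ : ∀ h, h ᵥ* Q = 0 → h = 0) (p : ι → F) (r : κ → F) :
    (P * Q - vecMulVec p r).rank = Fintype.card σ + 1 ↔ ¬ InColSpace P p ∧ ¬ InRowSpace Q r := by
  by_cases hp : InColSpace P p
  · simp only [hp, not_true_eq_false, false_and, iff_false]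
    obtain ⟨s, rfl⟩ := hp
    by_cases hr : InRowSpace Q r
    · obtain ⟨t, rfl⟩ := hr
      by_cases h : s ⬝ᵥ t = 1
      · have := rank_sub_col_row_of_eq hP hQ s t h
        omega
      · rw [rank_sub_col_row_of_ne hP hQ s t h]
        omega
    · rw [rank_sub_col_not_row hP hQ s r fun t h => hr ⟨t, h⟩]
      omega
  · by_cases hr : InRowSpace Q r
    · simp only [hr, not_true_eq_false, and_false, iff_false]
      obtain ⟨t, rfl⟩ := hr
      rw [rank_sub_not_col_row hP hQ p t fun s h => hp ⟨s, h⟩]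
      omega
    · rw [rank_sub_not_col_not_row hP hQ p r (fun s h => hp ⟨s, h⟩) fun t h => hr ⟨t, h⟩]
      simp [hp, hr]

theorem sum_hasPairing_right (hP : ∀ p, P *ᵥ p = 0 → p = 0) (hQ : ∀ h, h ᵥ* Q = 0 → h = 0)
    {s : σ → F} (hs : s ≠ 0) (e : F) :
    ∑ w : κ → F, (if HasPairing P Q e (P *ᵥ s) w then (1 : ℂ) else 0) =
      (Fintype.card F : ℂ) ^ Fintype.card σ / Fintype.card F := by
  have h : ∀ w : κ → F, (if HasPairing P Q e (P *ᵥ s) w then (1 : ℂ) else 0) =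
      if InRowSpace Q w then (if HasPairing P Q e (P *ᵥ s) w then (1 : ℂ) else 0) else 0 := by
    intro w
    split_ifs with h1 h2 <;> first | rfl | exact absurd h1.inRowSpace h2
  rw [Finset.sum_congr rfl fun w _ => h w, sum_inRowSpace hQ fun w => if HasPairing P Q e (P *ᵥ s) w then (1 : ℂ) else 0]
  simp_rw [hasPairing_mulVec_vecMul hP hQ, dotProduct_comm s]
  exact sum_ite_dotProduct_eq hs e

theorem sum_hasPairing_left (hP : ∀ p, P *ᵥ p = 0 → p = 0) (hQ : ∀ h, h ᵥ* Q = 0 → h = 0)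
    {t : σ → F} (ht : t ≠ 0) (e : F) :
    ∑ w : ι → F, (if HasPairing P Q e w (t ᵥ* Q) then (1 : ℂ) else 0) =
      (Fintype.card F : ℂ) ^ Fintype.card σ / Fintype.card F := by
  have h : ∀ w : ι → F, (if HasPairing P Q e w (t ᵥ* Q) then (1 : ℂ) else 0) =
      if InColSpace P w then (if HasPairing P Q e w (t ᵥ* Q) then (1 : ℂ) else 0) else 0 := by
    intro w
    split_ifs with h1 h2 <;> first | rfl | exact absurd h1.inColSpace h2
  rw [Finset.sum_congr rfl fun w _ => h w, sum_inColSpace hP fun w => if HasPairing P Q e w (t ᵥ* Q) then (1 : ℂ) else 0]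
  simp_rw [hasPairing_mulVec_vecMul hP hQ]
  exact sum_ite_dotProduct_eq ht e

theorem sum_not_inColSpace (hP : ∀ p, P *ᵥ p = 0 → p = 0) :
    ∑ w : ι → F, (if ¬ InColSpace P w then (1 : ℂ) else 0) =
      (Fintype.card F : ℂ) ^ Fintype.card ι - (Fintype.card F : ℂ) ^ Fintype.card σ := by
  have h : ∀ w : ι → F, (if ¬ InColSpace P w then (1 : ℂ) else 0) =
      1 - if InColSpace P w then 1 else 0 := fun w => by split_ifs <;> simp
  simp_rw [h]
  rw [Finset.sum_sub_distrib, sum_inColSpace hP fun _ => 1]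
  simp

theorem sum_not_inRowSpace (hQ : ∀ h, h ᵥ* Q = 0 → h = 0) :
    ∑ w : κ → F, (if ¬ InRowSpace Q w then (1 : ℂ) else 0) =
      (Fintype.card F : ℂ) ^ Fintype.card κ - (Fintype.card F : ℂ) ^ Fintype.card σ := by
  have h : ∀ w : κ → F, (if ¬ InRowSpace Q w then (1 : ℂ) else 0) =
      1 - if InRowSpace Q w then 1 else 0 := fun w => by split_ifs <;> simp
  simp_rw [h]
  rw [Finset.sum_sub_distrib, sum_inRowSpace hQ fun _ => 1]
  simp

/-- The number of neighbours of `c` of rank one whose distance from `y` is `j`. -/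
noncomputable def localCount (y : Matrix ι κ F) (j : ℕ) (c : Matrix ι κ F) : ℂ :=
  localSum (fun w => if (y - w).rank = j then 1 else 0) c

/-- This is `localSum_vecMulVec` applied to an indicator. Its value at 0 vanishes because
`Fintype.card σ ≥ 1` keeps the truncated difference `Fintype.card σ - 1` different from the rank of
P * Q. -/
theorem localCount_lower (hP : ∀ p, P *ᵥ p = 0 → p = 0) (hQ : ∀ h, h ᵥ* Q = 0 → h = 0)
    (hσ : 1 ≤ Fintype.card σ) {p : ι → F} {r : κ → F} (hp : p ≠ 0) (hr : r ≠ 0) :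
    localCount (P * Q) (Fintype.card σ - 1) (vecMulVec p r) =
      ∑ w, (if HasPairing P Q 1 p w then (1 : ℂ) else 0) +
      ∑ w, (if HasPairing P Q 1 w r then (1 : ℂ) else 0) -
      ∑ s : F, (if HasPairing P Q 1 (s • p) r then (1 : ℂ) else 0) -
      if HasPairing P Q 1 p r then 1 else 0 := by
  have h : ∀ (p : ι → F) (r : κ → F), (P * Q - vecMulVec p r).rank = Fintype.card σ - 1 ↔
      HasPairing P Q 1 p r := fun p r => by
    rw [← rank_sub_vecMulVec_add_one_iff hP hQ]
    omega
  have h0 : ¬ (P * Q).rank = Fintype.card σ - 1 := by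
    rw [Matrix.rank_mul_eq_card P Q hP hQ]
    omega
  rw [localCount, localSum_vecMulVec _ hp hr]
  simp only [← smul_vecMulVec, h, h0, if_false, sub_zero]

/-- The remaining case, where neither p nor r lies in its space, belongs to O₆; that part is
recognized by distance alone and needs no count. -/
theorem localCount_upper (hP : ∀ p, P *ᵥ p = 0 → p = 0) (hQ : ∀ h, h ᵥ* Q = 0 → h = 0)
    {p : ι → F} {r : κ → F} (hp : p ≠ 0) (hr : r ≠ 0) (h1 : InColSpace P p ∨ InRowSpace Q r) :
    localCount (P * Q) (Fintype.card σ + 1) (vecMulVec p r) =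
      (if InColSpace P p then 0 else
        (Fintype.card F : ℂ) ^ Fintype.card κ - (Fintype.card F : ℂ) ^ Fintype.card σ) +
      (if InRowSpace Q r then 0 else
        (Fintype.card F : ℂ) ^ Fintype.card ι - (Fintype.card F : ℂ) ^ Fintype.card σ) := by
  have h0 : ¬ (P * Q).rank = Fintype.card σ + 1 := by
    rw [Matrix.rank_mul_eq_card P Q hP hQ]
    omega
  have h2 : ∀ s : F, ¬ (¬ InColSpace P (s • p) ∧ ¬ InRowSpace Q r) := by
    rintro s ⟨h3, h4⟩
    obtain ⟨t, rfl⟩ := h1.resolve_right h4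
    exact h3 ⟨s • t, by rw [Matrix.mulVec_smul]⟩
  have h3 : ¬ (¬ InColSpace P p ∧ ¬ InRowSpace Q r) := by tauto
  have h4 := sum_not_inColSpace hP
  have h5 := sum_not_inRowSpace hQ
  rw [localCount, localSum_vecMulVec _ hp hr]
  simp only [← smul_vecMulVec, rank_sub_vecMulVec_eq_add_one_iff hP hQ, h0, if_false, sub_zero, h2,
    h3, Finset.sum_const_zero]
  by_cases hc : InColSpace P p <;> by_cases hw : InRowSpace Q r <;>
    simp only [hc, hw, not_true_eq_false, not_false_eq_true, false_and, and_false, true_and,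
      and_true, if_true, if_false, Finset.sum_const_zero, h4, h5]

end General

variable {D N : ℕ}

theorem ncard_eq_localCount (x y c : Matrix (Fin D) (Fin (N - D)) F) (j : ℕ) :
    ((distSet (bilinearFormsGraph F D N) 1 x ∩ distSet (bilinearFormsGraph F D N) 1 (x + c) ∩
      distSet (bilinearFormsGraph F D N) j y).ncard : ℂ) = localCount (y - x) j c := by
  have h : (distSet (bilinearFormsGraph F D N) 1 x ∩ distSet (bilinearFormsGraph F D N) 1 (x + c) ∩
      distSet (bilinearFormsGraph F D N) j y) =
      (((((rankOne F (Fin D) (Fin (N - D))).filter fun b => (c - b).rank = 1).filter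
        fun w => (y - x - w).rank = j).image fun w => x + w : Finset _) : Set _) := by
    ext w
    simp only [distSet, bilinearFormsGraph_dist, Set.mem_inter_iff, Set.mem_ofPred_eq,
      Finset.coe_image, Set.mem_image, Finset.mem_coe, Finset.mem_filter, mem_rankOne]
    constructor
    · rintro ⟨⟨h1, h2⟩, h3⟩
      refine ⟨w - x, ⟨⟨?_, ?_⟩, ?_⟩, by abel⟩
      · rwa [Matrix.rank_sub_rev]
      · rw [← h2]
        congr 1
        abel
      · rw [← h3]
        congr 1
        abel
    · rintro ⟨w, ⟨⟨h1, h2⟩, h3⟩, rfl⟩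
      refine ⟨⟨?_, ?_⟩, ?_⟩
      · rw [← h1, Matrix.rank_sub_rev]
        congr 1
        abel
      · rw [← h2]
        congr 1
        abel
      · rw [← h3]
        congr 1
        abel
  rw [h, Set.ncard_coe_finset, Finset.card_image_of_injective _ (add_right_injective x),
    localCount, localSum, Finset.sum_ite, Finset.sum_const_zero, add_zero, Finset.sum_const]
  simp

end LocalPartition

/-! ### The six parts in terms of p and r. -/

section PartMembership

open scoped Classical
open Matrix

variable {F : Type*} [Field F] [Fintype F] {D N : ℕ}

/-- Once the complex-valued counts are known to be the natural numbers `lo` and `up`, membership is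
a matter of arithmetic in ℕ. -/
theorem mem_yPart_iff_counts (x y c : Matrix (Fin D) (Fin (N - D)) F) (hc : c.rank = 1) (k lo up : ℕ)
    (hk : (y - x).rank = k) (hlo : localCount (y - x) (k - 1) c = lo)
    (hup : localCount (y - x) (k + 1) c = up) :
    (x + c ∈ yPart x y 0 ↔ (y - x - c).rank = k - 1) ∧
    (x + c ∈ yPart x y 1 ↔ (y - x - c).rank = k ∧
      lo = 2 * Fintype.card F ^ (k - 1) ∧ up = 0) ∧
    (x + c ∈ yPart x y 2 ↔ (y - x - c).rank = k ∧
      lo = 2 * Fintype.card F ^ (k - 1) - 1 ∧ up = 0) ∧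
    (x + c ∈ yPart x y 3 ↔ (y - x - c).rank = k ∧ lo = Fintype.card F ^ (k - 1) ∧
      up = Fintype.card F ^ D - Fintype.card F ^ k) ∧
    (x + c ∈ yPart x y 4 ↔ (y - x - c).rank = k ∧ lo = Fintype.card F ^ (k - 1) ∧
      up = Fintype.card F ^ (N - D) - Fintype.card F ^ k) ∧
    (x + c ∈ yPart x y 5 ↔ (y - x - c).rank = k + 1) := by
  have d : (bilinearFormsGraph F D N).dist x y = k := by
    rw [bilinearFormsGraph_dist, Matrix.rank_sub_rev, hk]
  have dx : (bilinearFormsGraph F D N).dist x (x + c) = 1 := by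
    rw [bilinearFormsGraph_dist, Matrix.rank_sub_rev, add_sub_cancel_left, hc]
  have dy : (bilinearFormsGraph F D N).dist y (x + c) = (y - x - c).rank := by
    rw [bilinearFormsGraph_dist, sub_sub]
  rw [← ncard_eq_localCount, Nat.cast_inj] at hlo hup
  have hx : x + c ∈ distSet (bilinearFormsGraph F D N) 1 x := dx
  have hy : ∀ j, x + c ∈ distSet (bilinearFormsGraph F D N) j y ↔ (y - x - c).rank = j :=
    fun j => by rw [← dy]; rfl
  refine ⟨?_, ?_, ?_, ?_, ?_, ?_⟩ <;>
    simp only [yPart, d, Matrix.cons_val, Set.mem_inter_iff, Set.mem_ofPred_eq, hx, hy, hlo, hup,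
      true_and]

variable {σ : Type*} [Fintype σ] [DecidableEq σ] {P : Matrix (Fin D) σ F}
  {Q : Matrix σ (Fin (N - D)) F} {x y : Matrix (Fin D) (Fin (N - D)) F}

/-- A nonzero coordinate vector has |F|^(k-1) partners with pairing 1, where k is the number of
columns of P. Hence each of p and r that lies in its space contributes |F|^(k-1) to the lower count,
and the subtracted overlaps tell pairing 0 from the other nonzero pairings. -/
theorem mem_yPart_iff (hxy : y - x = P * Q) (hP : ∀ p, P *ᵥ p = 0 → p = 0)
    (hQ : ∀ h, h ᵥ* Q = 0 → h = 0) (hσ : 1 ≤ Fintype.card σ) (hσD : Fintype.card σ < D)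
    (hN : 2 * D < N) {p : Fin D → F} {r : Fin (N - D) → F} (hp : p ≠ 0) (hr : r ≠ 0) :
    (x + vecMulVec p r ∈ yPart x y 0 ↔ HasPairing P Q 1 p r) ∧
    (x + vecMulVec p r ∈ yPart x y 1 ↔ HasPairing P Q 0 p r) ∧
    (x + vecMulVec p r ∈ yPart x y 2 ↔
      InColSpace P p ∧ InRowSpace Q r ∧ ¬ HasPairing P Q 0 p r ∧ ¬ HasPairing P Q 1 p r) ∧
    (x + vecMulVec p r ∈ yPart x y 3 ↔ InColSpace P p ∧ ¬ InRowSpace Q r) ∧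
    (x + vecMulVec p r ∈ yPart x y 4 ↔ ¬ InColSpace P p ∧ InRowSpace Q r) ∧
    (x + vecMulVec p r ∈ yPart x y 5 ↔ ¬ InColSpace P p ∧ ¬ InRowSpace Q r) := by
  have hq : 1 < Fintype.card F := Fintype.one_lt_card
  have hq0 := card_ne_zero_complex F
  have hrk : (y - x).rank = Fintype.card σ := by rw [hxy, Matrix.rank_mul_eq_card P Q hP hQ]
  have hc := Matrix.rank_vecMulVec_eq_one p r hp hr
  have hlow := localCount_lower hP hQ hσ hp hr
  have hpow : 1 ≤ Fintype.card F ^ (Fintype.card σ - 1) := Nat.one_le_pow _ _ (by omega)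
  -- The inequalities k < D < N - D make the upper counts for O₄ and O₅ nonzero and distinct.
  have hpk : Fintype.card F ^ Fintype.card σ < Fintype.card F ^ D := Nat.pow_lt_pow_right hq hσD
  have hpD : Fintype.card F ^ D < Fintype.card F ^ (N - D) := Nat.pow_lt_pow_right hq (by omega)
  have hdiv : (Fintype.card F : ℂ) ^ Fintype.card σ / Fintype.card F =
      (Fintype.card F : ℂ) ^ (Fintype.card σ - 1) := by
    obtain ⟨j, hj⟩ := Nat.exists_eq_add_of_le' hσ
    rw [hj, pow_succ, Nat.add_sub_cancel, mul_div_assoc, div_self hq0, mul_one]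
  by_cases hpc : InColSpace P p
  · by_cases hrc : InRowSpace Q r
    · have hup := localCount_upper hP hQ hp hr (.inl hpc)
      simp only [hpc, hrc, if_true, add_zero] at hup
      obtain ⟨s, rfl⟩ := hpc
      obtain ⟨t, rfl⟩ := hrc
      have hs : s ≠ 0 := fun h => hp (by simp [h])
      have ht : t ≠ 0 := fun h => hr (by simp [h])
      simp only [sum_hasPairing_right hP hQ hs, sum_hasPairing_left hP hQ ht, hdiv,
        ← Matrix.mulVec_smul, hasPairing_mulVec_vecMul hP hQ, smul_dotProduct, smul_eq_mul] at hlow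
      -- If the pairing is nonzero, exactly one multiple of s has pairing 1 with t.
      have h1 : ∑ e : F, (if e * (s ⬝ᵥ t) = 1 then (1 : ℂ) else 0) =
          if s ⬝ᵥ t = 0 then 0 else 1 := by
        split_ifs with h
        · simp [h]
        · simp_rw [← eq_div_iff h]
          simp
      rw [h1] at hlow
      simp only [hasPairing_mulVec_vecMul hP hQ, inColSpace_mulVec, inRowSpace_vecMul, true_and,
        not_true_eq_false, false_and, and_false]
      by_cases e1 : s ⬝ᵥ t = 1
      · have hr1 := rank_sub_col_row_of_eq hP hQ s t e1
        obtain ⟨m0, m1, m2, m3, m4, m5⟩ := mem_yPart_iff_counts x y _ hc (Fintype.card σ)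
          -- Both overlap terms equal 1 here, which accounts for the 2. The rank k - 1 alone already
          -- decides membership.
          (2 * Fintype.card F ^ (Fintype.card σ - 1) - 2) 0 hrk
          (by
            rw [hxy, hlow, e1, if_neg one_ne_zero, if_pos rfl, Nat.cast_sub (by omega)]
            push_cast
            ring) (by rw [hxy, hup]; simp)
        rw [m0, m1, m2, m3, m4, m5, hxy, e1]
        simp only [one_ne_zero, not_true_eq_false, and_false, iff_false, iff_true]
        refine ⟨?_, ?_, ?_, ?_, ?_, ?_⟩ <;> omega
      · have hr1 := rank_sub_col_row_of_ne hP hQ s t e1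
        by_cases e0 : s ⬝ᵥ t = 0
        · obtain ⟨m0, m1, m2, m3, m4, m5⟩ := mem_yPart_iff_counts x y _ hc (Fintype.card σ)
            (2 * Fintype.card F ^ (Fintype.card σ - 1)) 0 hrk
            (by
              rw [hxy, hlow, e0, if_pos rfl, if_neg zero_ne_one]
              push_cast
              ring) (by rw [hxy, hup]; simp)
          rw [m0, m1, m2, m3, m4, m5, hxy, e0, hr1]
          simp only [zero_ne_one, not_true_eq_false, false_and, iff_false, iff_true]
          refine ⟨?_, ?_, ?_, ?_, ?_, ?_⟩ <;> first | omega | simp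
        · obtain ⟨m0, m1, m2, m3, m4, m5⟩ := mem_yPart_iff_counts x y _ hc (Fintype.card σ)
            (2 * Fintype.card F ^ (Fintype.card σ - 1) - 1) 0 hrk
            (by
              rw [hxy, hlow, if_neg e0, if_neg e1, Nat.cast_sub (by omega)]
              push_cast
              ring) (by rw [hxy, hup]; simp)
          rw [m0, m1, m2, m3, m4, m5, hxy, hr1]
          simp only [e0, e1, not_false_eq_true, and_self, iff_false]
          refine ⟨?_, ?_, ?_, ?_, ?_, ?_⟩ <;> first | omega | simp
    · have hup := localCount_upper hP hQ hp hr (.inl hpc)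
      simp only [hpc, hrc, if_true, if_false, zero_add] at hup
      have hn : ∀ (e : F) (w : Fin D → F), ¬ HasPairing P Q e w r := fun e w h =>
        hrc h.inRowSpace
      obtain ⟨s, rfl⟩ := hpc
      have hs : s ≠ 0 := fun h => hp (by simp [h])
      simp only [sum_hasPairing_right hP hQ hs, hn, if_false, Finset.sum_const_zero, hdiv, sub_zero,
        add_zero] at hlow
      have hr1 := rank_sub_col_not_row hP hQ s r fun t h => hrc ⟨t, h⟩
      obtain ⟨m0, m1, m2, m3, m4, m5⟩ := mem_yPart_iff_counts x y _ hc (Fintype.card σ)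
        (Fintype.card F ^ (Fintype.card σ - 1)) (Fintype.card F ^ D - Fintype.card F ^ Fintype.card σ)
        hrk (by rw [hxy, hlow]; push_cast; rfl) (by
          rw [hxy, hup, Nat.cast_sub hpk.le, Fintype.card_fin]; push_cast; rfl)
      rw [m0, m1, m2, m3, m4, m5, hxy, hr1]
      simp only [hn, hrc, inColSpace_mulVec, not_true_eq_false, not_false_eq_true, false_and,
        and_false, and_self, iff_false]
      refine ⟨?_, ?_, ?_, ?_, ?_, ?_⟩ <;> first | omega | simp
  · have hn : ∀ (e : F) (w : Fin (N - D) → F), ¬ HasPairing P Q e p w := fun e w h =>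
      hpc h.inColSpace
    by_cases hrc : InRowSpace Q r
    · have hup := localCount_upper hP hQ hp hr (.inr hrc)
      simp only [hpc, hrc, if_true, if_false, add_zero] at hup
      obtain ⟨t, rfl⟩ := hrc
      have ht : t ≠ 0 := fun h => hr (by simp [h])
      have hns : ∀ s : F, ¬ HasPairing P Q 1 (s • p) (t ᵥ* Q) := by
        intro s h
        by_cases hs : s = 0
        · obtain ⟨s', t', h1, -, h2⟩ := h
          rw [hs, zero_smul] at h1
          simp [hP _ h1.symm] at h2
        · obtain ⟨s', h1⟩ := h.inColSpace
          exact hpc ⟨s⁻¹ • s', by rw [Matrix.mulVec_smul, ← h1, smul_smul, inv_mul_cancel₀ hs,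
            one_smul]⟩
      simp only [sum_hasPairing_left hP hQ ht, hn, hns, if_false, Finset.sum_const_zero, hdiv,
        sub_zero, zero_add] at hlow
      have hr1 := rank_sub_not_col_row hP hQ p t fun s h => hpc ⟨s, h⟩
      obtain ⟨m0, m1, m2, m3, m4, m5⟩ := mem_yPart_iff_counts x y _ hc (Fintype.card σ)
        (Fintype.card F ^ (Fintype.card σ - 1))
        (Fintype.card F ^ (N - D) - Fintype.card F ^ Fintype.card σ)
        hrk (by rw [hxy, hlow]; push_cast; rfl) (by
          rw [hxy, hup, Nat.cast_sub (by omega), Fintype.card_fin]; push_cast; rfl)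
      rw [m0, m1, m2, m3, m4, m5, hxy, hr1]
      simp only [hn, hpc, inRowSpace_vecMul, not_true_eq_false, not_false_eq_true, false_and,
        and_false, and_self, iff_false]
      refine ⟨?_, ?_, ?_, ?_, ?_, ?_⟩ <;> first | omega | simp
    · have hr1 := rank_sub_not_col_not_row hP hQ p r (fun s h => hpc ⟨s, h⟩) fun t h => hrc ⟨t, h⟩
      -- The counts stay unevaluated, since rank k + 1 alone decides.
      obtain ⟨m0, m1, m2, m3, m4, m5⟩ := mem_yPart_iff_counts x y _ hc (Fintype.card σ) _ _ hrk
        (ncard_eq_localCount x y _ _).symm (ncard_eq_localCount x y _ _).symm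
      rw [m0, m1, m2, m3, m4, m5, hxy, hr1]
      simp only [hn, hpc, hrc, not_false_eq_true, false_and, and_false, and_self, iff_false]
      refine ⟨?_, ?_, ?_, ?_, ?_, ?_⟩ <;> first | omega | simp

theorem sub_rank_of_mem_yPart {i : Fin 6} {w : Matrix (Fin D) (Fin (N - D)) F}
    (hw : w ∈ yPart x y i) : (w - x).rank = 1 := by
  have h : w ∈ distSet (bilinearFormsGraph F D N) 1 x := by
    fin_cases i
    · exact hw.1
    · exact hw.1.1
    · exact hw.1.1
    · exact hw.1.1
    · exact hw.1.1
    · exact hw.1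
  have h' : (bilinearFormsGraph F D N).dist x w = 1 := h
  rwa [bilinearFormsGraph_dist, Matrix.rank_sub_rev] at h'

theorem sum_yPart_eq (i : Fin 6) (G : Matrix (Fin D) (Fin (N - D)) F → ℂ) :
    ((Fintype.card F : ℂ) - 1) * ∑ w, (if w ∈ yPart x y i then G (w - x) else 0) =
      ∑ p ∈ Finset.univ.erase (0 : Fin D → F), ∑ r ∈ Finset.univ.erase (0 : Fin (N - D) → F),
        if x + vecMulVec p r ∈ yPart x y i then G (vecMulVec p r) else 0 := by
  rw [← sum_rankOne_mul_pred fun c => if x + c ∈ yPart x y i then G c else 0]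
  congr 1
  have h := Equiv.sum_comp (Equiv.addLeft x)
    fun w => if w ∈ yPart x y i then G (w - x) else (0 : ℂ)
  simp only [Equiv.coe_addLeft, add_sub_cancel_left] at h
  rw [← h]
  symm
  apply Finset.sum_subset (Finset.subset_univ _)
  intro c _ hc
  rw [if_neg]
  intro h
  have := sub_rank_of_mem_yPart h
  rw [add_sub_cancel_left] at this
  exact hc (mem_rankOne.mpr this)

end PartMembership

/-! ### Sums over the parts as sums over vectors. -/

section PartSums

open scoped Classical
open Matrix

variable {F : Type*} [Field F] [Fintype F] {D N : ℕ} {σ : Type*} [Fintype σ] [DecidableEq σ]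
  {P : Matrix (Fin D) σ F} {Q : Matrix σ (Fin (N - D)) F} {x y : Matrix (Fin D) (Fin (N - D)) F}

/-- The sum of `G (w - x)` over the part `yPart x y i`, times `|F| - 1`. -/
noncomputable def partSum (x y : Matrix (Fin D) (Fin (N - D)) F)
    (G : Matrix (Fin D) (Fin (N - D)) F → ℂ) (i : Fin 6) : ℂ :=
  ((Fintype.card F : ℂ) - 1) * ∑ w, (if w ∈ yPart x y i then G (w - x) else 0)

theorem sum_erase_sum_erase {V W : Type*} [Fintype V] [Fintype W] [DecidableEq V] [DecidableEq W]
    [Zero V] [Zero W] (H : V → W → ℂ) :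
    ∑ p ∈ Finset.univ.erase (0 : V), ∑ r ∈ Finset.univ.erase (0 : W), H p r =
      ∑ p, ∑ r, H p r - ∑ r, H 0 r - ∑ p, H p 0 + H 0 0 := by
  rw [sum_erase_zero]
  simp_rw [sum_erase_zero]
  rw [Finset.sum_sub_distrib]
  ring

/-- Unions of parts are easier than the parts: O₁ ∪ O₂ ∪ O₃ is column space times row space, and
adding O₄, O₅ or everything frees r, p or both. The multiples of G 0 remove the pairs with a zero
vector. -/
theorem partSum_formulas (hxy : y - x = P * Q) (hP : ∀ p, P *ᵥ p = 0 → p = 0)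
    (hQ : ∀ h, h ᵥ* Q = 0 → h = 0) (hσ : 1 ≤ Fintype.card σ) (hσD : Fintype.card σ < D)
    (hN : 2 * D < N) (G : Matrix (Fin D) (Fin (N - D)) F → ℂ) :
    partSum x y G 0 =
      ∑ s : σ → F, ∑ t, (if s ⬝ᵥ t = 1 then G (vecMulVec (P *ᵥ s) (t ᵥ* Q)) else 0) ∧
    partSum x y G 1 =
      ∑ s : σ → F, ∑ t, (if s ⬝ᵥ t = 0 then G (vecMulVec (P *ᵥ s) (t ᵥ* Q)) else 0) -
        (2 * (Fintype.card F : ℂ) ^ Fintype.card σ - 1) * G 0 ∧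
    partSum x y G 0 + partSum x y G 1 + partSum x y G 2 =
      ∑ s : σ → F, ∑ t, G (vecMulVec (P *ᵥ s) (t ᵥ* Q)) -
        (2 * (Fintype.card F : ℂ) ^ Fintype.card σ - 1) * G 0 ∧
    partSum x y G 0 + partSum x y G 1 + partSum x y G 2 + partSum x y G 3 =
      ∑ s : σ → F, ∑ r, G (vecMulVec (P *ᵥ s) r) -
        ((Fintype.card F : ℂ) ^ Fintype.card σ + (Fintype.card F : ℂ) ^ (N - D) - 1) * G 0 ∧
    partSum x y G 0 + partSum x y G 1 + partSum x y G 2 + partSum x y G 4 =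
      ∑ t, ∑ p, G (vecMulVec p (t ᵥ* Q)) -
        ((Fintype.card F : ℂ) ^ Fintype.card σ + (Fintype.card F : ℂ) ^ D - 1) * G 0 ∧
    partSum x y G 0 + partSum x y G 1 + partSum x y G 2 + partSum x y G 3 + partSum x y G 4 +
      partSum x y G 5 = ∑ p, ∑ r, G (vecMulVec p r) -
        ((Fintype.card F : ℂ) ^ D + (Fintype.card F : ℂ) ^ (N - D) - 1) * G 0 := by
  have hz1 : ∀ r : Fin (N - D) → F, vecMulVec (0 : Fin D → F) r = 0 := fun r => zero_vecMulVec r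
  have hz2 : ∀ p : Fin D → F, vecMulVec p (0 : Fin (N - D) → F) = 0 := fun p => by
    ext; simp [vecMulVec_apply]
  have hmem := fun (p : Fin D → F) (hp : p ≠ 0) (r : Fin (N - D) → F) (hr : r ≠ 0) =>
    mem_yPart_iff (P := P) (Q := Q) hxy hP hQ hσ hσD hN hp hr
  have hpair : ∀ e : F, ∑ p : Fin D → F, ∑ r : Fin (N - D) → F,
      (if HasPairing P Q e p r then G (vecMulVec p r) else 0) =
      ∑ s : σ → F, ∑ t, (if s ⬝ᵥ t = e then G (vecMulVec (P *ᵥ s) (t ᵥ* Q)) else 0) := by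
    intro e
    have h1 : ∀ p : Fin D → F, ∑ r : Fin (N - D) → F,
        (if HasPairing P Q e p r then G (vecMulVec p r) else 0) =
        if InColSpace P p then ∑ r : Fin (N - D) → F,
          (if HasPairing P Q e p r then G (vecMulVec p r) else 0) else 0 := by
      intro p
      split_ifs with h
      · rfl
      · exact Finset.sum_eq_zero fun r _ => if_neg fun h' => h h'.inColSpace
    have h2 : ∀ (p : Fin D → F) (r : Fin (N - D) → F),
        (if HasPairing P Q e p r then G (vecMulVec p r) else 0) =
        if InRowSpace Q r then (if HasPairing P Q e p r then G (vecMulVec p r) else 0) else 0 := by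
      intro p r
      split_ifs with h h' <;> first | rfl | exact absurd h.inRowSpace h'
    rw [Finset.sum_congr rfl fun p _ => h1 p, sum_inColSpace hP fun p => ∑ r : Fin (N - D) → F,
      (if HasPairing P Q e p r then G (vecMulVec p r) else 0)]
    refine Finset.sum_congr rfl fun s _ => ?_
    rw [Finset.sum_congr rfl fun r _ => h2 _ r, sum_inRowSpace hQ fun r =>
      if HasPairing P Q e (P *ᵥ s) r then G (vecMulVec (P *ᵥ s) r) else 0]
    simp_rw [hasPairing_mulVec_vecMul hP hQ]
  have hcol : ∀ H : (Fin D → F) → (Fin (N - D) → F) → ℂ,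
      ∑ p, ∑ r, (if InColSpace P p then H p r else 0) = ∑ s : σ → F, ∑ r, H (P *ᵥ s) r := by
    intro H
    rw [← sum_inColSpace hP fun p => ∑ r, H p r]
    refine Finset.sum_congr rfl fun p _ => ?_
    split_ifs
    · rfl
    · simp
  have hrow : ∀ (H : (Fin (N - D) → F) → ℂ),
      ∑ r, (if InRowSpace Q r then H r else 0) = ∑ t : σ → F, H (t ᵥ* Q) := sum_inRowSpace hQ
  have h0l : ∀ (e : F) (r : Fin (N - D) → F), HasPairing P Q e 0 r ↔ e = 0 ∧ InRowSpace Q r := by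
    intro e r
    constructor
    · intro h
      refine ⟨?_, h.inRowSpace⟩
      obtain ⟨s, t, h1, -, h2⟩ := h
      rw [hP s h1.symm, zero_dotProduct] at h2
      exact h2.symm
    · rintro ⟨rfl, t, h⟩
      exact ⟨0, t, by simp, h, by simp⟩
  have h0r : ∀ (e : F) (p : Fin D → F), HasPairing P Q e p 0 ↔ e = 0 ∧ InColSpace P p := by
    intro e r
    constructor
    · intro h
      refine ⟨?_, h.inColSpace⟩
      obtain ⟨s, t, -, h1, h2⟩ := h
      rw [hQ t h1.symm, dotProduct_zero] at h2
      exact h2.symm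
    · rintro ⟨rfl, s, h⟩
      exact ⟨s, 0, h, by simp, by simp⟩
  have hc1 : ∑ p : Fin D → F, (if InColSpace P p then G 0 else 0) =
      (Fintype.card F : ℂ) ^ Fintype.card σ * G 0 := by
    rw [sum_inColSpace hP fun _ => G 0]; simp
  have hr1 : ∑ r : Fin (N - D) → F, (if InRowSpace Q r then G 0 else 0) =
      (Fintype.card F : ℂ) ^ Fintype.card σ * G 0 := by
    rw [sum_inRowSpace hQ fun _ => G 0]; simp
  refine ⟨?_, ?_, ?_, ?_, ?_, ?_⟩
  · rw [partSum, sum_yPart_eq, ← hpair, Finset.sum_congr rfl fun p hp => Finset.sum_congr rfl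
      fun r hr => by rw [(hmem p (Finset.ne_of_mem_erase hp) r (Finset.ne_of_mem_erase hr)).1],
      sum_erase_sum_erase]
    simp [h0l, h0r]
  · rw [partSum, sum_yPart_eq, ← hpair, Finset.sum_congr rfl fun p hp => Finset.sum_congr rfl
      fun r hr => by rw [(hmem p (Finset.ne_of_mem_erase hp) r (Finset.ne_of_mem_erase hr)).2.1],
      sum_erase_sum_erase]
    simp only [h0l, h0r, true_and, hz1, hz2, hc1, hr1, inRowSpace_zero, if_true]
    ring
  · have e : partSum x y G 0 + partSum x y G 1 + partSum x y G 2 =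
        ∑ p ∈ Finset.univ.erase (0 : Fin D → F), ∑ r ∈ Finset.univ.erase (0 : Fin (N - D) → F),
          if InColSpace P p then (if InRowSpace Q r then G (vecMulVec p r) else 0) else 0 := by
      simp only [partSum, sum_yPart_eq, ← Finset.sum_add_distrib]
      refine Finset.sum_congr rfl fun p hp => Finset.sum_congr rfl fun r hr => ?_
      obtain ⟨m0, m1, m2, m3, m4, m5⟩ :=
        hmem p (Finset.ne_of_mem_erase hp) r (Finset.ne_of_mem_erase hr)
      simp only [m0, m1, m2]
      by_cases hpc : InColSpace P p
      · by_cases hrc : InRowSpace Q r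
        · obtain ⟨s, rfl⟩ := hpc
          obtain ⟨t, rfl⟩ := hrc
          simp only [hasPairing_mulVec_vecMul hP hQ, inColSpace_mulVec, inRowSpace_vecMul]
          by_cases e1 : s ⬝ᵥ t = 1
          · simp [e1]
          · by_cases e0 : s ⬝ᵥ t = 0 <;> simp [e0, e1]
        · have hn : ∀ e, ¬ HasPairing P Q e p r := fun e h => hrc h.inRowSpace
          simp [hn, hrc]
      · have hn : ∀ e, ¬ HasPairing P Q e p r := fun e h => hpc h.inColSpace
        simp [hn, hpc]
    rw [e, sum_erase_sum_erase, hcol]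
    simp only [hrow, inColSpace_zero, inRowSpace_zero, if_true, hz1, hz2, hc1, Finset.sum_const,
      Finset.card_univ, Fintype.card_fun, nsmul_eq_mul, Nat.cast_pow]
    ring
  · have e : partSum x y G 0 + partSum x y G 1 + partSum x y G 2 + partSum x y G 3 =
        ∑ p ∈ Finset.univ.erase (0 : Fin D → F), ∑ r ∈ Finset.univ.erase (0 : Fin (N - D) → F),
          if InColSpace P p then G (vecMulVec p r) else 0 := by
      simp only [partSum, sum_yPart_eq, ← Finset.sum_add_distrib]
      refine Finset.sum_congr rfl fun p hp => Finset.sum_congr rfl fun r hr => ?_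
      obtain ⟨m0, m1, m2, m3, m4, m5⟩ :=
        hmem p (Finset.ne_of_mem_erase hp) r (Finset.ne_of_mem_erase hr)
      simp only [m0, m1, m2, m3]
      by_cases hpc : InColSpace P p
      · by_cases hrc : InRowSpace Q r
        · obtain ⟨s, rfl⟩ := hpc
          obtain ⟨t, rfl⟩ := hrc
          simp only [hasPairing_mulVec_vecMul hP hQ, inColSpace_mulVec, inRowSpace_vecMul]
          by_cases e1 : s ⬝ᵥ t = 1
          · simp [e1]
          · by_cases e0 : s ⬝ᵥ t = 0 <;> simp [e0, e1]
        · have hn : ∀ e, ¬ HasPairing P Q e p r := fun e h => hrc h.inRowSpace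
          simp [hn, hrc, hpc]
      · have hn : ∀ e, ¬ HasPairing P Q e p r := fun e h => hpc h.inColSpace
        simp [hn, hpc]
    rw [e, sum_erase_sum_erase, hcol]
    simp only [inColSpace_zero, if_true, hz1, hz2, hc1, Finset.sum_const,
      Finset.card_univ, Fintype.card_fun, nsmul_eq_mul, Nat.cast_pow, Fintype.card_fin]
    ring
  · have e : partSum x y G 0 + partSum x y G 1 + partSum x y G 2 + partSum x y G 4 =
        ∑ p ∈ Finset.univ.erase (0 : Fin D → F), ∑ r ∈ Finset.univ.erase (0 : Fin (N - D) → F),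
          if InRowSpace Q r then G (vecMulVec p r) else 0 := by
      simp only [partSum, sum_yPart_eq, ← Finset.sum_add_distrib]
      refine Finset.sum_congr rfl fun p hp => Finset.sum_congr rfl fun r hr => ?_
      obtain ⟨m0, m1, m2, m3, m4, m5⟩ :=
        hmem p (Finset.ne_of_mem_erase hp) r (Finset.ne_of_mem_erase hr)
      simp only [m0, m1, m2, m4]
      by_cases hrc : InRowSpace Q r
      · by_cases hpc : InColSpace P p
        · obtain ⟨s, rfl⟩ := hpc
          obtain ⟨t, rfl⟩ := hrc
          simp only [hasPairing_mulVec_vecMul hP hQ, inColSpace_mulVec, inRowSpace_vecMul]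
          by_cases e1 : s ⬝ᵥ t = 1
          · simp [e1]
          · by_cases e0 : s ⬝ᵥ t = 0 <;> simp [e0, e1]
        · have hn : ∀ e, ¬ HasPairing P Q e p r := fun e h => hpc h.inColSpace
          simp [hn, hrc, hpc]
      · have hn : ∀ e, ¬ HasPairing P Q e p r := fun e h => hrc h.inRowSpace
        simp [hn, hrc]
    rw [e, sum_erase_sum_erase]
    simp only [hrow, inRowSpace_zero, if_true, hz1, hz2, Finset.sum_const,
      Finset.card_univ, Fintype.card_fun, nsmul_eq_mul, Nat.cast_pow, Fintype.card_fin]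
    rw [Finset.sum_comm]
    ring
  · have e : partSum x y G 0 + partSum x y G 1 + partSum x y G 2 + partSum x y G 3 +
        partSum x y G 4 + partSum x y G 5 =
        ∑ p ∈ Finset.univ.erase (0 : Fin D → F), ∑ r ∈ Finset.univ.erase (0 : Fin (N - D) → F),
          G (vecMulVec p r) := by
      simp only [partSum, sum_yPart_eq, ← Finset.sum_add_distrib]
      refine Finset.sum_congr rfl fun p hp => Finset.sum_congr rfl fun r hr => ?_
      obtain ⟨m0, m1, m2, m3, m4, m5⟩ :=
        hmem p (Finset.ne_of_mem_erase hp) r (Finset.ne_of_mem_erase hr)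
      simp only [m0, m1, m2, m3, m4, m5]
      by_cases hrc : InRowSpace Q r
      · by_cases hpc : InColSpace P p
        · obtain ⟨s, rfl⟩ := hpc
          obtain ⟨t, rfl⟩ := hrc
          simp only [hasPairing_mulVec_vecMul hP hQ, inColSpace_mulVec, inRowSpace_vecMul]
          by_cases e1 : s ⬝ᵥ t = 1
          · simp [e1]
          · by_cases e0 : s ⬝ᵥ t = 0 <;> simp [e0, e1]
        · have hn : ∀ e, ¬ HasPairing P Q e p r := fun e h => hpc h.inColSpace
          simp [hn, hrc, hpc]
      · have hn : ∀ e, ¬ HasPairing P Q e p r := fun e h => hrc h.inRowSpace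
        by_cases hpc : InColSpace P p <;> simp [hn, hrc, hpc]
    rw [e, sum_erase_sum_erase]
    simp only [hz1, hz2, Finset.sum_const,
      Finset.card_univ, Fintype.card_fun, nsmul_eq_mul, Nat.cast_pow, Fintype.card_fin]
    ring

theorem sum_sum_stdChar_mul {α β : Type*} [Fintype α] [Fintype β] [DecidableEq α] [DecidableEq β]
    (ρ : α → F) (ξ : β → F) :
    ∑ s : α → F, ∑ t : β → F, stdChar F ((ρ ⬝ᵥ s) * (t ⬝ᵥ ξ)) =
      (Fintype.card F : ℂ) ^ Fintype.card β * ((Fintype.card F : ℂ) ^ Fintype.card α /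
        Fintype.card F) * (1 + ((Fintype.card F : ℂ) - 1) *
        ((if ρ = 0 then 1 else 0) + (if ξ = 0 then 1 else 0) -
          (if ρ = 0 then 1 else 0) * (if ξ = 0 then 1 else 0))) := by
  have hq := card_ne_zero_complex F
  have h : ∀ s : α → F, ∑ t : β → F, stdChar F ((ρ ⬝ᵥ s) * (t ⬝ᵥ ξ)) =
      (Fintype.card F : ℂ) ^ Fintype.card β * if s ⬝ᵥ ρ = 0 ∨ ξ = 0 then 1 else 0 := by
    intro s
    have := sum_stdChar_dotProduct ((ρ ⬝ᵥ s) • ξ)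
    simp only [dotProduct_smul, smul_eq_mul, smul_eq_zero] at this
    rw [this, dotProduct_comm]
    simp
  simp_rw [h]
  rw [← Finset.mul_sum, mul_assoc]
  congr 1
  by_cases hξ : ξ = 0
  · by_cases hρ : ρ = 0
    · simp [hξ, hρ]
    · simp [hξ, hρ]
  · simp only [hξ, or_false, sum_ite_dotProduct_eq_zero]
    simp

/-- The condition s ⬝ᵥ t = e is detected by averaging characters of c(s ⬝ᵥ t - e) over c. Summing
over t then forces (ρ ⬝ᵥ s)ξ + cs = 0. -/
theorem sum_sum_stdChar_pairing (ρ ξ : σ → F) (e : F) :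
    ∑ s : σ → F, ∑ t : σ → F, (if s ⬝ᵥ t = e then stdChar F ((ρ ⬝ᵥ s) * (t ⬝ᵥ ξ)) else 0) =
      (Fintype.card F : ℂ)⁻¹ * (∑ s : σ → F, ∑ t : σ → F, stdChar F ((ρ ⬝ᵥ s) * (t ⬝ᵥ ξ)) +
        (Fintype.card F : ℂ) ^ Fintype.card σ *
          ((Fintype.card F : ℂ) * (if e = 0 then 1 else 0) - 1) +
        (Fintype.card F : ℂ) ^ Fintype.card σ * ((Fintype.card F : ℂ) - 1) *
          (stdChar F ((ρ ⬝ᵥ ξ) * e) - if ρ ⬝ᵥ ξ = 0 then 1 else 0)) := by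
  have hq := card_ne_zero_complex F
  have h : ∀ s t : σ → F, (if s ⬝ᵥ t = e then stdChar F ((ρ ⬝ᵥ s) * (t ⬝ᵥ ξ)) else 0) =
      (Fintype.card F : ℂ)⁻¹ * ∑ c : F, stdChar F (-(c * e)) *
        stdChar F (t ⬝ᵥ ((ρ ⬝ᵥ s) • ξ + c • s)) := by
    intro s t
    have h1 : ∀ c : F, stdChar F (-(c * e)) * stdChar F (t ⬝ᵥ ((ρ ⬝ᵥ s) • ξ + c • s)) =
        stdChar F ((ρ ⬝ᵥ s) * (t ⬝ᵥ ξ)) * stdChar F (c * (s ⬝ᵥ t - e)) := by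
      intro c
      rw [← AddChar.map_add_eq_mul, ← AddChar.map_add_eq_mul, dotProduct_add, dotProduct_smul,
        dotProduct_smul, dotProduct_comm s t]
      congr 1
      simp only [smul_eq_mul]
      ring
    simp_rw [h1]
    rw [← Finset.mul_sum, sum_stdChar_mul]
    by_cases h2 : s ⬝ᵥ t = e
    · simp [h2]
      field_simp
    · simp [h2, sub_eq_zero]
  simp_rw [h]
  simp_rw [← Finset.mul_sum]
  congr 1
  have h2 : ∀ s : σ → F, ∑ t : σ → F, ∑ c : F, stdChar F (-(c * e)) *
      stdChar F (t ⬝ᵥ ((ρ ⬝ᵥ s) • ξ + c • s)) = ∑ c : F, stdChar F (-(c * e)) *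
      if (ρ ⬝ᵥ s) • ξ + c • s = 0 then (Fintype.card F : ℂ) ^ Fintype.card σ else 0 := by
    intro s
    rw [Finset.sum_comm]
    simp_rw [← Finset.mul_sum, sum_stdChar_dotProduct]
  simp_rw [h2]
  rw [Finset.sum_comm, ← Finset.add_sum_erase _ _ (Finset.mem_univ (0 : F))]
  -- For c ≠ 0 the linear condition on s has only the zero solution, except for c = -(ρ ⬝ᵥ ξ), when
  -- the solutions form the line through ξ.
  have h3 : ∀ c ∈ Finset.univ.erase (0 : F), ∑ s : σ → F, stdChar F (-(c * e)) *
      (if (ρ ⬝ᵥ s) • ξ + c • s = 0 then (Fintype.card F : ℂ) ^ Fintype.card σ else 0) =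
      (Fintype.card F : ℂ) ^ Fintype.card σ * (stdChar F (-(c * e)) +
      ((Fintype.card F : ℂ) - 1) *
        (if c = -(ρ ⬝ᵥ ξ) then stdChar F ((ρ ⬝ᵥ ξ) * e) else 0)) := by
    intro c hc
    have hc0 := Finset.ne_of_mem_erase hc
    rw [← Finset.mul_sum, ← Finset.sum_filter, Finset.sum_const, nsmul_eq_mul]
    by_cases hct : c = -(ρ ⬝ᵥ ξ)
    · have hξ : ξ ≠ 0 := by
        rintro rfl
        simp at hct
        exact hc0 hct
      have : (Finset.univ.filter fun s : σ → F => (ρ ⬝ᵥ s) • ξ + c • s = 0) =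
          Finset.univ.image fun l : F => l • ξ := by
        ext s
        simp only [Finset.mem_filter, Finset.mem_univ, true_and, Finset.mem_image]
        constructor
        · intro h
          refine ⟨-c⁻¹ * (ρ ⬝ᵥ s), ?_⟩
          rw [mul_smul, eq_neg_of_add_eq_zero_left h, smul_neg, neg_smul, neg_neg, smul_smul,
            inv_mul_cancel₀ hc0, one_smul]
        · rintro ⟨l, rfl⟩
          rw [hct, dotProduct_smul, smul_smul, ← add_smul, smul_eq_mul]
          have : l * (ρ ⬝ᵥ ξ) + -(ρ ⬝ᵥ ξ) * l = 0 := by ring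
          rw [this, zero_smul]
      rw [this, Finset.card_image_of_injective _ (smul_left_injective F hξ), Finset.card_univ,
        if_pos hct]
      have : -(c * e) = (ρ ⬝ᵥ ξ) * e := by rw [hct]; ring
      rw [this]
      ring
    · have : (Finset.univ.filter fun s : σ → F => (ρ ⬝ᵥ s) • ξ + c • s = 0) = {0} := by
        ext s
        simp only [Finset.mem_filter, Finset.mem_univ, true_and, Finset.mem_singleton]
        constructor
        · intro h
          have h5 : (ρ ⬝ᵥ s) * (ρ ⬝ᵥ ξ + c) = 0 := by
            have := congrArg (ρ ⬝ᵥ ·) h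
            simp only [dotProduct_add, dotProduct_smul, smul_eq_mul, dotProduct_zero] at this
            linear_combination this
          have h6 : ρ ⬝ᵥ s = 0 := (mul_eq_zero.mp h5).resolve_right fun h => hct (by
            linear_combination h)
          rw [h6, zero_smul, zero_add] at h
          exact (smul_eq_zero.mp h).resolve_left hc0
        · rintro rfl
          simp
      rw [this, if_neg hct]
      simp
      ring
  have h4 : ∑ c ∈ Finset.univ.erase (0 : F), stdChar F (-(c * e)) =
      (Fintype.card F : ℂ) * (if e = 0 then 1 else 0) - 1 := by
    rw [sum_erase_zero]
    have := sum_stdChar_mul (-e)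
    simp only [mul_neg] at this
    rw [this]
    simp
  have h5 : ∑ c ∈ Finset.univ.erase (0 : F),
      (if c = -(ρ ⬝ᵥ ξ) then stdChar F ((ρ ⬝ᵥ ξ) * e) else 0) =
      stdChar F ((ρ ⬝ᵥ ξ) * e) - if ρ ⬝ᵥ ξ = 0 then 1 else 0 := by
    rw [sum_erase_zero]
    by_cases ht : ρ ⬝ᵥ ξ = 0
    · simp [ht]
    · have : (0 : F) ≠ -(ρ ⬝ᵥ ξ) := fun h => ht (neg_eq_zero.mp h.symm)
      simp [ht, this]
  have h6 : ∑ s : σ → F, stdChar F (-(0 * e)) * (if (ρ ⬝ᵥ s) • ξ + (0 : F) • s = 0 then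
      (Fintype.card F : ℂ) ^ Fintype.card σ else 0) =
      ∑ s : σ → F, ∑ t : σ → F, stdChar F ((ρ ⬝ᵥ s) * (t ⬝ᵥ ξ)) := by
    refine Finset.sum_congr rfl fun s _ => ?_
    rw [zero_mul, neg_zero, AddChar.map_zero_eq_one, one_mul, zero_smul, add_zero,
      ← sum_stdChar_dotProduct]
    simp only [dotProduct_smul, smul_eq_mul]
  rw [Finset.sum_congr rfl h3, h6, ← Finset.mul_sum (Finset.univ.erase (0 : F)),
    Finset.sum_add_distrib, ← Finset.mul_sum, h4, h5]
  ring

end PartSums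

/-! ### Character sums over the parts, and their span. -/

section PartCharacters

open scoped Classical
open Matrix

variable {F : Type*} [Field F] [Fintype F] {D N : ℕ} {σ : Type*} [Fintype σ] [DecidableEq σ]
  {P : Matrix (Fin D) σ F} {Q : Matrix σ (Fin (N - D)) F} {x y : Matrix (Fin D) (Fin (N - D)) F}

/-- The factorization is eliminated: full rank of P and Q turns conditions on uᵀP and Qv into
conditions on y - x, so only f and the three indicators remain. -/
theorem partSum_matChar (hxy : y - x = P * Q) (hP : ∀ p, P *ᵥ p = 0 → p = 0)
    (hQ : ∀ h, h ᵥ* Q = 0 → h = 0) (hσ : 1 ≤ Fintype.card σ) (hσD : Fintype.card σ < D)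
    (hN : 2 * D < N) {u : Fin D → F} {v : Fin (N - D) → F} (hu : u ≠ 0) (hv : v ≠ 0)
    {q a b m f τ α β : ℂ} (hq : (Fintype.card F : ℂ) = q) (ha : q ^ D = a) (hb : q ^ (N - D) = b)
    (hm : q ^ Fintype.card σ = m) (hf : stdChar F (u ⬝ᵥ ((y - x) *ᵥ v)) = f)
    (hτ : (if u ⬝ᵥ ((y - x) *ᵥ v) = 0 then 1 else 0) = τ)
    (hα : (if u ᵥ* (y - x) = 0 then 1 else 0) = α) (hβ : (if (y - x) *ᵥ v = 0 then 1 else 0) = β) :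
    partSum x y (matChar (vecMulVec u v)) 0 = q⁻¹ * (m * (m / q) *
      (1 + (q - 1) * (α + β - α * β)) - m + m * (q - 1) * (f - τ)) ∧
    partSum x y (matChar (vecMulVec u v)) 1 = q⁻¹ * (m * (m / q) *
      (1 + (q - 1) * (α + β - α * β)) + m * (q - 1) + m * (q - 1) * (1 - τ)) - (2 * m - 1) ∧
    partSum x y (matChar (vecMulVec u v)) 0 + partSum x y (matChar (vecMulVec u v)) 1 +
      partSum x y (matChar (vecMulVec u v)) 2 =
        m * (m / q) * (1 + (q - 1) * (α + β - α * β)) - (2 * m - 1) ∧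
    partSum x y (matChar (vecMulVec u v)) 0 + partSum x y (matChar (vecMulVec u v)) 1 +
      partSum x y (matChar (vecMulVec u v)) 2 + partSum x y (matChar (vecMulVec u v)) 3 =
        b * (m / q) * (1 + (q - 1) * α) - (m + b - 1) ∧
    partSum x y (matChar (vecMulVec u v)) 0 + partSum x y (matChar (vecMulVec u v)) 1 +
      partSum x y (matChar (vecMulVec u v)) 2 + partSum x y (matChar (vecMulVec u v)) 4 =
        a * (m / q) * (1 + (q - 1) * β) - (m + a - 1) ∧
    partSum x y (matChar (vecMulVec u v)) 0 + partSum x y (matChar (vecMulVec u v)) 1 +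
      partSum x y (matChar (vecMulVec u v)) 2 + partSum x y (matChar (vecMulVec u v)) 3 +
      partSum x y (matChar (vecMulVec u v)) 4 + partSum x y (matChar (vecMulVec u v)) 5 =
        a * (b / q) - (a + b - 1) := by
  obtain ⟨s0, s1, s2, s3, s4, s5⟩ :=
    partSum_formulas hxy hP hQ hσ hσD hN (matChar (vecMulVec u v))
  have hq0 : q ≠ 0 := hq ▸ card_ne_zero_complex F
  have eα : u ᵥ* P = 0 ↔ u ᵥ* (y - x) = 0 := by
    rw [hxy, ← Matrix.vecMul_vecMul]
    exact ⟨fun h => by simp [h], fun h => hQ _ h⟩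
  have eβ : Q *ᵥ v = 0 ↔ (y - x) *ᵥ v = 0 := by
    rw [hxy, ← Matrix.mulVec_mulVec]
    exact ⟨fun h => by simp [h], fun h => hP _ h⟩
  have eτ : u ᵥ* P ⬝ᵥ Q *ᵥ v = u ⬝ᵥ ((y - x) *ᵥ v) := by
    rw [hxy, ← Matrix.mulVec_mulVec, Matrix.dotProduct_mulVec u P]
  have h3 : ∑ s : σ → F, ∑ r : Fin (N - D) → F, stdChar F ((u ⬝ᵥ P *ᵥ s) * (r ⬝ᵥ v)) =
      b * (m / q) * (1 + (q - 1) * α) := by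
    have := sum_sum_stdChar_mul (u ᵥ* P) v
    simp only [eα, hα, hv, if_false, hq, Fintype.card_fin, hb, hm] at this
    simp_rw [Matrix.dotProduct_mulVec u P, this]
    ring
  have h4 : ∑ t : σ → F, ∑ p : Fin D → F, stdChar F ((u ⬝ᵥ p) * ((t ᵥ* Q) ⬝ᵥ v)) =
      a * (m / q) * (1 + (q - 1) * β) := by
    have := sum_sum_stdChar_mul (Q *ᵥ v) u
    simp only [eβ, hβ, hu, if_false, hq, Fintype.card_fin, ha, hm] at this
    simp_rw [← Matrix.dotProduct_mulVec _ Q, fun t p => mul_comm (u ⬝ᵥ p) (t ⬝ᵥ Q *ᵥ v),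
      fun t => dotProduct_comm t (Q *ᵥ v), fun p => dotProduct_comm u p, this]
    ring
  have h5 : ∑ p : Fin D → F, ∑ r : Fin (N - D) → F, stdChar F ((u ⬝ᵥ p) * (r ⬝ᵥ v)) =
      a * (b / q) := by
    have := sum_sum_stdChar_mul u v
    simp only [hu, hv, if_false, hq, Fintype.card_fin, ha, hb] at this
    rw [this]
    ring
  have h2 := sum_sum_stdChar_mul (u ᵥ* P) (Q *ᵥ v)
  have h0 := sum_sum_stdChar_pairing (u ᵥ* P) (Q *ᵥ v) 1
  have h1 := sum_sum_stdChar_pairing (u ᵥ* P) (Q *ᵥ v) 0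
  rw [h2] at h0 h1
  simp only [eα, eβ, eτ, hα, hβ, hf, hτ, hq, hm, one_ne_zero, if_true, if_false, mul_one, mul_zero,
    AddChar.map_zero_eq_one] at h0 h1 h2
  simp only [matChar_vecMulVec_vecMulVec, matChar_zero_right, hq, ha, hb, hm, mul_one] at s0 s1 s2 s3 s4 s5
  rw [h3] at s3
  rw [h4] at s4
  rw [h5] at s5
  simp only [Matrix.dotProduct_mulVec u P, ← Matrix.dotProduct_mulVec _ Q, h2, h0, h1] at s0 s1 s2
  refine ⟨?_, ?_, s2, s3, s4, s5⟩
  · rw [s0]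
    ring
  · rw [s1]

/-- These are the sizes of the parts times q - 1, the trivial-character case that `partSum_matChar`
excludes. -/
theorem partSum_one (hxy : y - x = P * Q) (hP : ∀ p, P *ᵥ p = 0 → p = 0)
    (hQ : ∀ h, h ᵥ* Q = 0 → h = 0) (hσ : 1 ≤ Fintype.card σ) (hσD : Fintype.card σ < D)
    (hN : 2 * D < N) {q a b m : ℂ} (hq : (Fintype.card F : ℂ) = q) (ha : q ^ D = a)
    (hb : q ^ (N - D) = b) (hm : q ^ Fintype.card σ = m) :
    partSum x y (fun _ => 1) 0 = (m - 1) * (m / q) ∧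
    partSum x y (fun _ => 1) 1 = (m - 1) * (m / q - 1) ∧
    partSum x y (fun _ => 1) 2 = (q - 2) * ((m - 1) * (m / q)) ∧
    partSum x y (fun _ => 1) 3 = (m - 1) * (b - m) ∧
    partSum x y (fun _ => 1) 4 = (a - m) * (m - 1) ∧
    partSum x y (fun _ => 1) 5 = (a - m) * (b - m) := by
  obtain ⟨s0, s1, s2, s3, s4, s5⟩ := partSum_formulas hxy hP hQ hσ hσD hN (fun _ => 1)
  have hq0 : q ≠ 0 := hq ▸ card_ne_zero_complex F
  have h0 := sum_sum_stdChar_pairing (0 : σ → F) 0 1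
  have h1 := sum_sum_stdChar_pairing (0 : σ → F) 0 0
  simp only [zero_dotProduct, zero_mul, AddChar.map_zero_eq_one, if_true, sub_self, mul_zero,
    add_zero, one_ne_zero, if_false, Finset.sum_const, Finset.card_univ, Fintype.card_fun,
    nsmul_eq_mul, Nat.cast_pow, hq, hm, mul_one] at h0 h1
  simp only [Finset.sum_const, Finset.card_univ, Fintype.card_fun, nsmul_eq_mul, Nat.cast_pow,
    Fintype.card_fin, hq, ha, hb, hm, mul_one] at s0 s1 s2 s3 s4 s5
  rw [h0] at s0
  rw [h1] at s1
  have e0 : partSum x y (fun _ => 1) 0 = (m - 1) * (m / q) := by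
    rw [s0]; field_simp; ring
  have e1 : partSum x y (fun _ => 1) 1 = (m - 1) * (m / q - 1) := by
    rw [s1]; field_simp; ring
  have e2 : partSum x y (fun _ => 1) 2 = (q - 2) * ((m - 1) * (m / q)) := by
    have h : m / q * q = m := div_mul_cancel₀ _ hq0
    linear_combination s2 - e0 - e1 - (m - 1) * h
  have e3 : partSum x y (fun _ => 1) 3 = (m - 1) * (b - m) := by
    linear_combination s3 - s2
  have e4 : partSum x y (fun _ => 1) 4 = (a - m) * (m - 1) := by
    linear_combination s4 - s2
  refine ⟨e0, e1, e2, e3, e4, ?_⟩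
  linear_combination s5 - s3 - e4

/-- The character sum over the part `yPart x y i`, as a function on the matrices of rank one. -/
noncomputable def partChar (x y : Matrix (Fin D) (Fin (N - D)) F) (i : Fin 6)
    (a : {a : Matrix (Fin D) (Fin (N - D)) F // a.rank = 1}) : ℂ :=
  ∑ w, (if w ∈ yPart x y i then matChar a.1 (w - x) else 0)

theorem partSum_matChar_eq (i : Fin 6)
    (a : {a : Matrix (Fin D) (Fin (N - D)) F // a.rank = 1}) :
    partSum x y (matChar a.1) i = ((Fintype.card F : ℂ) - 1) * partChar x y i a := rfl

/-- The relations of `partSum_matChar` are solved one function at a time: the constant from the sum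
over all parts, the two annihilator indicators from the unions with O₄ and O₅, the trace indicator
from O₂, and finally f from O₁. -/
theorem basicComb_mem_span (hxy : y - x = P * Q) (hP : ∀ p, P *ᵥ p = 0 → p = 0)
    (hQ : ∀ h, h ᵥ* Q = 0 → h = 0) (hσ : 1 ≤ Fintype.card σ) (hσD : Fintype.card σ < D)
    (hN : 2 * D < N) (c : Fin 5 → ℝ) :
    (fun a : {a : Matrix (Fin D) (Fin (N - D)) F // a.rank = 1} => basicComb (y - x) c a.1) ∈
      Submodule.span ℝ (Set.range (partChar x y)) := by
  set S := Submodule.span ℝ (Set.range (partChar x y)) with hS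
  have hmem : ∀ i, partChar x y i ∈ S := fun i => Submodule.subset_span ⟨i, rfl⟩
  obtain ⟨q, hq⟩ : ∃ q : ℝ, (Fintype.card F : ℝ) = q := ⟨_, rfl⟩
  obtain ⟨a, ha⟩ : ∃ a : ℝ, q ^ D = a := ⟨_, rfl⟩
  obtain ⟨b, hb⟩ : ∃ b : ℝ, q ^ (N - D) = b := ⟨_, rfl⟩
  obtain ⟨m, hm⟩ : ∃ m : ℝ, q ^ Fintype.card σ = m := ⟨_, rfl⟩
  have hq1 : 1 < q := hq ▸ one_lt_card_real F
  have hq0 : 0 < q := by linarith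
  have hm0 : 0 < m := hm ▸ pow_pos hq0 _
  have ha0 : 0 < a := ha ▸ pow_pos hq0 _
  have hb0 : 0 < b := hb ▸ pow_pos hq0 _
  have hqc : (Fintype.card F : ℂ) = (q : ℂ) := by rw [← hq]; simp
  have hq' : q - 1 ≠ 0 := by linarith
  have hqc' : (q : ℂ) - 1 ≠ 0 := by exact_mod_cast hq'
  have hqc0 : (q : ℂ) ≠ 0 := by exact_mod_cast hq0.ne'
  have hmc0 : (m : ℂ) ≠ 0 := by exact_mod_cast hm0.ne'
  have hac0 : (a : ℂ) ≠ 0 := by exact_mod_cast ha0.ne'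
  have hbc0 : (b : ℂ) ≠ 0 := by exact_mod_cast hb0.ne'
  -- This number is (q - 1)θ₁, by which the sum over all parts is divided to obtain the constant
  -- function.
  have hθ : a * (b / q) - (a + b - 1) ≠ 0 := by
    have h1 : q ^ 2 ≤ a := ha ▸ pow_le_pow_right₀ hq1.le (by omega)
    have h2 : a < b := by
      rw [← ha, ← hb]
      exact pow_lt_pow_right₀ hq1 (by omega)
    have h3 : a / q * q = a := div_mul_cancel₀ _ hq0.ne'
    have h4 : 2 ≤ a / q := by
      rw [le_div_iff₀ hq0]
      have : (2 : ℝ) ≤ q := by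
        rw [← hq]
        exact_mod_cast Fintype.one_lt_card (α := F)
      nlinarith
    have h5 : a * (b / q) = a / q * b := by ring
    rw [h5]
    nlinarith
  have hθc : (a : ℂ) * (b / q) - (a + b - 1) ≠ 0 := by exact_mod_cast hθ
  let R := {a : Matrix (Fin D) (Fin (N - D)) F // a.rank = 1}
  let F₀ : R → ℂ := fun a => matChar a.1 (y - x)
  let F₁ : R → ℂ := fun a => if trace (a.1ᵀ * (y - x)) = 0 then 1 else 0
  let F₂ : R → ℂ := fun a => if a.1ᵀ * (y - x) = 0 then 1 else 0
  let F₃ : R → ℂ := fun a => if a.1 * (y - x)ᵀ = 0 then 1 else 0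
  let F₄ : R → ℂ := fun _ => 1
  have key : ∀ A : R, ((q : ℂ) - 1) * partChar x y 0 A = (q : ℂ)⁻¹ * (m * (m / q) *
      (1 + (q - 1) * (F₂ A + F₃ A - F₂ A * F₃ A)) - m + m * (q - 1) * (F₀ A - F₁ A)) ∧
      ((q : ℂ) - 1) * partChar x y 1 A = (q : ℂ)⁻¹ * (m * (m / q) * (1 + (q - 1) *
        (F₂ A + F₃ A - F₂ A * F₃ A)) + m * (q - 1) + m * (q - 1) * (1 - F₁ A)) - (2 * m - 1) ∧
      ((q : ℂ) - 1) * partChar x y 0 A + ((q : ℂ) - 1) * partChar x y 1 A +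
        ((q : ℂ) - 1) * partChar x y 2 A =
        m * (m / q) * (1 + (q - 1) * (F₂ A + F₃ A - F₂ A * F₃ A)) - (2 * m - 1) ∧
      ((q : ℂ) - 1) * partChar x y 0 A + ((q : ℂ) - 1) * partChar x y 1 A +
        ((q : ℂ) - 1) * partChar x y 2 A + ((q : ℂ) - 1) * partChar x y 3 A =
        b * (m / q) * (1 + (q - 1) * F₂ A) - (m + b - 1) ∧
      ((q : ℂ) - 1) * partChar x y 0 A + ((q : ℂ) - 1) * partChar x y 1 A +
        ((q : ℂ) - 1) * partChar x y 2 A + ((q : ℂ) - 1) * partChar x y 4 A =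
        a * (m / q) * (1 + (q - 1) * F₃ A) - (m + a - 1) ∧
      ((q : ℂ) - 1) * partChar x y 0 A + ((q : ℂ) - 1) * partChar x y 1 A +
        ((q : ℂ) - 1) * partChar x y 2 A + ((q : ℂ) - 1) * partChar x y 3 A +
        ((q : ℂ) - 1) * partChar x y 4 A + ((q : ℂ) - 1) * partChar x y 5 A =
        a * (b / q) - (a + b - 1) := by
    intro A
    obtain ⟨u, v, hu, hv, h⟩ := Matrix.exists_eq_vecMulVec_of_rank_eq_one A.1 A.2
    have := partSum_matChar (q := q) (a := a) (b := b) (m := m) hxy hP hQ hσ hσD hN hu hv hqc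
      (by rw [← ha]; push_cast; rfl) (by rw [← hb]; push_cast; rfl) (by rw [← hm]; push_cast; rfl)
      (f := F₀ A) (τ := F₁ A) (α := F₂ A) (β := F₃ A)
      (by simp only [F₀, h, matChar_vecMulVec_left])
      (by simp only [F₁, h, trace_transpose_vecMulVec_mul])
      (by simp only [F₂, h, transpose_vecMulVec_mul_eq_zero, hv, false_or])
      (by simp only [F₃, h, vecMulVec_mul_transpose_eq_zero, hu, false_or])
    rw [← h] at this
    simp only [partSum_matChar_eq, hqc] at this
    exact this
  have m4 : F₄ ∈ S := by
    have : F₄ = ((q - 1) / (a * (b / q) - (a + b - 1))) • (partChar x y 0 + partChar x y 1 +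
        partChar x y 2 + partChar x y 3 + partChar x y 4 + partChar x y 5) := by
      ext A
      obtain ⟨-, -, -, -, -, k⟩ := key A
      simp only [F₄, Pi.smul_apply, Pi.add_apply, Complex.real_smul]
      push_cast
      rw [div_mul_eq_mul_div, eq_div_iff hθc]
      linear_combination -k
    rw [this]
    exact S.smul_mem _ (S.add_mem (S.add_mem (S.add_mem (S.add_mem (S.add_mem (hmem 0) (hmem 1))
      (hmem 2)) (hmem 3)) (hmem 4)) (hmem 5))
  have m2 : F₂ ∈ S := by
    have : F₂ = (q / (b * m)) • (partChar x y 0 + partChar x y 1 + partChar x y 2 +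
        partChar x y 3) + ((m + b - 1 - b * (m / q)) * (q / (b * m * (q - 1)))) • F₄ := by
      ext A
      obtain ⟨-, -, -, k, -, -⟩ := key A
      simp only [F₄, Pi.smul_apply, Pi.add_apply, Complex.real_smul]
      push_cast
      have : (partChar x y 0 A + partChar x y 1 A + partChar x y 2 A + partChar x y 3 A) =
          (b * (m / q) * (1 + (q - 1) * F₂ A) - (m + b - 1)) / ((q : ℂ) - 1) := by
        rw [eq_div_iff hqc']
        linear_combination k
      rw [this]
      field_simp
      ring
    rw [this]
    exact S.add_mem (S.smul_mem _ (S.add_mem (S.add_mem (S.add_mem (hmem 0) (hmem 1))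
      (hmem 2)) (hmem 3))) (S.smul_mem _ m4)
  have m3 : F₃ ∈ S := by
    have : F₃ = (q / (a * m)) • (partChar x y 0 + partChar x y 1 + partChar x y 2 +
        partChar x y 4) + ((m + a - 1 - a * (m / q)) * (q / (a * m * (q - 1)))) • F₄ := by
      ext A
      obtain ⟨-, -, -, -, k, -⟩ := key A
      simp only [F₄, Pi.smul_apply, Pi.add_apply, Complex.real_smul]
      push_cast
      have : (partChar x y 0 A + partChar x y 1 A + partChar x y 2 A + partChar x y 4 A) =
          (a * (m / q) * (1 + (q - 1) * F₃ A) - (m + a - 1)) / ((q : ℂ) - 1) := by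
        rw [eq_div_iff hqc']
        linear_combination k
      rw [this]
      field_simp
      ring
    rw [this]
    exact S.add_mem (S.smul_mem _ (S.add_mem (S.add_mem (S.add_mem (hmem 0) (hmem 1))
      (hmem 2)) (hmem 4))) (S.smul_mem _ m4)
  -- Subtracting q times the O₂ sum from the sum over O₁ ∪ O₂ ∪ O₃ cancels the product F₂F₃, which
  -- lies outside the five-function span. The same device serves for F₀.
  have m1 : F₁ ∈ S := by
    have : F₁ = (1 / m) • (partChar x y 0 + partChar x y 1 + partChar x y 2) -
        (q / m) • partChar x y 1 + (2 - (2 * m - 1) / m) • F₄ := by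
      ext A
      obtain ⟨-, k1, k2, -, -, -⟩ := key A
      simp only [F₄, Pi.smul_apply, Pi.add_apply, Pi.sub_apply, Complex.real_smul]
      push_cast
      have h1 : partChar x y 1 A = ((q : ℂ)⁻¹ * (m * (m / q) * (1 + (q - 1) *
          (F₂ A + F₃ A - F₂ A * F₃ A)) + m * (q - 1) + m * (q - 1) * (1 - F₁ A)) - (2 * m - 1)) /
          ((q : ℂ) - 1) := by
        rw [eq_div_iff hqc']
        linear_combination k1
      have h2 : partChar x y 0 A + partChar x y 1 A + partChar x y 2 A = (m * (m / q) *
          (1 + (q - 1) * (F₂ A + F₃ A - F₂ A * F₃ A)) - (2 * m - 1)) / ((q : ℂ) - 1) := by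
        rw [eq_div_iff hqc']
        linear_combination k2
      rw [h2, h1]
      field_simp
      ring
    rw [this]
    exact S.add_mem (S.sub_mem (S.smul_mem _ (S.add_mem (S.add_mem (hmem 0) (hmem 1)) (hmem 2)))
      (S.smul_mem _ (hmem 1))) (S.smul_mem _ m4)
  have m0 : F₀ ∈ S := by
    have : F₀ = F₁ + (q / m) • partChar x y 0 -
        (1 / m) • (partChar x y 0 + partChar x y 1 + partChar x y 2) +
        ((1 - m) / (m * (q - 1))) • F₄ := by
      ext A
      obtain ⟨k0, -, k2, -, -, -⟩ := key A
      simp only [F₄, Pi.smul_apply, Pi.add_apply, Pi.sub_apply, Complex.real_smul]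
      push_cast
      have h1 : partChar x y 0 A = ((q : ℂ)⁻¹ * (m * (m / q) * (1 + (q - 1) *
          (F₂ A + F₃ A - F₂ A * F₃ A)) - m + m * (q - 1) * (F₀ A - F₁ A))) /
          ((q : ℂ) - 1) := by
        rw [eq_div_iff hqc']
        linear_combination k0
      have h2 : partChar x y 0 A + partChar x y 1 A + partChar x y 2 A = (m * (m / q) *
          (1 + (q - 1) * (F₂ A + F₃ A - F₂ A * F₃ A)) - (2 * m - 1)) / ((q : ℂ) - 1) := by
        rw [eq_div_iff hqc']
        linear_combination k2
      rw [h2, h1]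
      field_simp
      ring
    rw [this]
    exact S.add_mem (S.sub_mem (S.add_mem m1 (S.smul_mem _ (hmem 0))) (S.smul_mem _
      (S.add_mem (S.add_mem (hmem 0) (hmem 1)) (hmem 2)))) (S.smul_mem _ m4)
  have : (fun A : R => basicComb (y - x) c A.1) =
      c 0 • F₀ + c 1 • F₁ + c 2 • F₂ + c 3 • F₃ + c 4 • F₄ := by
    ext A
    simp [basicComb, F₀, F₁, F₂, F₃, F₄]
  rw [this]
  exact S.add_mem (S.add_mem (S.add_mem (S.add_mem (S.smul_mem _ m0) (S.smul_mem _ m1))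
    (S.smul_mem _ m2)) (S.smul_mem _ m3)) (S.smul_mem _ m4)

end PartCharacters

/-! ### Transforms of the five functions at neighbours of x. -/

section PartValues

open scoped Classical
open Matrix

variable {F : Type*} [Field F] [Fintype F]

section General

variable {ι κ σ : Type*} [Fintype ι] [Fintype κ] [Fintype σ] [DecidableEq ι] [DecidableEq κ]
  [DecidableEq σ] {P : Matrix ι σ F} {Q : Matrix σ κ F}

theorem sum_stdChar_mul_dotProduct_eq (e : F) {r : κ → F} (hr : r ≠ 0) :
    ∑ v ∈ Finset.univ.erase (0 : κ → F), stdChar F (e * (r ⬝ᵥ v)) =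
      (Fintype.card F : ℂ) ^ Fintype.card κ * (if e = 0 then 1 else 0) - 1 := by
  rw [sum_erase_zero]
  have := sum_stdChar_dotProduct (e • r)
  simp only [dotProduct_smul, smul_eq_mul, smul_eq_zero, hr, or_false] at this
  simp_rw [dotProduct_comm r, this]
  simp

theorem sum_col_annihilator (hP : ∀ p, P *ᵥ p = 0 → p = 0) :
    ∑ u : ι → F, (if u ᵥ* P = 0 then (1 : ℂ) else 0) =
      (Fintype.card F : ℂ) ^ Fintype.card ι / (Fintype.card F : ℂ) ^ Fintype.card σ := by
  have h := card_ker_complex Pᵀ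
  rw [Matrix.rank_transpose, Matrix.rank_eq_card_of_mulVec_injective P hP] at h
  simp_rw [Matrix.mulVec_transpose] at h
  rw [← h]
  simp

/-- Adjoining p to P as a further independent column reduces this to `sum_col_annihilator`. -/
theorem sum_col_annihilator_of_not_inColSpace (hP : ∀ p, P *ᵥ p = 0 → p = 0) {p : ι → F}
    (hp : ¬ InColSpace P p) :
    ∑ u : ι → F, (if u ᵥ* P = 0 then (if u ⬝ᵥ p = 0 then (1 : ℂ) else 0) else 0) =
      (Fintype.card F : ℂ) ^ Fintype.card ι / (Fintype.card F : ℂ) ^ (Fintype.card σ + 1) := by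
  have h := sum_col_annihilator (F := F) (P := Matrix.fromCols P (replicateCol Unit p))
    (mulVec_fromCols_eq_zero hP fun s h => hp ⟨s, h⟩)
  rw [Fintype.card_sum, Fintype.card_unit] at h
  rw [← h]
  refine Finset.sum_congr rfl fun u _ => ?_
  have e : u ᵥ* Matrix.fromCols P (replicateCol Unit p) = 0 ↔ u ᵥ* P = 0 ∧ u ⬝ᵥ p = 0 := by
    rw [Matrix.vecMul_fromCols]
    constructor
    · intro h
      exact ⟨funext fun i => congrFun h (Sum.inl i), congrFun h (Sum.inr ())⟩
    · rintro ⟨h1, h2⟩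
      ext (i | i)
      · exact congrFun h1 i
      · exact h2
  simp only [e]
  by_cases h1 : u ᵥ* P = 0 <;> by_cases h2 : u ⬝ᵥ p = 0 <;> simp only [h1, h2, and_self,
    and_true, and_false, if_true, if_false]

/-- Only those u that annihilate the column space contribute; on them u ⬝ᵥ p vanishes identically,
or on a subspace whose size does not depend on p. The values V and V' stay anonymous, because ω is
orthogonal whatever they are. -/
theorem sum_rankOne_col_annihilator (hP : ∀ p, P *ᵥ p = 0 → p = 0)
    (hQ : ∀ h, h ᵥ* Q = 0 → h = 0) :
    ∃ V V' : ℂ, ∀ (p : ι → F) (r : κ → F), r ≠ 0 →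
      (InColSpace P p → ∑ a ∈ rankOne F ι κ, (if aᵀ * (P * Q) = 0 then 1 else 0) *
        matChar a (-vecMulVec p r) = V) ∧
      (¬ InColSpace P p → ∑ a ∈ rankOne F ι κ, (if aᵀ * (P * Q) = 0 then 1 else 0) *
        matChar a (-vecMulVec p r) = V') := by
  have hq := one_lt_card_ne F
  have key : ∀ (p : ι → F) (r : κ → F), r ≠ 0 →
      ((Fintype.card F : ℂ) - 1) * ∑ a ∈ rankOne F ι κ, (if aᵀ * (P * Q) = 0 then 1 else 0) *
        matChar a (-vecMulVec p r) = ∑ u ∈ Finset.univ.erase (0 : ι → F),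
          (if u ᵥ* P = 0 then ((Fintype.card F : ℂ) ^ Fintype.card κ *
            (if u ⬝ᵥ p = 0 then 1 else 0) - 1) else 0) := by
    intro p r hr
    rw [sum_rankOne_mul_pred]
    refine Finset.sum_congr rfl fun u _ => ?_
    have e : ∀ v ∈ Finset.univ.erase (0 : κ → F), (if (vecMulVec u v)ᵀ * (P * Q) = 0 then 1 else 0) *
        matChar (vecMulVec u v) (-vecMulVec p r) =
        (if u ᵥ* P = 0 then 1 else 0) * stdChar F (-(u ⬝ᵥ p) * (r ⬝ᵥ v)) := by
      intro v hv
      have hv0 := Finset.ne_of_mem_erase hv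
      have h1 : (vecMulVec u v)ᵀ * (P * Q) = 0 ↔ u ᵥ* P = 0 := by
        rw [transpose_vecMulVec_mul_eq_zero, ← Matrix.vecMul_vecMul]
        simp only [hv0, false_or]
        exact ⟨fun h => hQ _ h, fun h => by simp [h]⟩
      simp only [h1]
      rw [← neg_vecMulVec, matChar_vecMulVec_vecMulVec, dotProduct_neg]
    rw [Finset.sum_congr rfl e, ← Finset.mul_sum, sum_stdChar_mul_dotProduct_eq _ hr]
    simp
  refine ⟨((Fintype.card F : ℂ) - 1)⁻¹ * ∑ u ∈ Finset.univ.erase (0 : ι → F),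
    (if u ᵥ* P = 0 then ((Fintype.card F : ℂ) ^ Fintype.card κ - 1) else 0),
    ((Fintype.card F : ℂ) - 1)⁻¹ * ((Fintype.card F : ℂ) ^ Fintype.card κ *
      ((Fintype.card F : ℂ) ^ Fintype.card ι / (Fintype.card F : ℂ) ^ (Fintype.card σ + 1)) -
      (Fintype.card F : ℂ) ^ Fintype.card ι / (Fintype.card F : ℂ) ^ Fintype.card σ -
      ((Fintype.card F : ℂ) ^ Fintype.card κ - 1)), fun p r hr => ⟨fun hp => ?_, fun hp => ?_⟩⟩
  · rw [eq_inv_mul_iff_mul_eq₀ hq, key p r hr]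
    refine Finset.sum_congr rfl fun u _ => ?_
    split_ifs with h1 h2
    · simp
    · obtain ⟨s, rfl⟩ := hp
      rw [Matrix.dotProduct_mulVec, h1] at h2
      simp at h2
    · rfl
  · rw [eq_inv_mul_iff_mul_eq₀ hq, key p r hr, sum_erase_zero,
      ← sum_col_annihilator_of_not_inColSpace hP hp, ← sum_col_annihilator hP, Finset.mul_sum,
      ← Finset.sum_sub_distrib]
    simp only [Matrix.zero_vecMul, zero_dotProduct, if_true, mul_one]
    congr 1
    refine Finset.sum_congr rfl fun u _ => ?_
    split_ifs <;> simp

theorem sum_rankOne_transpose (g : Matrix ι κ F → ℂ) :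
    ∑ a ∈ rankOne F κ ι, g aᵀ = ∑ a ∈ rankOne F ι κ, g a := by
  refine Finset.sum_nbij' (fun a => aᵀ) (fun a => aᵀ) ?_ ?_ ?_ ?_ ?_
  · intro a ha
    rw [mem_rankOne, Matrix.rank_transpose]
    exact mem_rankOne.mp ha
  · intro a ha
    rw [mem_rankOne, Matrix.rank_transpose]
    exact mem_rankOne.mp ha
  all_goals simp

theorem matChar_transpose (a w : Matrix ι κ F) : matChar aᵀ wᵀ = matChar a w := by
  rw [matChar, Matrix.transpose_transpose, Matrix.trace_mul_comm, ← Matrix.trace_transpose,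
    Matrix.transpose_mul, Matrix.transpose_transpose, matChar]

theorem sum_rankOne_row_annihilator (hP : ∀ p, P *ᵥ p = 0 → p = 0)
    (hQ : ∀ h, h ᵥ* Q = 0 → h = 0) :
    ∃ V V' : ℂ, ∀ (p : ι → F) (r : κ → F), p ≠ 0 →
      (InRowSpace Q r → ∑ a ∈ rankOne F ι κ, (if a * (P * Q)ᵀ = 0 then 1 else 0) *
        matChar a (-vecMulVec p r) = V) ∧
      (¬ InRowSpace Q r → ∑ a ∈ rankOne F ι κ, (if a * (P * Q)ᵀ = 0 then 1 else 0) *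
        matChar a (-vecMulVec p r) = V') := by
  obtain ⟨V, V', h⟩ := sum_rankOne_col_annihilator (P := Qᵀ) (Q := Pᵀ)
    (fun p hp => hQ p (by rwa [Matrix.mulVec_transpose] at hp))
    (fun p hp => hP p (by rwa [Matrix.vecMul_transpose] at hp))
  refine ⟨V, V', fun p r hp => ?_⟩
  have h1 := h r p hp
  have e : ∑ a ∈ rankOne F κ ι, (if aᵀ * (Qᵀ * Pᵀ) = 0 then 1 else 0) *
      matChar a (-vecMulVec r p) = ∑ a ∈ rankOne F ι κ, (if a * (P * Q)ᵀ = 0 then 1 else 0) *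
        matChar a (-vecMulVec p r) := by
    rw [← sum_rankOne_transpose]
    refine Finset.sum_congr rfl fun a _ => ?_
    rw [← Matrix.transpose_mul, ← matChar_transpose a, Matrix.transpose_neg, transpose_vecMulVec]
    simp only [Matrix.transpose_transpose]
  have e2 : InColSpace Qᵀ r ↔ InRowSpace Q r := by
    simp only [InColSpace, InRowSpace, Matrix.mulVec_transpose]
  rwa [e, e2] at h1

theorem sum_rankOne_matChar_mul_neg (y d : Matrix ι κ F) :
    ∑ a ∈ rankOne F ι κ, matChar a y * matChar a (-d) = rankOneSum F ι κ (y - d).rank := by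
  simp_rw [← matChar_add_right, ← sub_eq_add_neg]
  exact sum_rankOne_matChar _

/-- The trace condition is the average of the characters of the multiples of y. -/
theorem sum_rankOne_trace (y d : Matrix ι κ F) :
    ∑ a ∈ rankOne F ι κ, (if trace (aᵀ * y) = 0 then 1 else 0) * matChar a (-d) =
      (Fintype.card F : ℂ)⁻¹ * ∑ e : F, (rankOneSum F ι κ (e • y - d).rank : ℂ) := by
  have h : ∀ a : Matrix ι κ F, (if trace (aᵀ * y) = 0 then (1 : ℂ) else 0) =
      (Fintype.card F : ℂ)⁻¹ * ∑ e : F, matChar a (e • y) := by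
    intro a
    have := sum_stdChar_mul (trace (aᵀ * y))
    have e : ∀ s : F, matChar a (s • y) = stdChar F (s * trace (aᵀ * y)) := fun s => by
      simp [matChar]
    simp_rw [e, this]
    split_ifs <;> simp [card_ne_zero_complex F]
  simp_rw [h, mul_assoc, ← Finset.mul_sum, Finset.sum_mul]
  rw [Finset.sum_comm]
  simp_rw [sum_rankOne_matChar_mul_neg]

theorem rank_smul_sub_vecMulVec {e : F} (he : e ≠ 0) (y : Matrix ι κ F) (p : ι → F) (r : κ → F) :
    (e • y - vecMulVec p r).rank = (y - vecMulVec (e⁻¹ • p) r).rank := by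
  rw [← Matrix.rank_smul_of_ne_zero he (y - vecMulVec (e⁻¹ • p) r), smul_sub, smul_vecMulVec,
    smul_smul, mul_inv_cancel₀ he, one_smul]

theorem sum_rankOneSum_eq_of_forall (y : Matrix ι κ F) {p : ι → F} {r : κ → F} (hp : p ≠ 0)
    (hr : r ≠ 0) (j : ℕ)
    (h : ∀ e : F, e ≠ 0 → (y - vecMulVec (e • p) r).rank = j) :
    ∑ e : F, (rankOneSum F ι κ (e • y - vecMulVec p r).rank : ℂ) =
      rankOneSum F ι κ 1 + ((Fintype.card F : ℂ) - 1) * rankOneSum F ι κ j := by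
  have hc := sum_erase_zero fun e : F => (rankOneSum F ι κ (e • y - vecMulVec p r).rank : ℂ)
  rw [zero_smul, zero_sub, Matrix.rank_neg', Matrix.rank_vecMulVec_eq_one p r hp hr] at hc
  have h2 : ∑ e ∈ Finset.univ.erase (0 : F), (rankOneSum F ι κ (e • y - vecMulVec p r).rank : ℂ) =
      ∑ e ∈ Finset.univ.erase (0 : F), (rankOneSum F ι κ j : ℂ) := by
    refine Finset.sum_congr rfl fun e he => ?_
    have he0 := Finset.ne_of_mem_erase he
    rw [rank_smul_sub_vecMulVec he0, h _ (inv_ne_zero he0)]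
  rw [sum_erase_zero fun _ : F => (rankOneSum F ι κ j : ℂ), Finset.sum_const, Finset.card_univ,
    nsmul_eq_mul] at h2
  linear_combination h2 - hc

/-- The multiple e = 0 leaves a matrix of rank one; among e ≠ 0 only e = s ⬝ᵥ t lowers the rank. -/
theorem sum_rankOneSum_eq_of_pairing (hP : ∀ p, P *ᵥ p = 0 → p = 0)
    (hQ : ∀ h, h ᵥ* Q = 0 → h = 0) {s t : σ → F} (h : s ⬝ᵥ t ≠ 0) :
    ∑ e : F, (rankOneSum F ι κ (e • (P * Q) - vecMulVec (P *ᵥ s) (t ᵥ* Q)).rank : ℂ) =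
      rankOneSum F ι κ 1 + ((Fintype.card F : ℂ) - 2) * rankOneSum F ι κ (Fintype.card σ) +
        rankOneSum F ι κ (Fintype.card σ - 1) := by
  have hs : P *ᵥ s ≠ 0 := fun h0 => h (by rw [hP s h0, zero_dotProduct])
  have ht : t ᵥ* Q ≠ 0 := fun h0 => h (by rw [hQ t h0, dotProduct_zero])
  have hc := sum_erase_zero fun e : F =>
    (rankOneSum F ι κ (e • (P * Q) - vecMulVec (P *ᵥ s) (t ᵥ* Q)).rank : ℂ)
  rw [zero_smul, zero_sub, Matrix.rank_neg', Matrix.rank_vecMulVec_eq_one _ _ hs ht] at hc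
  have h2 : ∑ e ∈ Finset.univ.erase (0 : F),
      (rankOneSum F ι κ (e • (P * Q) - vecMulVec (P *ᵥ s) (t ᵥ* Q)).rank : ℂ) =
      ∑ e ∈ Finset.univ.erase (0 : F), ((rankOneSum F ι κ (Fintype.card σ) : ℂ) +
        if e = s ⬝ᵥ t then (rankOneSum F ι κ (Fintype.card σ - 1) : ℂ) -
          rankOneSum F ι κ (Fintype.card σ) else 0) := by
    refine Finset.sum_congr rfl fun e he => ?_
    have he0 := Finset.ne_of_mem_erase he
    rw [rank_smul_sub_vecMulVec he0, ← Matrix.mulVec_smul]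
    by_cases he1 : e = s ⬝ᵥ t
    · have h1 := rank_sub_col_row_of_eq hP hQ (e⁻¹ • s) t (by
        rw [smul_dotProduct, he1, smul_eq_mul, inv_mul_cancel₀ h])
      rw [if_pos he1, add_sub_cancel, ← h1, Nat.add_sub_cancel]
    · rw [if_neg he1, add_zero, rank_sub_col_row_of_ne hP hQ (e⁻¹ • s) t]
      rw [smul_dotProduct, smul_eq_mul]
      intro h1
      exact he1 (by rw [← mul_one e, ← h1, mul_inv_cancel_left₀ he0])
  rw [sum_erase_zero fun e : F => ((rankOneSum F ι κ (Fintype.card σ) : ℂ) +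
        if e = s ⬝ᵥ t then (rankOneSum F ι κ (Fintype.card σ - 1) : ℂ) -
          rankOneSum F ι κ (Fintype.card σ) else 0), if_neg h.symm, Finset.sum_add_distrib,
    Finset.sum_ite_eq', if_pos (Finset.mem_univ _), Finset.sum_const, Finset.card_univ,
    nsmul_eq_mul] at h2
  linear_combination h2 - hc

end General

end PartValues

/-! ### Orthogonality to ω. -/

section Orthogonality

open scoped Classical
open Matrix

variable {F : Type*} [Field F] [Fintype F] {D N : ℕ} {σ : Type*} [Fintype σ] [DecidableEq σ]
  {P : Matrix (Fin D) σ F} {Q : Matrix σ (Fin (N - D)) F} {x y : Matrix (Fin D) (Fin (N - D)) F}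

theorem partSum_of_forall {G : Matrix (Fin D) (Fin (N - D)) F → ℂ} {V : ℂ} {i : Fin 6}
    (h : ∀ (p : Fin D → F) (r : Fin (N - D) → F), p ≠ 0 → r ≠ 0 →
      x + vecMulVec p r ∈ yPart x y i → G (vecMulVec p r) = V) :
    partSum x y G i = V * partSum x y (fun _ => 1) i := by
  rw [partSum, partSum, mul_left_comm, Finset.mul_sum _ _ V]
  congr 1
  refine Finset.sum_congr rfl fun w _ => ?_
  split_ifs with hw
  · obtain ⟨p, r, hp, hr, e⟩ := Matrix.exists_eq_vecMulVec_of_rank_eq_one _ (sub_rank_of_mem_yPart hw)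
    rw [e, h p r hp hr, mul_one]
    rwa [← e, add_sub_cancel]
  · rw [mul_zero]

/-- The transform is constant on each part, since its value at x + prᵀ depends only on the ranks of
e(y - x) - prᵀ and on whether p and r lie in their spaces. -/
theorem partSum_charTransform_basicComb (hxy : y - x = P * Q) (hP : ∀ p, P *ᵥ p = 0 → p = 0)
    (hQ : ∀ h, h ᵥ* Q = 0 → h = 0) (hσ : 1 ≤ Fintype.card σ) (hσD : Fintype.card σ < D)
    (hN : 2 * D < N) (c : Fin 5 → ℝ) {q : ℂ} (hq : (Fintype.card F : ℂ) = q) {θ : ℕ → ℂ}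
    (hθ : ∀ j, (rankOneSum F (Fin D) (Fin (N - D)) j : ℂ) = θ j) :
    ∃ A A' B B' : ℂ, ∀ i, partSum x y
      (fun d => charTransform x (basicComb (y - x) c) (x + d)) i =
      ![c 0 * θ (Fintype.card σ - 1) + c 1 * (q⁻¹ * (θ 1 + (q - 2) * θ (Fintype.card σ) +
          θ (Fintype.card σ - 1))) + c 2 * A + c 3 * B + c 4 * θ 1,
        c 0 * θ (Fintype.card σ) + c 1 * (q⁻¹ * (θ 1 + (q - 1) * θ (Fintype.card σ))) +
          c 2 * A + c 3 * B + c 4 * θ 1,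
        c 0 * θ (Fintype.card σ) + c 1 * (q⁻¹ * (θ 1 + (q - 2) * θ (Fintype.card σ) +
          θ (Fintype.card σ - 1))) + c 2 * A + c 3 * B + c 4 * θ 1,
        c 0 * θ (Fintype.card σ) + c 1 * (q⁻¹ * (θ 1 + (q - 1) * θ (Fintype.card σ))) +
          c 2 * A + c 3 * B' + c 4 * θ 1,
        c 0 * θ (Fintype.card σ) + c 1 * (q⁻¹ * (θ 1 + (q - 1) * θ (Fintype.card σ))) +
          c 2 * A' + c 3 * B + c 4 * θ 1,
        c 0 * θ (Fintype.card σ + 1) + c 1 * (q⁻¹ * (θ 1 + (q - 1) * θ (Fintype.card σ + 1))) +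
          c 2 * A' + c 3 * B' + c 4 * θ 1] i * partSum x y (fun _ => 1) i := by
  obtain ⟨A, A', hA⟩ := sum_rankOne_col_annihilator hP hQ
  obtain ⟨B, B', hB⟩ := sum_rankOne_row_annihilator hP hQ
  refine ⟨A, A', B, B', fun i => partSum_of_forall fun p r hp hr hi => ?_⟩
  have e : charTransform x (basicComb (y - x) c) (x + vecMulVec p r) =
      c 0 * θ (P * Q - vecMulVec p r).rank +
      c 1 * (q⁻¹ * ∑ e : F, (rankOneSum F (Fin D) (Fin (N - D))
        (e • (P * Q) - vecMulVec p r).rank : ℂ)) +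
      c 2 * ∑ a ∈ rankOne F (Fin D) (Fin (N - D)), (if aᵀ * (P * Q) = 0 then 1 else 0) *
        matChar a (-vecMulVec p r) +
      c 3 * ∑ a ∈ rankOne F (Fin D) (Fin (N - D)), (if a * (P * Q)ᵀ = 0 then 1 else 0) *
        matChar a (-vecMulVec p r) + c 4 * θ 1 := by
    have h1 := sum_rankOne_matChar_mul_neg (0 : Matrix (Fin D) (Fin (N - D)) F) (vecMulVec p r)
    rw [zero_sub, Matrix.rank_neg', Matrix.rank_vecMulVec_eq_one p r hp hr, hθ] at h1
    simp only [matChar_zero_right, one_mul] at h1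
    rw [← hq, ← hθ, ← sum_rankOne_trace, ← sum_rankOne_matChar_mul_neg, ← h1, charTransform]
    simp only [sub_add_cancel_left, Finset.mul_sum, ← Finset.sum_add_distrib, hxy, basicComb]
    refine Finset.sum_congr rfl fun a _ => ?_
    ring
  rw [e]
  obtain ⟨A1, A2⟩ := hA p r hr
  obtain ⟨B1, B2⟩ := hB p r hp
  obtain ⟨m0, m1, m2, m3, m4, m5⟩ := mem_yPart_iff hxy hP hQ hσ hσD hN hp hr
  have single : ∀ j, (∀ e : F, e ≠ 0 → (P * Q - vecMulVec (e • p) r).rank = j) →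
      (P * Q - vecMulVec p r).rank = j ∧
      ∑ e : F, (rankOneSum F (Fin D) (Fin (N - D)) (e • (P * Q) - vecMulVec p r).rank : ℂ) =
        θ 1 + (q - 1) * θ j := fun j hj => by
    have := hj 1 one_ne_zero
    rw [one_smul] at this
    exact ⟨this, by rw [sum_rankOneSum_eq_of_forall _ hp hr j hj, hθ, hθ, hq]⟩
  have col : ∀ e : F, e ≠ 0 → ¬ InColSpace P p → ¬ InColSpace P (e • p) := by
    rintro e he h ⟨s, hs⟩
    exact h ⟨e⁻¹ • s, by rw [Matrix.mulVec_smul, ← hs, smul_smul, inv_mul_cancel₀ he, one_smul]⟩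
  have pairing : ∀ e : F, e ≠ 0 → HasPairing P Q e p r → 
      ∑ e : F, (rankOneSum F (Fin D) (Fin (N - D)) (e • (P * Q) - vecMulVec p r).rank : ℂ) =
        θ 1 + (q - 2) * θ (Fintype.card σ) + θ (Fintype.card σ - 1) := by
    rintro e he ⟨s, t, rfl, rfl, h⟩
    rw [sum_rankOneSum_eq_of_pairing hP hQ (by rwa [h]), hθ, hθ, hθ, hq]
  fin_cases i
  · have h := m0.mp hi
    rw [pairing 1 one_ne_zero h, A1 h.inColSpace, B1 h.inRowSpace]
    obtain ⟨s, t, rfl, rfl, h⟩ := h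
    have h1 := rank_sub_col_row_of_eq hP hQ s t h
    have h2 : (P * Q - vecMulVec (P *ᵥ s) (t ᵥ* Q)).rank = Fintype.card σ - 1 := by omega
    rw [h2]
    rfl
  · have h := m1.mp hi
    rw [A1 h.inColSpace, B1 h.inRowSpace]
    obtain ⟨s, t, rfl, rfl, h⟩ := h
    obtain ⟨h1, h2⟩ := single (Fintype.card σ) fun e _ => by
      rw [← Matrix.mulVec_smul, rank_sub_col_row_of_ne hP hQ]
      rw [smul_dotProduct, h, smul_zero]
      exact zero_ne_one
    rw [h1, h2]
    rfl
  · obtain ⟨⟨s, rfl⟩, ⟨t, rfl⟩, h0, h1⟩ := m2.mp hi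
    rw [hasPairing_mulVec_vecMul hP hQ] at h0 h1
    rw [A1 ⟨s, rfl⟩, B1 ⟨t, rfl⟩, pairing _ h0 ⟨s, t, rfl, rfl, rfl⟩,
      rank_sub_col_row_of_ne hP hQ s t h1]
    rfl
  · obtain ⟨hc, hr'⟩ := m3.mp hi
    rw [A1 hc, B2 hr']
    obtain ⟨s, rfl⟩ := hc
    obtain ⟨h1, h2⟩ := single (Fintype.card σ) fun e _ => by
      rw [← Matrix.mulVec_smul, rank_sub_col_not_row hP hQ _ _ fun t h => hr' ⟨t, h⟩]
    rw [h1, h2]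
    rfl
  · obtain ⟨hc, hr'⟩ := m4.mp hi
    rw [A2 hc, B1 hr']
    obtain ⟨t, rfl⟩ := hr'
    obtain ⟨h1, h2⟩ := single (Fintype.card σ) fun e he => by
      rw [rank_sub_not_col_row hP hQ _ _ fun s h => col e he hc ⟨s, h⟩]
    rw [h1, h2]
    rfl
  · obtain ⟨hc, hr'⟩ := m5.mp hi
    rw [A2 hc, B2 hr']
    obtain ⟨h1, h2⟩ := single (Fintype.card σ + 1) fun e he => by
      rw [rank_sub_not_col_not_row hP hQ _ _ (fun s h => col e he hc ⟨s, h⟩) fun t h => hr' ⟨t, h⟩]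
    rw [h1, h2]
    rfl

/-- The quantities ω_i|O_i| sum to zero over O₅ ∪ O₆, over O₄ ∪ O₆ and over each of the complements,
which removes the unknown A, A', B, B' and the constant term. What remains rests on θ_{k-1} - θ_k =
q(θ_k - θ_{k+1}). -/
theorem sum_omegaCoeff_mul_partSum (hxy : y - x = P * Q) (hP : ∀ p, P *ᵥ p = 0 → p = 0)
    (hQ : ∀ h, h ᵥ* Q = 0 → h = 0) (hσ : 1 ≤ Fintype.card σ) (hσD : Fintype.card σ < D)
    (hN : 2 * D < N) (c : Fin 5 → ℝ) :
    ∑ i, (omegaCoeff (Fintype.card F) ((Fintype.card F : ℝ) ^ D) ((Fintype.card F : ℝ) ^ (N - D))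
      (Fintype.card σ) i : ℂ) *
      partSum x y (fun d => charTransform x (basicComb (y - x) c) (x + d)) i = 0 := by
  obtain ⟨k, hk⟩ := Nat.exists_eq_add_of_le' hσ
  obtain ⟨q, hq⟩ : ∃ q : ℂ, (Fintype.card F : ℂ) = q := ⟨_, rfl⟩
  obtain ⟨a, ha⟩ : ∃ a : ℂ, q ^ D = a := ⟨_, rfl⟩
  obtain ⟨b, hb⟩ : ∃ b : ℂ, q ^ (N - D) = b := ⟨_, rfl⟩
  -- With card σ = k + 1, this n is q^(card σ - 1).
  obtain ⟨n, hn⟩ : ∃ n : ℂ, q ^ k = n := ⟨_, rfl⟩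
  have hq0 : q ≠ 0 := hq ▸ card_ne_zero_complex F
  have hq1 : q - 1 ≠ 0 := hq ▸ one_lt_card_ne F
  have hn0 : n ≠ 0 := hn ▸ pow_ne_zero _ hq0
  have hm : q ^ Fintype.card σ = n * q := by rw [hk, pow_succ, hn]
  have hθ : ∀ j, (rankOneSum F (Fin D) (Fin (N - D)) j : ℂ) =
      (a * b / q ^ j - a - b + 1) / (q - 1) := fun j => by
    have := rankOneSum_mul (F := F) (ι := Fin D) (κ := Fin (N - D)) j
    rw [eq_div_iff hq1, mul_comm]
    simpa only [hq, Fintype.card_fin, ha, hb] using this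
  obtain ⟨A, A', B, B', h⟩ :=
    partSum_charTransform_basicComb hxy hP hQ hσ hσD hN c hq hθ
  obtain ⟨n0, n1, n2, n3, n4, n5⟩ := partSum_one hxy hP hQ hσ hσD hN hq ha hb hm
  simp only [h, Fin.sum_univ_six]
  simp only [omegaCoeff, Matrix.cons_val, n0, n1, n2, n3, n4, n5]
  push_cast
  rw [hq, ha, hb, hm, hk]
  simp only [Nat.add_sub_cancel, pow_succ, pow_zero, one_mul, hn]
  field_simp
  ring

end Orthogonality

/-! ### The iterates in ω^⊥, and its dimension. -/

section Membership

open scoped Classical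
open Matrix

variable {F : Type*} [Field F] [Fintype F] {D N : ℕ} {σ : Type*} [Fintype σ] [DecidableEq σ]
  {P : Matrix (Fin D) σ F} {Q : Matrix σ (Fin (N - D)) F} {x y : Matrix (Fin D) (Fin (N - D)) F}

theorem matE_mulVec_dotProduct {b : Matrix (Fin D) (Fin (N - D)) F} (hb : b.rank = 1)
    (u v : Matrix (Fin D) (Fin (N - D)) F → ℝ) :
    (matE (bilinearFormsGraph F D N) *ᵥ u) ⬝ᵥ v = u ⬝ᵥ (matE (bilinearFormsGraph F D N) *ᵥ v) := by
  simp only [dotProduct, matE_mulVec_apply b hb, Finset.mul_sum, Finset.sum_mul]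
  rw [Finset.sum_comm]
  refine Finset.sum_congr rfl fun z _ => Finset.sum_congr rfl fun w _ => ?_
  rw [Matrix.rank_sub_rev]
  ring

theorem matE_mulVec_eq_self {b : Matrix (Fin D) (Fin (N - D)) F} (hb : b.rank = 1)
    {w : Matrix (Fin D) (Fin (N - D)) F → ℝ} {g : Matrix (Fin D) (Fin (N - D)) F → ℂ}
    (hw : ∀ z, (w z : ℂ) = charTransform x g z) : matE (bilinearFormsGraph F D N) *ᵥ w = w := by
  have hX : (Fintype.card (Matrix (Fin D) (Fin (N - D)) F) : ℂ) ≠ 0 := by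
    exact_mod_cast Fintype.card_ne_zero
  ext z
  rw [← Complex.ofReal_inj, ofReal_matE_mulVec b hb x]
  simp only [hw]
  rw [charTransform_congr fun a ha => sum_charTransform_mul_matChar x g a ha, charTransform,
    charTransform, Finset.mul_sum]
  refine Finset.sum_congr rfl fun a _ => ?_
  field_simp

/-- E is symmetric and fixes w, so the inner product of EÔ_i with w is the sum of w over O_i. -/
theorem partSum_charTransform {b : Matrix (Fin D) (Fin (N - D)) F} (hb : b.rank = 1)
    {w : Matrix (Fin D) (Fin (N - D)) F → ℝ} {g : Matrix (Fin D) (Fin (N - D)) F → ℂ}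
    (hw : ∀ z, (w z : ℂ) = charTransform x g z) (i : Fin 6) :
    partSum x y (fun d => charTransform x g (x + d)) i = ((Fintype.card F : ℂ) - 1) *
      (((matE (bilinearFormsGraph F D N) *ᵥ setVec (yPart x y i)) ⬝ᵥ w : ℝ) : ℂ) := by
  rw [matE_mulVec_dotProduct hb, matE_mulVec_eq_self hb hw, partSum, dotProduct]
  push_cast
  congr 1
  refine Finset.sum_congr rfl fun z _ => ?_
  by_cases hz : z ∈ yPart x y i <;> simp [setVec, hz, hw]

theorem dist_eq_card (hxy : y - x = P * Q) (hP : ∀ p, P *ᵥ p = 0 → p = 0)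
    (hQ : ∀ h, h ᵥ* Q = 0 → h = 0) : (bilinearFormsGraph F D N).dist x y = Fintype.card σ := by
  rw [bilinearFormsGraph_dist, Matrix.rank_sub_rev, hxy, Matrix.rank_mul_eq_card P Q hP hQ]

theorem omegaVec_dotProduct_eq_zero (hxy : y - x = P * Q) (hP : ∀ p, P *ᵥ p = 0 → p = 0)
    (hQ : ∀ h, h ᵥ* Q = 0 → h = 0) (hσ : 1 ≤ Fintype.card σ) (hσD : Fintype.card σ < D)
    (hN : 2 * D < N) {b : Matrix (Fin D) (Fin (N - D)) F} (hb : b.rank = 1)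
    {w : Matrix (Fin D) (Fin (N - D)) F → ℝ} {c : Fin 5 → ℝ}
    (hw : ∀ z, (w z : ℂ) = charTransform x (basicComb (y - x) c) z) :
    omegaVec x y ⬝ᵥ w = 0 := by
  have h := sum_omegaCoeff_mul_partSum hxy hP hQ hσ hσD hN c
  simp only [partSum_charTransform hb hw, mul_left_comm _ ((Fintype.card F : ℂ) - 1),
    ← Finset.mul_sum] at h
  have h2 := (mul_eq_zero.mp h).resolve_left (one_lt_card_ne F)
  rw [omegaVec, dist_eq_card hxy hP hQ, sum_dotProduct]
  simp only [smul_dotProduct, smul_eq_mul]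
  exact_mod_cast h2

theorem mem_subspaceS (hxy : y - x = P * Q) (hP : ∀ p, P *ᵥ p = 0 → p = 0)
    (hQ : ∀ h, h ᵥ* Q = 0 → h = 0) (hσ : 1 ≤ Fintype.card σ) (hσD : Fintype.card σ < D)
    (hN : 2 * D < N) {b : Matrix (Fin D) (Fin (N - D)) F} (hb : b.rank = 1)
    {w : Matrix (Fin D) (Fin (N - D)) F → ℝ} {c : Fin 5 → ℝ}
    (hw : ∀ z, (w z : ℂ) = charTransform x (basicComb (y - x) c) z) : w ∈ subspaceS x y := by
  have hX : (Fintype.card (Matrix (Fin D) (Fin (N - D)) F) : ℂ) ≠ 0 := by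
    exact_mod_cast Fintype.card_ne_zero
  obtain ⟨d, hd⟩ := (Submodule.mem_span_range_iff_exists_fun ℝ).mp
    (basicComb_mem_span hxy hP hQ hσ hσD hN c)
  refine (Submodule.mem_span_range_iff_exists_fun ℝ).mpr
    -- The factor |X| undoes the |X|⁻¹ in the Fourier expansion of EÔ_i.
    ⟨fun i => Fintype.card (Matrix (Fin D) (Fin (N - D)) F) * d i, ?_⟩
  ext z
  rw [← Complex.ofReal_inj, hw]
  simp only [Finset.sum_apply, Pi.smul_apply, smul_eq_mul, Complex.ofReal_sum, Complex.ofReal_mul,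
    ofReal_matE_mulVec_setVec b hb x, Complex.ofReal_natCast]
  rw [charTransform_congr (h := fun a => ∑ i, (d i : ℂ) * ∑ w, if w ∈ yPart x y i then
    matChar a (w - x) else 0) fun a ha => by
      have := congrFun hd ⟨a, ha⟩
      simp only [Finset.sum_apply, Pi.smul_apply, Complex.real_smul, partChar] at this
      exact this.symm]
  simp only [charTransform, Finset.sum_mul, Finset.mul_sum]
  rw [Finset.sum_comm]
  refine Finset.sum_congr rfl fun i _ => ?_
  refine Finset.sum_congr rfl fun a _ => ?_
  refine Finset.sum_congr rfl fun v _ => ?_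
  field_simp

theorem mem_omegaPerp (hxy : y - x = P * Q) (hP : ∀ p, P *ᵥ p = 0 → p = 0)
    (hQ : ∀ h, h ᵥ* Q = 0 → h = 0) (hσ : 1 ≤ Fintype.card σ) (hσD : Fintype.card σ < D)
    (hN : 2 * D < N) {b : Matrix (Fin D) (Fin (N - D)) F} (hb : b.rank = 1)
    {w : Matrix (Fin D) (Fin (N - D)) F → ℝ} {c : Fin 5 → ℝ}
    (hw : ∀ z, (w z : ℂ) = charTransform x (basicComb (y - x) c) z) : w ∈ omegaPerp x y :=
  ⟨mem_subspaceS hxy hP hQ hσ hσD hN hb hw, omegaVec_dotProduct_eq_zero hxy hP hQ hσ hσD hN hb hw⟩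

/-- Evaluate the Fourier coefficient of ω at uvᵀ, where u and v annihilate y - x from the left and
the right. This character is 1 on O₁, …, O₅, so those sums are just sizes; since the ω_i|O_i| add up
to zero, only the deviation on O₆ survives. It has the nonzero weight ω₆ because k ≥ 2. -/
theorem omegaVec_ne_zero (hxy : y - x = P * Q) (hP : ∀ p, P *ᵥ p = 0 → p = 0)
    (hQ : ∀ h, h ᵥ* Q = 0 → h = 0) (hσ : 2 ≤ Fintype.card σ) (hσD : Fintype.card σ < D)
    (hN : 2 * D < N) {b : Matrix (Fin D) (Fin (N - D)) F} (hb : b.rank = 1) :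
    omegaVec x y ≠ 0 := by
  intro h0
  have hX : (Fintype.card (Matrix (Fin D) (Fin (N - D)) F) : ℂ) ≠ 0 := by
    exact_mod_cast Fintype.card_ne_zero
  have hrk : (y - x).rank = Fintype.card σ := by rw [hxy, Matrix.rank_mul_eq_card P Q hP hQ]
  obtain ⟨u, hu, hu'⟩ := exists_vecMul_eq_zero (y - x) (by rw [Fintype.card_fin]; omega)
  obtain ⟨v, hv, hv'⟩ := exists_mulVec_eq_zero_of_rank_lt (y - x) (by rw [Fintype.card_fin]; omega)
  obtain ⟨w, hw⟩ : ∃ w : Fin 6 → ℝ, omegaCoeff (Fintype.card F) ((Fintype.card F : ℝ) ^ D)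
      ((Fintype.card F : ℝ) ^ (N - D)) (Fintype.card σ) = w := ⟨_, rfl⟩
  have h1 : charTransform x (fun a => ∑ i, (w i : ℂ) * ∑ z, if z ∈ yPart x y i then
      matChar a (z - x) else 0) = 0 := by
    ext z
    have h := congrArg (fun r : ℝ => (r : ℂ)) (congrFun h0 z)
    rw [omegaVec, dist_eq_card hxy hP hQ, hw] at h
    simp only [Finset.sum_apply, Pi.smul_apply, smul_eq_mul, Complex.ofReal_sum,
      Complex.ofReal_mul, ofReal_matE_mulVec_setVec b hb x, Pi.zero_apply,
      Complex.ofReal_zero, mul_left_comm _ (_⁻¹ : ℂ), ← Finset.mul_sum] at h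
    have h2 := (mul_eq_zero.mp h).resolve_left (inv_ne_zero hX)
    refine Eq.trans ?_ h2
    simp only [charTransform, Finset.sum_mul, Finset.mul_sum]
    rw [Finset.sum_comm]
    simp only [mul_assoc]
  have h2 := eq_zero_of_charTransform_eq_zero h1 _ (Matrix.rank_vecMulVec_eq_one u v hu hv)
  have h3 : ∑ i, (w i : ℂ) * partSum x y (matChar (vecMulVec u v)) i = 0 := by
    simp only [partSum, mul_left_comm _ ((Fintype.card F : ℂ) - 1), ← Finset.mul_sum]
    rw [h2, mul_zero]
  obtain ⟨k, hk⟩ := Nat.exists_eq_add_of_le' hσ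
  obtain ⟨q, hq⟩ : ∃ q : ℝ, (Fintype.card F : ℝ) = q := ⟨_, rfl⟩
  obtain ⟨a, ha⟩ : ∃ a : ℝ, q ^ D = a := ⟨_, rfl⟩
  obtain ⟨b, hb⟩ : ∃ b : ℝ, q ^ (N - D) = b := ⟨_, rfl⟩
  obtain ⟨n, hn⟩ : ∃ n : ℝ, q ^ (k + 1) = n := ⟨_, rfl⟩
  have hq1 : 1 < q := hq ▸ one_lt_card_real F
  have hn1 : 1 < n := hn ▸ one_lt_pow₀ hq1 (by omega)
  have ha0 : 0 < a := ha ▸ pow_pos (by linarith) _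
  have hb0 : 0 < b := hb ▸ pow_pos (by linarith) _
  have hm : q ^ Fintype.card σ = n * q := by rw [hk, pow_succ, hn]
  have hqc : (Fintype.card F : ℂ) = (q : ℂ) := by rw [← hq]; simp
  have hac : (q : ℂ) ^ D = (a : ℂ) := by exact_mod_cast ha
  have hbc : (q : ℂ) ^ (N - D) = (b : ℂ) := by exact_mod_cast hb
  have hmc : (q : ℂ) ^ Fintype.card σ = ((n * q : ℝ) : ℂ) := by exact_mod_cast hm
  obtain ⟨s0, s1, s2, s3, s4, s5⟩ := partSum_matChar hxy hP hQ (by omega) hσD hN hu hv hqc hac hbc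
    hmc (f := 1) (τ := 1) (α := 1) (β := 1) (by rw [hv']; simp) (by rw [hv']; simp)
    (if_pos hu') (if_pos hv')
  have hq0 : (q : ℂ) ≠ 0 := by exact_mod_cast (by linarith : q ≠ 0)
  have hq1c : (q : ℂ) - 1 ≠ 0 := by exact_mod_cast (by linarith : q - 1 ≠ 0)
  have hn0 : (n : ℂ) ≠ 0 := by exact_mod_cast (by linarith : n ≠ 0)
  obtain ⟨t, ht⟩ : ∃ t, partSum x y (matChar (vecMulVec u v)) = t := ⟨_, rfl⟩
  rw [ht] at s0 s1 s2 s3 s4 s5 h3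
  push_cast at s0 s1 s2 s3 s4 s5
  have e0 : t 0 = (n * q - 1) * n := by rw [s0]; field_simp; ring
  have e1 : t 1 = (n * q - 1) * (n - 1) := by rw [s1]; field_simp; ring
  have e2 : t 2 = (q - 2) * ((n * q - 1) * n) := by
    rw [eq_sub_iff_add_eq'.mpr s2, e0, e1]; field_simp; ring
  have e3 : t 3 = (n * q - 1) * (b - n * q) := by
    rw [eq_sub_iff_add_eq'.mpr s3, e0, e1, e2]; field_simp; ring
  have e4 : t 4 = (a - n * q) * (n * q - 1) := by
    rw [eq_sub_iff_add_eq'.mpr s4, e0, e1, e2]; field_simp; ring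
  have e5 : t 5 = (a - n * q) * (b - n * q) + (a * b / q - a * b) := by
    -- The term ab/q - ab is the deviation from the size of O₆ times q - 1.
    rw [eq_sub_iff_add_eq'.mpr s5, e0, e1, e2, e3, e4]; field_simp; ring
  have h4 : ∑ i, (w i : ℂ) * t i = (n * q - 1) * (n - 1) / (q - 1) * (a * b / q - a * b) := by
    rw [← hw, Fin.sum_univ_six, e0, e1, e2, e3, e4, e5]
    simp only [omegaCoeff, Matrix.cons_val]
    rw [hq, ha, hb, hm, hk]
    simp only [Nat.add_one_sub_one, hn]
    push_cast
    field_simp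
    ring
  rw [h3] at h4
  have h5 : (n * q - 1) * (n - 1) / (q - 1) * (a * b / q - a * b) = 0 := by exact_mod_cast h4.symm
  have h6 : a * b / q < a * b := div_lt_self (mul_pos ha0 hb0) hq1
  have h7 : 0 < (n * q - 1) * (n - 1) / (q - 1) :=
    div_pos (mul_pos (by nlinarith) (by linarith)) (by linarith)
  nlinarith

/-- The vector ω lies in S, so ω^⊥ = S would give ⟨ω, ω⟩ = 0; hence the complement is proper in a
space of dimension at most 6. -/
theorem finrank_omegaPerp_le (h : omegaVec x y ≠ 0) : Module.finrank ℝ (omegaPerp x y) ≤ 5 := by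
  have h1 : omegaPerp x y < subspaceS x y := by
    refine lt_of_le_of_ne (fun v hv => hv.1) fun he => h ?_
    have h2 : omegaVec x y ∈ subspaceS x y :=
      Submodule.sum_mem _ fun i _ => Submodule.smul_mem _ _ (Submodule.subset_span ⟨i, rfl⟩)
    rw [← he] at h2
    exact dotProduct_self_eq_zero.mp h2.2
  have h2 := Submodule.finrank_lt_finrank_of_lt h1
  have h3 : Module.finrank ℝ (subspaceS x y) ≤ 6 := by
    have := finrank_range_le_card (R := ℝ) fun i : Fin 6 =>
      matE (bilinearFormsGraph F D N) *ᵥ setVec (yPart x y i)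
    rwa [Fintype.card_fin] at this
  omega

theorem exists_basis_omegaPerp (h : omegaVec x y ≠ 0)
    {f : Fin 5 → Matrix (Fin D) (Fin (N - D)) F → ℝ} (hf : LinearIndependent ℝ f)
    (hm : ∀ l, f l ∈ omegaPerp x y) :
    ∃ b : Module.Basis (Fin 5) ℝ (omegaPerp x y),
      ∀ l, (b l : Matrix (Fin D) (Fin (N - D)) F → ℝ) = f l := by
  have hli : LinearIndependent ℝ fun l => (⟨f l, hm l⟩ : omegaPerp x y) :=
    LinearIndependent.of_comp (omegaPerp x y).subtype hf
  have hc : Fintype.card (Fin 5) = Module.finrank ℝ (omegaPerp x y) :=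
    le_antisymm hli.fintype_card_le_finrank ((finrank_omegaPerp_le h).trans_eq (by simp))
  exact ⟨basisOfLinearIndependentOfCardEqFinrank hli hc, fun l => by simp⟩

/-- Multiplication by `matChar a d` turns the character of -d into 1 and 1 into the character of d.
Wherever one of the three indicators is nonzero, `matChar a d` equals 1, so the indicators are
unchanged. -/
theorem matChar_mul_basicComb_neg (d : Matrix (Fin D) (Fin (N - D)) F) (c : Fin 5 → ℝ)
    (a : Matrix (Fin D) (Fin (N - D)) F) (ha : a.rank = 1) :
    matChar a d * basicComb (-d) c a = basicComb d ![c 4, c 1, c 2, c 3, c 0] a := by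
  obtain ⟨u, v, hu, hv, rfl⟩ := Matrix.exists_eq_vecMulVec_of_rank_eq_one a ha
  have h1 : matChar (vecMulVec u v) d * matChar (vecMulVec u v) (-d) = 1 := by
    rw [← matChar_add_right, add_neg_cancel, matChar_zero_right]
  have ht : u ⬝ᵥ (d *ᵥ v) = 0 → matChar (vecMulVec u v) d = 1 := fun h => by
    rw [matChar_vecMulVec_left, h, AddChar.map_zero_eq_one]
  have hα : u ᵥ* d = 0 → matChar (vecMulVec u v) d = 1 := fun h => ht (by
    rw [Matrix.dotProduct_mulVec, h, zero_dotProduct])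
  have hβ : d *ᵥ v = 0 → matChar (vecMulVec u v) d = 1 := fun h => ht (by
    rw [h, dotProduct_zero])
  simp only [basicComb, trace_transpose_vecMulVec_mul, transpose_vecMulVec_mul_eq_zero,
    vecMulVec_mul_transpose_eq_zero, hu, hv, false_or, Matrix.neg_mulVec, Matrix.vecMul_neg,
    dotProduct_neg, neg_eq_zero, Matrix.cons_val]
  have e : ∀ (p : Prop) [Decidable p], (p → matChar (vecMulVec u v) d = 1) →
      matChar (vecMulVec u v) d * (if p then 1 else 0) = if p then 1 else 0 := by
    intro p _ hp
    split_ifs with h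
    · rw [hp h, mul_one]
    · rw [mul_zero]
  have e1 := e _ ht
  have e2 := e _ hα
  have e3 := e _ hβ
  linear_combination (c 0 : ℂ) * h1 + (c 1 : ℂ) * e1 + (c 2 : ℂ) * e2 + (c 3 : ℂ) * e3

theorem exists_ofReal_nortonIter (x y : Matrix (Fin D) (Fin (N - D)) F)
    {b : Matrix (Fin D) (Fin (N - D)) F} (hb : b.rank = 1) (l : ℕ) :
    ∃ c : Fin 5 → ℝ, ∀ z, (nortonIter (bilinearFormsGraph F D N) x y l z : ℂ) =
      charTransform x (basicComb (y - x) c) z := by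
  obtain ⟨c, hc⟩ : ∃ c : Fin 5 → ℝ, (localStep (Fintype.card F)
      ((Fintype.card F : ℝ) ^ Fintype.card (Fin D))
      ((Fintype.card F : ℝ) ^ Fintype.card (Fin (N - D)))
      ((Fintype.card F : ℝ) ^ (y - x).rank))^[l] ![1, 0, 0, 0, 0] = c := ⟨_, rfl⟩
  refine ⟨((Fintype.card (Matrix (Fin D) (Fin (N - D)) F) : ℝ)⁻¹) ^ (l + 1) • c, fun z => ?_⟩
  rw [ofReal_nortonIter b hb, hc, charTransform, charTransform, Finset.mul_sum]
  refine Finset.sum_congr rfl fun a _ => ?_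
  rw [← mul_assoc]
  congr 1
  have := basicComb_linear {()} (y - x)
    (fun _ => ((Fintype.card (Matrix (Fin D) (Fin (N - D)) F) : ℝ)⁻¹) ^ (l + 1)) (fun _ => c) a
  simp only [Finset.sum_singleton] at this
  rw [this]
  push_cast
  rfl

theorem exists_ofReal_nortonIter_swap (x y : Matrix (Fin D) (Fin (N - D)) F)
    {b : Matrix (Fin D) (Fin (N - D)) F} (hb : b.rank = 1) (l : ℕ) :
    ∃ c : Fin 5 → ℝ, ∀ z, (nortonIter (bilinearFormsGraph F D N) y x l z : ℂ) =
      charTransform x (basicComb (y - x) c) z := by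
  obtain ⟨c, hc⟩ := exists_ofReal_nortonIter y x hb l
  refine ⟨![c 4, c 1, c 2, c 3, c 0], fun z => ?_⟩
  rw [hc, charTransform_base x y, ← neg_sub y x, charTransform_congr fun a ha =>
    matChar_mul_basicComb_neg (y - x) c a ha]

end Membership

theorem proposition12p7 {F : Type*} [Field F] [Fintype F] (hq : Fintype.card F ≠ 2)
    (D N : ℕ) (hD : 6 ≤ 2 * D) (hN : 2 * D < N)
    (x y : Matrix (Fin D) (Fin (N - D)) F)
    (hk₂ : 2 ≤ (bilinearFormsGraph F D N).dist x y)
    (hk : (bilinearFormsGraph F D N).dist x y ≤ D - 1) :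
    (∃ b : Module.Basis (Fin 5) ℝ (omegaPerp x y),
      ∀ l : Fin 5, (b l : Matrix (Fin D) (Fin (N - D)) F → ℝ) =
        nortonIter (bilinearFormsGraph F D N) x y l) ∧
    (∃ b : Module.Basis (Fin 5) ℝ (omegaPerp x y),
      ∀ l : Fin 5, (b l : Matrix (Fin D) (Fin (N - D)) F → ℝ) =
        nortonIter (bilinearFormsGraph F D N) y x l) := by
  classical
  rw [bilinearFormsGraph_dist, Matrix.rank_sub_rev] at hk hk₂
  obtain ⟨P, Q, hxy, hP, hQ⟩ := Matrix.exists_rank_factorization (y - x)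
  -- Any rank-one matrix serves: its existence identifies θ₁ with the eigenvalue of the rank-one
  -- characters.
  obtain ⟨b, hb, -⟩ := Matrix.exists_rank_one_sub (y - x) ((y - x).rank - 1) (by omega)
  have hσ : Fintype.card (Fin (y - x).rank) = (y - x).rank := Fintype.card_fin _
  have hω : omegaVec x y ≠ 0 := omegaVec_ne_zero hxy hP hQ (by omega) (by omega) hN hb
  refine ⟨exists_basis_omegaPerp hω (linearIndependent_nortonIter hq x y hN (by omega) (by omega))
    fun l => ?_, exists_basis_omegaPerp hω (linearIndependent_nortonIter hq y x hN
      (by rw [Matrix.rank_sub_rev]; omega) (by rw [Matrix.rank_sub_rev]; omega)) fun l => ?_⟩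
  · obtain ⟨c, hc⟩ := exists_ofReal_nortonIter x y hb l
    exact mem_omegaPerp hxy hP hQ (by omega) (by omega) hN hb hc
  · obtain ⟨c, hc⟩ := exists_ofReal_nortonIter_swap x y hb l
    exact mem_omegaPerp hxy hP hQ (by omega) (by omega) hN hb hc
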